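/- An instance of $k$-CSP$(\mathcal A)$ consists of a finite set $V$ of $n$ interval variables, a finite list $C$ of binary constraints $R(u,v)$ with $u,v\in V$, where each $R$ is a union of some of the thirteen atomic relations of Allen's interval algebra, and a number $k\in\mathbb N$. An assignment maps every variable $u$ to a real interval with end-points $u^-<u^+$. Two intervals $I,J$ overlap if some point $x$ satisfies $I^-<x<I^+$ and $J^-<x<J^+$. The question is whether there is an assignment that satisfies all constraints and in which, for every variable, fewer than $k$ other variables are assigned intervals that overlap with its interval. Let $x$ be the binary word encoding $(V,C)$ (every variable is listed, so $|x|\ge n$); the problem is a set of triples $(x,n,k)$ with parameters $n=|V|$ and $k$. The solutions to be counted are the ordered partitions $(S_1,\dots,S_\ell)$ of the set of all $2n$ start- and end-points for which the ranking function $r$ ($r(p)=i$ iff $p\in S_i$), regarded as an assignment $u\mapsto(r(u^-),r(u^+))$, is such an assignment. Time is the running time on a deterministic random access machine with logarithmic cost. **Theorem.** The problem $k$-CSP$(\mathcal A)$ can be decided, and the number of its solutions can be computed, in time $$(2nk)^{2k}\cdot 2^n\cdot |x|^{O(1)}$$ (where, in the degenerate case $n=0$, the base $2nk$ is read as $2k$,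 and $0^0=1$). Consequently $k$-CSP$(\mathcal A)$ belongs to $\mathbf{FPE}$, the class of sets $L\subseteq\{0,1\}^*\times\mathbb N\times\mathbb N$ whose membership problem is solvable, on every input $(x,n,k)$, in time $f(k)\cdot 2^{O(n)}\cdot|x|^{O(1)}$ for some computable $f:\mathbb N\to\mathbb N$. -/

import Mathlib

/-! ### The machine model: a random access machine with logarithmic cost

A machine has registers and arrays of registers, all holding natural numbers.  A program names
finitely many registers and arrays; cells of an array are addressed by computed indices.
Every operation is charged according to the bit lengths of the numbers and addresses it touches:
linearly for reading, writing, addition and subtraction, and by the schoolbook bound (product of the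
lengths) for multiplication and division. -/

/-- A memory configuration: the registers, and the arrays (array name, index). -/
structure RamState where
  reg : ℕ → ℕ
  mem : ℕ → ℕ → ℕ

/-- Arithmetic expressions: constants, registers, array cells, and arithmetic on naturals
(truncated subtraction; division and remainder by zero as for `Nat`). -/
inductive RamExpr where
  | const (c : ℕ)
  | reg (r : ℕ)
  | mem (a : ℕ) (i : RamExpr)
  | add (e₁ e₂ : RamExpr)
  | sub (e₁ e₂ : RamExpr)
  | mul (e₁ e₂ : RamExpr)
  | div (e₁ e₂ : RamExpr)
  | mod (e₁ e₂ : RamExpr)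

namespace RamExpr

/-- The value of an expression in a state. -/
def eval (s : RamState) : RamExpr → ℕ
  | const c => c
  | reg r => s.reg r
  | mem a i => s.mem a (i.eval s)
  | add e₁ e₂ => e₁.eval s + e₂.eval s
  | sub e₁ e₂ => e₁.eval s - e₂.eval s
  | mul e₁ e₂ => e₁.eval s * e₂.eval s
  | div e₁ e₂ => e₁.eval s / e₂.eval s
  | mod e₁ e₂ => e₁.eval s % e₂.eval s

/-- The cost of evaluating an expression; `Nat.size` is the bit length. -/
def cost (s : RamState) : RamExpr → ℕ
  | const c => c.size + 1
  | reg r => (s.reg r).size + 1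
  | mem a i => i.cost s + (i.eval s).size + (s.mem a (i.eval s)).size + 1
  | add e₁ e₂ => e₁.cost s + e₂.cost s + (e₁.eval s).size + (e₂.eval s).size + 1
  | sub e₁ e₂ => e₁.cost s + e₂.cost s + (e₁.eval s).size + (e₂.eval s).size + 1
  | mul e₁ e₂ => e₁.cost s + e₂.cost s + ((e₁.eval s).size + 1) * ((e₂.eval s).size + 1)
  | div e₁ e₂ => e₁.cost s + e₂.cost s + ((e₁.eval s).size + 1) * ((e₂.eval s).size + 1)
  | mod e₁ e₂ => e₁.cost s + e₂.cost s + ((e₁.eval s).size + 1) * ((e₂.eval s).size + 1)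

end RamExpr

/-- Programs. A test succeeds if its expression is nonzero. -/
inductive RamProg where
  | skip
  | set (r : ℕ) (e : RamExpr)
  | store (a : ℕ) (i e : RamExpr)
  | seq (P Q : RamProg)
  | ite (e : RamExpr) (P Q : RamProg)
  | while (e : RamExpr) (P : RamProg)

/-- `RamProg.Run P s s' t`: started in `s`, the program `P` halts in `s'` after time `t`. -/
inductive RamProg.Run : RamProg → RamState → RamState → ℕ → Prop
  | skip (s : RamState) : Run .skip s s 1
  | set (s : RamState) (r : ℕ) (e : RamExpr) :
      Run (.set r e) s ⟨Function.update s.reg r (e.eval s), s.mem⟩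
        (e.cost s + (e.eval s).size + 1)
  | store (s : RamState) (a : ℕ) (i e : RamExpr) :
      Run (.store a i e) s
        ⟨s.reg, Function.update s.mem a (Function.update (s.mem a) (i.eval s) (e.eval s))⟩
        (i.cost s + e.cost s + (i.eval s).size + (e.eval s).size + 1)
  | seq {P Q : RamProg} {s s' s'' : RamState} {t t' : ℕ} :
      Run P s s' t → Run Q s' s'' t' → Run (.seq P Q) s s'' (t + t' + 1)
  | ite_true {e : RamExpr} {P Q : RamProg} {s s' : RamState} {t : ℕ} :
      e.eval s ≠ 0 → Run P s s' t → Run (.ite e P Q) s s' (e.cost s + t + 1)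
  | ite_false {e : RamExpr} {P Q : RamProg} {s s' : RamState} {t : ℕ} :
      e.eval s = 0 → Run Q s s' t → Run (.ite e P Q) s s' (e.cost s + t + 1)
  | while_true {e : RamExpr} {P : RamProg} {s s' s'' : RamState} {t t' : ℕ} :
      e.eval s ≠ 0 → Run P s s' t → Run (.while e P) s' s'' t' →
      Run (.while e P) s s'' (e.cost s + t + t' + 1)
  | while_false {e : RamExpr} {P : RamProg} {s : RamState} :
      e.eval s = 0 → Run (.while e P) s s (e.cost s + 1)

/-- The model is deterministic: final state and running time are determined by the start. -/
theorem RamProg.Run.deterministic {P : RamProg} {s s₁ s₂ : RamState} {t₁ t₂ : ℕ}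
    (h₁ : P.Run s s₁ t₁) (h₂ : P.Run s s₂ t₂) : s₁ = s₂ ∧ t₁ = t₂ := by
  induction h₁ generalizing s₂ t₂ with
  | skip => cases h₂; exact ⟨rfl, rfl⟩
  | set => cases h₂; exact ⟨rfl, rfl⟩
  | store => cases h₂; exact ⟨rfl, rfl⟩
  | seq _ _ ih ih' =>
    cases h₂ with
    | seq a b =>
      obtain ⟨rfl, rfl⟩ := ih a
      obtain ⟨rfl, rfl⟩ := ih' b
      exact ⟨rfl, rfl⟩
  | ite_true h _ ih =>
    cases h₂ with
    | ite_true _ a => obtain ⟨rfl, rfl⟩ := ih a; exact ⟨rfl, rfl⟩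
    | ite_false h' _ => exact absurd h' h
  | ite_false h _ ih =>
    cases h₂ with
    | ite_true h' _ => exact absurd h h'
    | ite_false _ a => obtain ⟨rfl, rfl⟩ := ih a; exact ⟨rfl, rfl⟩
  | while_true h _ _ ih ih' =>
    cases h₂ with
    | while_true _ a b =>
      obtain ⟨rfl, rfl⟩ := ih a
      obtain ⟨rfl, rfl⟩ := ih' b
      exact ⟨rfl, rfl⟩
    | while_false h' => exact absurd h' h
  | while_false h =>
    cases h₂ with
    | while_true h' _ _ => exact absurd h h'
    | while_false _ => exact ⟨rfl, rfl⟩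

/-! ### Bi-parameterized problems and the class FPE -/

/-- A bi-parameterized problem: a set of triples `(x, n, k)` of a word over a finite alphabet
(here `Bool`), the fine-grained parameter `n` and the coarse-grained parameter `k`. -/
abbrev BiParamProblem : Type := Set (List Bool × ℕ × ℕ)

/-- The initial state on input `(x, n, k)`: registers 0, 1, 2 hold `|x|`, `n`, `k`, array 0 holds
the symbols of `x`, and everything else is zero. -/
def RamState.init (x : List Bool) (n k : ℕ) : RamState where
  reg r := if r = 0 then x.length else if r = 1 then n else if r = 2 then k else 0
  mem a i := if a = 0 ∧ x[i]? = some true then 1 else 0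

/-- The function `F` is computed by one program which on every input `(x, n, k)` halts within time
`T x n k` with the value in register 0. -/
def ComputableInTime (F : List Bool → ℕ → ℕ → ℕ) (T : List Bool → ℕ → ℕ → ℕ) : Prop :=
  ∃ P : RamProg, ∀ (x : List Bool) (n k : ℕ), ∃ (s : RamState) (t : ℕ),
    P.Run (RamState.init x n k) s t ∧ s.reg 0 = F x n k ∧ t ≤ T x n k

open Classical in
/-- The problem `L` is decided within time `T`: its indicator function is computable in that
time. -/
def SolvableInTime (L : BiParamProblem) (T : List Bool → ℕ → ℕ → ℕ) : Prop :=
  ComputableInTime (fun x n k => if (x, n, k) ∈ L then 1 else 0) T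

/-- The class FPE: problems solvable in time `f(k) * 2 ^ O(n) * |x| ^ O(1)`, with `f` computable. -/
def FPE : Set BiParamProblem :=
  {L | ∃ f : ℕ → ℕ, Computable f ∧ ∃ (c : ℕ) (p : Polynomial ℕ),
    SolvableInTime L fun x n k => f k * 2 ^ (c * n) * p.eval x.length}

/-! ### Allen's interval algebra -/

/-- An interval on the line, given by its start-point and its end-point. -/
structure LineInterval where
  lo : ℝ
  hi : ℝ
  lo_lt_hi : lo < hi

/-- Two intervals overlap if some point lies strictly inside both. -/
def LineInterval.Overlaps (I J : LineInterval) : Prop :=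
  ∃ x : ℝ, (I.lo < x ∧ x < I.hi) ∧ (J.lo < x ∧ x < J.hi)

/-- The thirteen atomic relations; a trailing `i` (`Inv`) denotes the converse. -/
inductive AllenAtom where
  | precedes | precededBy
  | equals
  | meets | metBy
  | overlaps | overlappedBy
  | starts | startedBy
  | during | contains
  | finishes | finishedBy
  deriving DecidableEq

/-- The meaning of the atomic relations, as relations between two intervals `I` and `J`. -/
def AllenAtom.Holds (I J : LineInterval) : AllenAtom → Prop
  | precedes => I.hi < J.lo
  | precededBy => J.hi < I.lo
  | equals => I.lo = J.lo ∧ I.hi = J.hi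
  | meets => I.hi = J.lo
  | metBy => J.hi = I.lo
  | overlaps => I.lo < J.lo ∧ J.lo < I.hi ∧ I.hi < J.hi
  | overlappedBy => J.lo < I.lo ∧ I.lo < J.hi ∧ J.hi < I.hi
  | starts => I.lo = J.lo ∧ I.hi < J.hi
  | startedBy => I.lo = J.lo ∧ J.hi < I.hi
  | during => J.lo < I.lo ∧ I.hi < J.hi
  | contains => I.lo < J.lo ∧ J.hi < I.hi
  | finishes => J.lo < I.lo ∧ I.hi = J.hi
  | finishedBy => I.lo < J.lo ∧ I.hi = J.hi

/-- A fixed enumeration of the atoms, used to encode sets of atoms by 13 bits. -/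
def AllenAtom.enumeration : List AllenAtom :=
  [precedes, precededBy, equals, meets, metBy, overlaps, overlappedBy, starts, startedBy,
    during, contains, finishes, finishedBy]

/-- A constraint `R(u, v)` on `n` variables, where `R` is a union of atomic relations. -/
structure AllenConstraint (n : ℕ) where
  fst : Fin n
  snd : Fin n
  rel : Finset AllenAtom

/-- The assignment `f` satisfies all constraints of the instance `(Fin n, C)`. -/
def Satisfies {n : ℕ} (C : List (AllenConstraint n)) (f : Fin n → LineInterval) : Prop :=
  ∀ c ∈ C, ∃ a ∈ c.rel, a.Holds (f c.fst) (f c.snd)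

/-- No interval overlaps with `k` or more other intervals. -/
def OverlapsFewerThan {n : ℕ} (k : ℕ) (f : Fin n → LineInterval) : Prop :=
  ∀ u : Fin n, {v : Fin n | v ≠ u ∧ (f u).Overlaps (f v)}.ncard < k

/-- The number `m` in binary with `w` digits, least significant digit first. -/
def binaryDigits (w m : ℕ) : List Bool := (List.range w).map fun i => m.testBit i

/-- A constraint as a word: two variables in binary, and the 13 bits of its relation. -/
def AllenConstraint.encode {n : ℕ} (c : AllenConstraint n) : List Bool :=
  binaryDigits n.size c.fst ++ binaryDigits n.size c.snd ++
    AllenAtom.enumeration.map fun a => decide (a ∈ c.rel)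

/-- The instance with variables `Fin n` and constraints `C` as a word: a symbol for each variable, a
separator, and the list of the constraints. -/
def encodeInstance (n : ℕ) (C : List (AllenConstraint n)) : List Bool :=
  List.replicate n true ++ false :: C.flatMap AllenConstraint.encode

/-- The problem `k`-CSP(𝒜), parameterized by the number `n` of variables and by `k`: is there a
satisfying assignment in which no interval overlaps with `k` or more others? -/
def kCSPAllen : BiParamProblem :=
  {(x, n, k) | ∃ C : List (AllenConstraint n), x = encodeInstance n C ∧
    ∃ f : Fin n → LineInterval, Satisfies C f ∧ OverlapsFewerThan k f}

/-! ### Ordered partitions and the counting problem -/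

/-- An ordered partition of `S`: a finite sequence of non-empty sets partitioning `S`. -/
structure OrderedPartition (S : Type) where
  parts : List (Finset S)
  nonempty : ∀ A ∈ parts, A.Nonempty
  disjoint : parts.Pairwise Disjoint
  cover : ∀ x : S, ∃ A ∈ parts, x ∈ A

/-- A finite set has finitely many ordered partitions. -/
instance OrderedPartition.finite (S : Type) [Finite S] : Finite (OrderedPartition S) := by
  classical
  cases nonempty_fintype S
  refine Finite.of_injective
    (fun π : OrderedPartition S => (⟨π.parts, ?_⟩ : {l : List (Finset S) // l.Nodup})) ?_
  · refine List.Pairwise.imp_of_mem (fun {A B} hA _ h hAB => ?_) π.disjoint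
    subst hAB
    exact (π.nonempty A hA).ne_empty (disjoint_self.mp h)
  · rintro ⟨l, _, _, _⟩ ⟨l', _, _, _⟩ h
    cases congrArg Subtype.val h
    rfl

open Classical in
/-- The ranking function: the (1-based) position of the part that contains `x`. -/
noncomputable def OrderedPartition.rank {S : Type} (π : OrderedPartition S) (x : S) : ℕ :=
  π.parts.findIdx (fun A => decide (x ∈ A)) + 1

/-- An ordered partition of the set of start-points (`Sum.inl u`) and end-points (`Sum.inr u`) of the
variables is a solution if the ranks of the end-points form a satisfying assignment in which no
interval overlaps with `k` or more others. -/
def OrderedPartition.IsSolution {n : ℕ} (C : List (AllenConstraint n)) (k : ℕ)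
    (π : OrderedPartition (Fin n ⊕ Fin n)) : Prop :=
  ∃ f : Fin n → LineInterval,
    (∀ u, (f u).lo = π.rank (.inl u) ∧ (f u).hi = π.rank (.inr u)) ∧
    Satisfies C f ∧ OverlapsFewerThan k f

/-- The number of solutions (ordered partitions) of the instance encoded by `x`; it is `0` if `x`
does not encode an instance with `n` variables. -/
noncomputable def kCSPAllenCount (x : List Bool) (n k : ℕ) : ℕ :=
  Nat.card {π : OrderedPartition (Fin n ⊕ Fin n) //
    ∃ C : List (AllenConstraint n), x = encodeInstance n C ∧ π.IsSolution C k}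

/-!
The solutions are counted by a dynamic program over a left-to-right sweep of the line.

An ordered partition of the `2 n` end-points is read as a word over `2 n + 1` letters: a letter
`c < 2 n` puts the point `c` into the current part, and the letter `2 n` closes the current part.
With the points of each part in increasing order, every partial ordered partition is reached by
exactly one word (`stepPair_injective`, `exists_pred`). What matters for the continuation is a small
*state*: for every variable whether it has started or ended, before or within the current part, and
for the variables that had started but not ended before the current part the order of their
start-points and the number of their overlaps so far. The state decides whether the next letter is
compatible with the constraints and the bound on overlaps (`isValid_step_iff`), and determines the
next state (`stepDigits_stateDigits`). When a part is closed, the atomic relation of each pair that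
becomes settled can be read off (`settledAtom_stateDigits`). Hence the number of valid partial
ordered partitions with a given state satisfies a recursion along the letters (`stateCount_succ`),
and the number of solutions is a sum over final states (`card_isSolution`, `card_finalSet`).

Variables that are open at the same moment overlap pairwise, so at most `k` of them are old and at
most `k` are new. A state is therefore described by one bit per variable and `2 k` slots, each
naming a variable, together with two numbers below `k` for an old one. This gives at most
`(2 n + 1) * 2 ^ n * ((n + 1) * k) ^ (2 * k)` states (`card_layerStates_le`), which is where the time
bound comes from. Only the order of the end-points matters for the constraints, so a real
assignment exists if and only if the number of solutions is not zero (`exists_isSolution_iff`).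

The machine program is obtained in two steps. States are coded as numbers in base `2 n + 5`, and the
transition function, the test for final states and the test for valid inputs are written as
arithmetic terms with bounded sums and products. These are compiled to programs that run in
polynomial time (`ArithTerm.compile_reaches`). The dynamic program itself consists of three nested
loops around the transition program, with a queue of the states met and a table of their counts
(`layersProg_reaches`).

For membership in FPE, `n ^ (2 k)` is at most `2 ^ n` times a computable function of `k`
(`pow_le_mul_two_pow`).
-/

/-! ### Running programs within a time bound -/

/-- Started in `s`, the program `P` halts in `s'` within time `T`. -/
def RamProg.Reaches (P : RamProg) (s s' : RamState) (T : ℕ) : Prop := ∃ t ≤ T, P.Run s s' t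

/-- The state after writing `v` into register `r`. -/
def RamState.setReg (s : RamState) (r v : ℕ) : RamState := ⟨Function.update s.reg r v, s.mem⟩

/-- The state after writing `v` into cell `i` of array `a`. -/
def RamState.setMem (s : RamState) (a i v : ℕ) : RamState :=
  ⟨s.reg, Function.update s.mem a (Function.update (s.mem a) i v)⟩

namespace RamState

@[simp] theorem reg_setReg (s : RamState) (r v q : ℕ) :
    (s.setReg r v).reg q = if q = r then v else s.reg q := by
  simp [setReg, Function.update_apply]

@[simp] theorem mem_setReg (s : RamState) (r v : ℕ) : (s.setReg r v).mem = s.mem := rfl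

@[simp] theorem reg_setMem (s : RamState) (a i v : ℕ) : (s.setMem a i v).reg = s.reg := rfl

@[simp] theorem mem_setMem (s : RamState) (a i v c j : ℕ) :
    (s.setMem a i v).mem c j = if c = a ∧ j = i then v else s.mem c j := by
  by_cases h : c = a
  · subst h; simp [setMem, Function.update_apply]
  · simp [setMem, h]

end RamState

namespace RamExpr

/-- All numbers that occur in the evaluation of the expression have at most `b` bits. -/
def Fits (b : ℕ) (s : RamState) : RamExpr → Prop
  | const c => c.size ≤ b
  | reg r => (s.reg r).size ≤ b
  | mem a i => i.Fits b s ∧ (s.mem a (i.eval s)).size ≤ b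
  | add e f => e.Fits b s ∧ f.Fits b s ∧ (e.eval s + f.eval s).size ≤ b
  | sub e f => e.Fits b s ∧ f.Fits b s
  | mul e f => e.Fits b s ∧ f.Fits b s ∧ (e.eval s * f.eval s).size ≤ b
  | div e f => e.Fits b s ∧ f.Fits b s
  | mod e f => e.Fits b s ∧ f.Fits b s

/-- The number of nodes of an expression. -/
def nodes : RamExpr → ℕ
  | const _ => 1
  | reg _ => 1
  | mem _ i => i.nodes + 1
  | add e f => e.nodes + f.nodes + 1
  | sub e f => e.nodes + f.nodes + 1
  | mul e f => e.nodes + f.nodes + 1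
  | div e f => e.nodes + f.nodes + 1
  | mod e f => e.nodes + f.nodes + 1

theorem Fits.size_eval_le {b : ℕ} {s : RamState} {e : RamExpr} (h : e.Fits b s) :
    (e.eval s).size ≤ b := by
  induction e with
  | const c => exact h
  | reg r => exact h
  | mem a i => exact h.2
  | add e f => exact h.2.2
  | sub e f ihe ihf => exact (Nat.size_le_size (Nat.sub_le _ _)).trans (ihe h.1)
  | mul e f => exact h.2.2
  | div e f ihe ihf => exact (Nat.size_le_size (Nat.div_le_self _ _)).trans (ihe h.1)
  | mod e f ihe ihf => exact (Nat.size_le_size (Nat.mod_le _ _)).trans (ihe h.1)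

theorem Fits.cost_le {b : ℕ} {s : RamState} {e : RamExpr} (h : e.Fits b s) :
    e.cost s ≤ e.nodes * (b + 1) ^ 2 := by
  have key : ∀ x y : ℕ, x ≤ b → y ≤ b → (x + 1) * (y + 1) ≤ (b + 1) ^ 2 := fun x y hx hy => by
    rw [pow_two]; gcongr
  have key' : b + b + 1 ≤ (b + 1) ^ 2 := by nlinarith
  induction e with
  | const c => simp only [Fits, cost, nodes] at *; nlinarith
  | reg r => simp only [Fits, cost, nodes] at *; nlinarith
  | mem a i ih =>
    have := ih h.1; have h1 := h.1.size_eval_le; have h2 := h.2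
    simp only [cost, nodes, add_mul] at *; omega
  | add e f ihe ihf =>
    have := ihe h.1; have := ihf h.2.1
    have := h.1.size_eval_le; have := h.2.1.size_eval_le
    simp only [cost, nodes, add_mul] at *; omega
  | sub e f ihe ihf =>
    have := ihe h.1; have := ihf h.2
    have := h.1.size_eval_le; have := h.2.size_eval_le
    simp only [cost, nodes, add_mul] at *; omega
  | mul e f ihe ihf =>
    have := ihe h.1; have := ihf h.2.1
    have := key _ _ h.1.size_eval_le h.2.1.size_eval_le
    simp only [cost, nodes, add_mul] at *; omega
  | div e f ihe ihf =>
    have := ihe h.1; have := ihf h.2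
    have := key _ _ h.1.size_eval_le h.2.size_eval_le
    simp only [cost, nodes, add_mul] at *; omega
  | mod e f ihe ihf =>
    have := ihe h.1; have := ihf h.2
    have := key _ _ h.1.size_eval_le h.2.size_eval_le
    simp only [cost, nodes, add_mul] at *; omega

end RamExpr

namespace RamProg.Reaches

theorem mono {P : RamProg} {s s' : RamState} {T T' : ℕ} (h : P.Reaches s s' T) (hT : T ≤ T') :
    P.Reaches s s' T' :=
  let ⟨t, ht, hr⟩ := h
  ⟨t, ht.trans hT, hr⟩

theorem skip (s : RamState) : RamProg.skip.Reaches s s 1 := ⟨1, le_rfl, .skip s⟩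

theorem set {b : ℕ} {s : RamState} {e : RamExpr} (r : ℕ) (h : e.Fits b s) :
    (RamProg.set r e).Reaches s (s.setReg r (e.eval s)) ((e.nodes + 1) * (b + 1) ^ 2) := by
  refine ⟨_, ?_, .set s r e⟩
  have h1 := h.cost_le
  have h2 := h.size_eval_le
  nlinarith

theorem store {b : ℕ} {s : RamState} {i e : RamExpr} (a : ℕ) (hi : i.Fits b s) (he : e.Fits b s) :
    (RamProg.store a i e).Reaches s (s.setMem a (i.eval s) (e.eval s))
      ((i.nodes + e.nodes + 1) * (b + 1) ^ 2) := by
  refine ⟨_, ?_, .store s a i e⟩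
  have h1 := hi.cost_le
  have h2 := hi.size_eval_le
  have h3 := he.cost_le
  have h4 := he.size_eval_le
  nlinarith

theorem seq {P Q : RamProg} {s s' s'' : RamState} {T T' : ℕ} (h : P.Reaches s s' T)
    (h' : Q.Reaches s' s'' T') : (RamProg.seq P Q).Reaches s s'' (T + T' + 1) :=
  let ⟨_, ht, hr⟩ := h
  let ⟨_, ht', hr'⟩ := h'
  ⟨_, by omega, .seq hr hr'⟩

theorem ite_pos {b : ℕ} {e : RamExpr} {P Q : RamProg} {s s' : RamState} {T : ℕ}
    (he : e.Fits b s) (h0 : e.eval s ≠ 0) (h : P.Reaches s s' T) :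
    (RamProg.ite e P Q).Reaches s s' (e.nodes * (b + 1) ^ 2 + T + 1) :=
  let ⟨_, ht, hr⟩ := h
  ⟨_, by have := he.cost_le; omega, .ite_true h0 hr⟩

theorem ite_neg {b : ℕ} {e : RamExpr} {P Q : RamProg} {s s' : RamState} {T : ℕ}
    (he : e.Fits b s) (h0 : e.eval s = 0) (h : Q.Reaches s s' T) :
    (RamProg.ite e P Q).Reaches s s' (e.nodes * (b + 1) ^ 2 + T + 1) :=
  let ⟨_, ht, hr⟩ := h
  ⟨_, by have := he.cost_le; omega, .ite_false h0 hr⟩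

/-- A loop that makes `N` passes, described by an invariant indexed by the number of passes made. -/
theorem while_loop {b : ℕ} {e : RamExpr} {P : RamProg} (Inv : ℕ → RamState → Prop) {N T : ℕ}
    (hstep : ∀ i < N, ∀ s, Inv i s → e.Fits b s ∧ e.eval s ≠ 0 ∧
      ∃ s', P.Reaches s s' T ∧ Inv (i + 1) s')
    (hend : ∀ s, Inv N s → e.Fits b s ∧ e.eval s = 0) {s : RamState} (h0 : Inv 0 s) :
    ∃ s', (RamProg.while e P).Reaches s s' ((N + 1) * (e.nodes * (b + 1) ^ 2 + T + 1)) ∧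
      Inv N s' := by
  suffices H : ∀ M i s, i + M = N → Inv i s →
      ∃ s', (RamProg.while e P).Reaches s s' ((M + 1) * (e.nodes * (b + 1) ^ 2 + T + 1)) ∧
        Inv N s' from H N 0 s (by omega) h0
  intro M
  induction M with
  | zero =>
    intro i s hi hs
    obtain rfl : i = N := by omega
    obtain ⟨h1, h2⟩ := hend s hs
    exact ⟨s, ⟨_, by have := h1.cost_le; omega, .while_false h2⟩, hs⟩
  | succ M ih =>
    intro i s hi hs
    obtain ⟨h1, h2, s', ⟨t, ht, hr⟩, hs'⟩ := hstep i (by omega) s hs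
    obtain ⟨s'', ⟨t', ht', hr'⟩, hs''⟩ := ih (i + 1) s' (by omega) hs'
    refine ⟨s'', ⟨_, ?_, .while_true h2 hr hr'⟩, hs''⟩
    have := h1.cost_le
    rw [add_mul (M + 1) 1]
    omega

end RamProg.Reaches

/-! ### Functions of polynomial growth -/

/-- The function is bounded by a polynomial. -/
def PolyBounded (f : ℕ → ℕ) : Prop := ∃ K : ℕ, ∀ b, f b ≤ (b + 2) ^ K

namespace PolyBounded

theorem const (c : ℕ) : PolyBounded fun _ => c :=
  ⟨c, fun b => (Nat.lt_two_pow_self (n := c)).le.trans (Nat.pow_le_pow_left (by omega) c)⟩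

theorem id : PolyBounded fun b => b := ⟨1, fun b => by simp⟩

theorem add {f g : ℕ → ℕ} (hf : PolyBounded f) (hg : PolyBounded g) :
    PolyBounded fun b => f b + g b := by
  obtain ⟨K, hK⟩ := hf
  obtain ⟨M, hM⟩ := hg
  refine ⟨K + M + 1, fun b => ?_⟩
  have h1 : (b + 2) ^ K ≤ (b + 2) ^ (K + M) := Nat.pow_le_pow_right (by omega) (by omega)
  have h2 : (b + 2) ^ M ≤ (b + 2) ^ (K + M) := Nat.pow_le_pow_right (by omega) (by omega)
  have h3 := hK b
  have h4 := hM b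
  rw [pow_succ]
  nlinarith

theorem mul {f g : ℕ → ℕ} (hf : PolyBounded f) (hg : PolyBounded g) :
    PolyBounded fun b => f b * g b := by
  obtain ⟨K, hK⟩ := hf
  obtain ⟨M, hM⟩ := hg
  exact ⟨K + M, fun b => by rw [pow_add]; exact Nat.mul_le_mul (hK b) (hM b)⟩

theorem pow {f : ℕ → ℕ} (hf : PolyBounded f) (m : ℕ) : PolyBounded fun b => f b ^ m := by
  obtain ⟨K, hK⟩ := hf
  exact ⟨K * m, fun b => by rw [pow_mul]; exact Nat.pow_le_pow_left (hK b) m⟩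

theorem comp {f g : ℕ → ℕ} (hf : PolyBounded f) (hg : PolyBounded g) :
    PolyBounded fun b => f (g b) := by
  obtain ⟨K, hK⟩ := hf
  obtain ⟨M, hM⟩ := (hg.add (const 2)).pow K
  exact ⟨M, fun b => (hK _).trans (hM b)⟩

theorem exists_polynomial {f : ℕ → ℕ} (hf : PolyBounded f) :
    ∃ p : Polynomial ℕ, ∀ b, f b ≤ p.eval b := by
  obtain ⟨K, hK⟩ := hf
  exact ⟨(Polynomial.X + 2) ^ K, fun b => by simpa using hK b⟩

end PolyBounded

/-! ### A language of polynomial-time arithmetic terms -/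

/-- The arithmetic operations of the machine. -/
inductive ArithOp where
  | add | sub | mul | div | mod

/-- The value of an arithmetic operation. -/
def ArithOp.eval : ArithOp → ℕ → ℕ → ℕ
  | add, x, y => x + y
  | sub, x, y => x - y
  | mul, x, y => x * y
  | div, x, y => x / y
  | mod, x, y => x % y

/-- The machine expression for an arithmetic operation. -/
def ArithOp.expr : ArithOp → RamExpr → RamExpr → RamExpr
  | add => .add
  | sub => .sub
  | mul => .mul
  | div => .div
  | mod => .mod

/-- Arithmetic terms with bounded sums and products.  The leaves are constants, five parameters (the
only possible bounds of sums and products), variables as de Bruijn indices, and input symbols. -/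
inductive ArithTerm where
  | const (c : ℕ)
  | par (i : Fin 5)
  | var (i : ℕ)
  | inp (e : ArithTerm)
  | op (o : ArithOp) (e f : ArithTerm)
  | sum (i : Fin 5) (e : ArithTerm)
  | prod (i : Fin 5) (e : ArithTerm)

/-- The stack `σ` with `a` pushed on top. -/
def pushVal (a : ℕ) (σ : ℕ → ℕ) : ℕ → ℕ
  | 0 => a
  | i + 1 => σ i

@[simp] theorem pushVal_zero (a : ℕ) (σ : ℕ → ℕ) : pushVal a σ 0 = a := rfl

@[simp] theorem pushVal_succ (a : ℕ) (σ : ℕ → ℕ) (i : ℕ) : pushVal a σ (i + 1) = σ i := rfl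

namespace ArithTerm

/-- The value of a term for given parameters, input and values of the variables. -/
def eval (p : Fin 5 → ℕ) (A : ℕ → ℕ) (σ : ℕ → ℕ) : ArithTerm → ℕ
  | const c => c
  | par i => p i
  | var i => σ i
  | inp e => A (e.eval p A σ)
  | op o e f => o.eval (e.eval p A σ) (f.eval p A σ)
  | sum i e => ∑ x ∈ Finset.range (p i), e.eval p A (pushVal x σ)
  | prod i e => ∏ x ∈ Finset.range (p i), e.eval p A (pushVal x σ)

/-- The loop that folds the values of a subprogram over a range: register `j` accumulates, `j + 1`
counts, and the subprogram leaves its value in register `j + 2`. -/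
def foldLoop (o : ArithOp) (start : ℕ) (i j : ℕ) (P : RamProg) : RamProg :=
  .seq (.set j (.const start)) <| .seq (.set (j + 1) (.const 0)) <|
    .while (.sub (.reg i) (.reg (j + 1))) <| .seq P <|
      .seq (.set j (o.expr (.reg j) (.reg (j + 2)))) (.set (j + 1) (.add (.reg (j + 1)) (.const 1)))

/-- The program that computes a term into register `j`, using only registers from `j` on; the
parameters are in registers `0` to `4`, the variable `i` is in register `ρ i`. -/
def compile : (ℕ → ℕ) → ℕ → ArithTerm → RamProg
  | _, j, const c => .set j (.const c)
  | _, j, par i => .set j (.reg i)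
  | ρ, j, var i => .set j (.reg (ρ i))
  | ρ, j, inp e => .seq (e.compile ρ j) (.set j (.mem 0 (.reg j)))
  | ρ, j, op o e f => .seq (e.compile ρ j) <| .seq (f.compile ρ (j + 1)) <|
      .set j (o.expr (.reg j) (.reg (j + 1)))
  | ρ, j, sum i e => foldLoop .add 0 i j (e.compile (pushVal (j + 1) ρ) (j + 2))
  | ρ, j, prod i e => foldLoop .mul 1 i j (e.compile (pushVal (j + 1) ρ) (j + 2))

end ArithTerm

theorem Nat.size_add_le (x y : ℕ) : (x + y).size ≤ x.size + y.size + 1 := by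
  rw [Nat.size_le]
  have hx := Nat.lt_size_self x
  have hy := Nat.lt_size_self y
  have h1 : 2 ^ x.size ≤ 2 ^ (x.size + y.size) := Nat.pow_le_pow_right (by omega) (by omega)
  have h2 : 2 ^ y.size ≤ 2 ^ (x.size + y.size) := Nat.pow_le_pow_right (by omega) (by omega)
  rw [pow_succ]
  omega

theorem Nat.size_mul_le (x y : ℕ) : (x * y).size ≤ x.size + y.size := by
  rw [Nat.size_le, pow_add]
  have hx := Nat.lt_size_self x
  have hy := Nat.lt_size_self y
  rcases Nat.eq_zero_or_pos y with rfl | hy0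
  · simp
  · exact Nat.mul_lt_mul_of_lt_of_le hx hy.le (by positivity)

theorem Nat.size_le_self (x : ℕ) : x.size ≤ x := Nat.size_le.2 Nat.lt_two_pow_self

theorem ArithOp.size_eval_le (o : ArithOp) (x y : ℕ) : (o.eval x y).size ≤ x.size + y.size + 1 := by
  cases o with
  | add => exact Nat.size_add_le x y
  | sub => exact (Nat.size_le_size (Nat.sub_le _ _)).trans (by omega)
  | mul => exact (Nat.size_mul_le x y).trans (by omega)
  | div => exact (Nat.size_le_size (Nat.div_le_self _ _)).trans (by omega)
  | mod => exact (Nat.size_le_size (Nat.mod_le _ _)).trans (by omega)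

theorem ArithOp.eval_expr (o : ArithOp) (e f : RamExpr) (s : RamState) :
    (o.expr e f).eval s = o.eval (e.eval s) (f.eval s) := by
  cases o <;> rfl

theorem ArithOp.nodes_expr (o : ArithOp) (e f : RamExpr) :
    (o.expr e f).nodes = e.nodes + f.nodes + 1 := by
  cases o <;> rfl

theorem ArithOp.fits_expr (o : ArithOp) {e f : RamExpr} {s : RamState} {b : ℕ}
    (he : e.Fits b s) (hf : f.Fits b s) (h : (e.eval s).size + (f.eval s).size + 1 ≤ b) :
    (o.expr e f).Fits b s := by
  cases o with
  | add => exact ⟨he, hf, (Nat.size_add_le _ _).trans h⟩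
  | sub => exact ⟨he, hf⟩
  | mul => exact ⟨he, hf, (Nat.size_mul_le _ _).trans (by omega)⟩
  | div => exact ⟨he, hf⟩
  | mod => exact ⟨he, hf⟩

theorem Nat.size_sum_le (f : ℕ → ℕ) (B m : ℕ) (h : ∀ x < m, (f x).size ≤ B) :
    (∑ x ∈ Finset.range m, f x).size ≤ m + B := by
  rw [Nat.size_le]
  calc ∑ x ∈ Finset.range m, f x ≤ ∑ x ∈ Finset.range m, 2 ^ B :=
        Finset.sum_le_sum fun x hx => (Nat.size_le.1 (h x (Finset.mem_range.1 hx))).le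
    _ = m * 2 ^ B := by simp
    _ < 2 ^ (m + B) := by
        rw [pow_add]; exact Nat.mul_lt_mul_of_pos_right Nat.lt_two_pow_self (by positivity)

theorem Nat.size_prod_le (f : ℕ → ℕ) (B m : ℕ) (h : ∀ x < m, (f x).size ≤ B) :
    (∏ x ∈ Finset.range m, f x).size ≤ m * B + 1 := by
  induction m with
  | zero => simp
  | succ m ih =>
    rw [Finset.prod_range_succ]
    refine (Nat.size_mul_le _ _).trans ?_
    have := ih fun x hx => h x (by omega)
    have := h m (by omega)
    rw [add_mul]; omega

/-! ### Compiled terms run in polynomial time -/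

namespace ArithTerm

/-- A fold runs the subprogram once per index. It computes `F` at the upper limit if `F` satisfies the
recursion that the loop performs, where `g x` is the value of the subprogram in pass `x`. -/
theorem foldLoop_reaches (o : ArithOp) (start i j : ℕ) (P : RamProg) (s : RamState) (b T : ℕ)
    (F g : ℕ → ℕ) (hi : i < j) (hF0 : F 0 = start)
    (hF : ∀ x < s.reg i, F (x + 1) = o.eval (F x) (g x))
    (hm : s.reg i + 1 ≤ b) (hsize : ∀ x ≤ s.reg i, (F x).size ≤ b)
    (hsize' : ∀ x < s.reg i, (F x).size + (g x).size + 1 ≤ b)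
    (hP : ∀ x < s.reg i, ∀ s', (∀ r < j, s'.reg r = s.reg r) → s'.reg (j + 1) = x →
      s'.mem = s.mem → ∃ s'', P.Reaches s' s'' T ∧ s''.reg (j + 2) = g x ∧
        (∀ r < j + 2, s''.reg r = s'.reg r) ∧ s''.mem = s'.mem) :
    ∃ s', (foldLoop o start i j P).Reaches s s'
        ((s.reg i + 1) * (T + 11 * (b + 1) ^ 2 + 3) + 4 * (b + 1) ^ 2 + 2) ∧
      s'.reg j = F (s.reg i) ∧ (∀ r < j, s'.reg r = s.reg r) ∧ s'.mem = s.mem := by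
  have hb : 1 ≤ b := by omega
  have hsz : ∀ x ≤ s.reg i + 1, x.size ≤ b := fun x hx => (Nat.size_le_self x).trans (by omega)
  let s1 := s.setReg j start
  let s2 := s1.setReg (j + 1) 0
  have r1 : (RamProg.set j (.const start)).Reaches s s1 (2 * (b + 1) ^ 2) :=
    RamProg.Reaches.set j (by have := hsize 0 (by omega); rw [hF0] at this; exact this)
  have r2 : (RamProg.set (j + 1) (.const 0)).Reaches s1 s2 (2 * (b + 1) ^ 2) :=
    RamProg.Reaches.set (j + 1) (hsz 0 (by omega))
  let Inv : ℕ → RamState → Prop := fun x t =>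
    (∀ r < j, t.reg r = s.reg r) ∧ t.mem = s.mem ∧ t.reg j = F x ∧ t.reg (j + 1) = x
  obtain ⟨s3, r3, hs3⟩ := RamProg.Reaches.while_loop (b := b)
    (e := .sub (.reg i) (.reg (j + 1)))
    (P := .seq P (.seq (.set j (o.expr (.reg j) (.reg (j + 2))))
      (.set (j + 1) (.add (.reg (j + 1)) (.const 1)))))
    Inv (N := s.reg i) (T := T + (4 * (b + 1) ^ 2 + 4 * (b + 1) ^ 2 + 1) + 1) (s := s2)
    (by
      intro x hx t ⟨h1, h2, h3, h4⟩
      have hti : t.reg i = s.reg i := h1 i hi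
      refine ⟨⟨?_, ?_⟩, ?_, ?_⟩
      · change (t.reg i).size ≤ b
        rw [hti]; exact hsz _ (by omega)
      · change (t.reg (j + 1)).size ≤ b
        rw [h4]; exact hsz _ (by omega)
      · simp only [RamExpr.eval]; omega
      obtain ⟨u, hu, hu1, hu2, hu3⟩ := hP x hx t h1 h4 h2
      have huj : u.reg j = F x := (hu2 j (by omega)).trans h3
      have huj1 : u.reg (j + 1) = x := (hu2 (j + 1) (by omega)).trans h4
      have hsx := hsize' x hx
      have e1 : (o.expr (.reg j) (.reg (j + 2))).Fits b u := by
        apply o.fits_expr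
        · change (u.reg j).size ≤ b
          rw [huj]; omega
        · change (u.reg (j + 2)).size ≤ b
          rw [hu1]; omega
        · simp only [RamExpr.eval]; rw [huj, hu1]; exact hsx
      have q1 := RamProg.Reaches.set j e1
      rw [o.eval_expr, o.nodes_expr] at q1
      simp only [RamExpr.eval, RamExpr.nodes] at q1
      rw [huj, hu1, ← hF x hx] at q1
      have e2 : (RamExpr.add (.reg (j + 1)) (.const 1)).Fits b (u.setReg j (F (x + 1))) := by
        simp only [RamExpr.Fits, RamExpr.eval, RamState.reg_setReg]
        rw [if_neg (by omega), huj1]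
        exact ⟨hsz _ (by omega), hsz _ (by omega), hsz _ (by omega)⟩
      have q2 := RamProg.Reaches.set (j + 1) e2
      simp only [RamExpr.eval, RamExpr.nodes, RamState.reg_setReg] at q2
      rw [if_neg (by omega), huj1] at q2
      refine ⟨_, hu.seq (q1.seq q2), ?_, ?_, ?_, ?_⟩
      · intro r hr
        simp only [RamState.reg_setReg]
        rw [if_neg (by omega), if_neg (by omega), hu2 r (by omega), h1 r hr]
      · simp only [RamState.mem_setReg]; rw [hu3, h2]
      · simp
      · simp)
    (by
      intro t ⟨h1, h2, h3, h4⟩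
      have hti : t.reg i = s.reg i := h1 i hi
      refine ⟨⟨?_, ?_⟩, ?_⟩
      · change (t.reg i).size ≤ b
        rw [hti]; exact hsz _ (by omega)
      · change (t.reg (j + 1)).size ≤ b
        rw [h4]; exact hsz _ (by omega)
      · simp only [RamExpr.eval]; omega)
    (by
      refine ⟨?_, rfl, ?_, ?_⟩
      · intro r hr
        simp only [s2, s1, RamState.reg_setReg]
        rw [if_neg (by omega), if_neg (by omega)]
      · simp [s2, s1, hF0]
      · simp [s2])
  refine ⟨s3, ?_, hs3.2.2.1, hs3.1, hs3.2.1⟩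
  refine (r1.seq (r2.seq r3)).mono ?_
  simp only [RamExpr.nodes]
  have : 3 * (b + 1) ^ 2 + (T + (4 * (b + 1) ^ 2 + 4 * (b + 1) ^ 2 + 1) + 1) + 1
      = T + 11 * (b + 1) ^ 2 + 3 := by ring
  simp only [show 1 + 1 + 1 = 3 from rfl, this]
  omega

/-- Evaluating a term takes polynomial time in a common bound `b` of the parameters and of the bit
lengths of the variables; its value has polynomially many bits. -/
theorem compile_reaches (t : ArithTerm) : ∃ f : ℕ → ℕ, PolyBounded f ∧
    ∀ (b : ℕ) (p : Fin 5 → ℕ) (A σ : ℕ → ℕ), (∀ i, p i ≤ b) → (∀ i, (σ i).size ≤ b) →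
      (∀ i, A i ≤ 1) → (t.eval p A σ).size ≤ f b ∧
      ∀ (ρ : ℕ → ℕ) (j : ℕ) (s : RamState), (∀ i : Fin 5, s.reg i = p i) →
        (∀ i, s.reg (ρ i) = σ i) → (∀ i, ρ i < j) → 5 ≤ j → s.mem 0 = A →
        ∃ s', (t.compile ρ j).Reaches s s' (f b) ∧ s'.reg j = t.eval p A σ ∧
          (∀ r < j, s'.reg r = s.reg r) ∧ s'.mem = s.mem := by
  induction t with
  | const c =>
    refine ⟨fun b => 2 * (c + 1) ^ 2 + c, .add (.const _) (.const _), ?_⟩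
    intro b p A σ _ _ _
    refine ⟨(Nat.size_le_self c).trans (by simp), ?_⟩
    intro ρ j s _ _ _ _ _
    have h : (RamExpr.const c).Fits c s := Nat.size_le_self c
    exact ⟨_, (RamProg.Reaches.set j h).mono (by simp [RamExpr.nodes]), by simp [eval, RamExpr.eval],
      fun r hr => by simp [hr.ne], rfl⟩
  | par i =>
    refine ⟨fun b => 2 * (b + 1) ^ 2 + b,
      .add (.mul (.const _) (.pow (.add .id (.const _)) 2)) .id, ?_⟩
    intro b p A σ hp _ _
    have hi : (p i).size ≤ b := (Nat.size_le_self _).trans (hp i)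
    refine ⟨hi.trans (by simp), ?_⟩
    intro ρ j s h1 _ _ _ _
    have h : (RamExpr.reg i).Fits b s := by simpa [RamExpr.Fits, h1] using hi
    exact ⟨_, (RamProg.Reaches.set j h).mono (by simp [RamExpr.nodes]),
      by simp [eval, RamExpr.eval, h1], fun r hr => by simp [hr.ne], rfl⟩
  | var i =>
    refine ⟨fun b => 2 * (b + 1) ^ 2 + b,
      .add (.mul (.const _) (.pow (.add .id (.const _)) 2)) .id, ?_⟩
    intro b p A σ _ hσ _
    refine ⟨(hσ i).trans (by simp), ?_⟩
    intro ρ j s _ h2 _ _ _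
    have h : (RamExpr.reg (ρ i)).Fits b s := by simpa [RamExpr.Fits, h2] using hσ i
    exact ⟨_, (RamProg.Reaches.set j h).mono (by simp [RamExpr.nodes]),
      by simp [eval, RamExpr.eval, h2], fun r hr => by simp [hr.ne], rfl⟩
  | inp e ih =>
    obtain ⟨f, hf, h⟩ := ih
    refine ⟨fun b => f b + 3 * (f b + 1 + 1) ^ 2 + 1,
      .add (.add hf (.mul (.const _) (.pow (.add (.add hf (.const _)) (.const _)) 2))) (.const _),
      ?_⟩
    intro b p A σ hp hσ hA
    obtain ⟨h1, h2⟩ := h b p A σ hp hσ hA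
    have hsz : (A (e.eval p A σ)).size ≤ 1 := (Nat.size_le_self _).trans (hA _)
    refine ⟨by simp only [eval]; omega, ?_⟩
    intro ρ j s k1 k2 k3 k4 k5
    obtain ⟨u, hu, hu1, hu2, hu3⟩ := h2 ρ j s k1 k2 k3 k4 k5
    have hmem : u.mem 0 = A := by rw [hu3, k5]
    have hfit : (RamExpr.mem 0 (.reg j)).Fits (f b + 1) u := by
      simp only [RamExpr.Fits, RamExpr.eval, hu1, hmem]
      omega
    refine ⟨_, (hu.seq (RamProg.Reaches.set j hfit)).mono ?_, ?_, fun r hr => ?_, ?_⟩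
    · simp only [RamExpr.nodes]; omega
    · simp [eval, RamExpr.eval, hu1, hmem]
    · simp [hr.ne, hu2 r hr]
    · simp [hu3]
  | op o e e' ih ih' =>
    obtain ⟨f, hf, h⟩ := ih
    obtain ⟨f', hf', h'⟩ := ih'
    refine ⟨fun b => f b + f' b + 4 * (f b + f' b + 1 + 1) ^ 2 + 2,
      .add (.add (.add hf hf') (.mul (.const _)
        (.pow (.add (.add (.add hf hf') (.const _)) (.const _)) 2))) (.const _), ?_⟩
    intro b p A σ hp hσ hA
    obtain ⟨h1, h2⟩ := h b p A σ hp hσ hA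
    obtain ⟨h1', h2'⟩ := h' b p A σ hp hσ hA
    refine ⟨(o.size_eval_le _ _).trans (by dsimp only; omega), ?_⟩
    intro ρ j s k1 k2 k3 k4 k5
    obtain ⟨u, hu, hu1, hu2, hu3⟩ := h2 ρ j s k1 k2 k3 k4 k5
    obtain ⟨v, hv, hv1, hv2, hv3⟩ := h2' ρ (j + 1) u
      (fun i => by rw [hu2 i (by omega), k1]) (fun i => by rw [hu2 _ (k3 i), k2])
      (fun i => by have := k3 i; omega) (by omega) (by rw [hu3, k5])
    have hvj : v.reg j = e.eval p A σ := by rw [hv2 j (by omega), hu1]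
    have hfit : (o.expr (.reg j) (.reg (j + 1))).Fits (f b + f' b + 1) v := by
      apply o.fits_expr
      · simp only [RamExpr.Fits, hvj]; omega
      · simp only [RamExpr.Fits, hv1]; omega
      · simp only [RamExpr.eval, hvj, hv1]; omega
    refine ⟨_, (hu.seq (hv.seq (RamProg.Reaches.set j hfit))).mono ?_, ?_, fun r hr => ?_, ?_⟩
    · simp only [o.nodes_expr, RamExpr.nodes]; omega
    · simp [eval, RamExpr.eval, o.eval_expr, hvj, hv1]
    · simp [hr.ne, hv2 r (by omega), hu2 r hr]
    · simp [hu3, hv3]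
  | sum i e ih =>
    obtain ⟨f, hf, h⟩ := ih
    let B : ℕ → ℕ := fun b => b + f b + f b + 3
    have hB : PolyBounded B := .add (.add (.add .id hf) hf) (.const _)
    refine ⟨fun b => (b + 1) * (f b + 11 * (B b + 1) ^ 2 + 3) + 4 * (B b + 1) ^ 2 + 2 + B b, ?_, ?_⟩
    · have h2 := (hB.add (.const 1)).pow 2
      exact .add (.add (.add (.mul (.add .id (.const _)) (.add (.add hf (.mul (.const _) h2))
        (.const _))) (.mul (.const _) h2)) (.const _)) hB
    intro b p A σ hp hσ hA
    have hpush : ∀ x < p i, ∀ y, (pushVal x σ y).size ≤ b := by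
      intro x hx y
      cases y with
      | zero => exact (Nat.size_le_self x).trans (hx.le.trans (hp i))
      | succ y => exact hσ y
    have hsz : ∀ m ≤ p i, (∑ x ∈ Finset.range m, e.eval p A (pushVal x σ)).size ≤ b + f b :=
      fun m hm => (Nat.size_sum_le _ (f b) m fun x hx =>
        (h b p A _ hp (hpush x (by omega)) hA).1).trans (by have := hp i; omega)
    refine ⟨(hsz _ le_rfl).trans (by simp only [B]; omega), ?_⟩
    intro ρ j s k1 k2 k3 k4 k5
    have hsi : s.reg i = p i := k1 i
    have hbi := hp i
    obtain ⟨u, hu, hu1, hu2, hu3⟩ := foldLoop_reaches .add 0 i j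
      (e.compile (pushVal (j + 1) ρ) (j + 2)) s (B b) (f b)
      (fun m => ∑ x ∈ Finset.range m, e.eval p A (pushVal x σ))
      (fun x => e.eval p A (pushVal x σ)) (by omega) rfl
      (fun x _ => Finset.sum_range_succ _ _) (by simp only [B]; omega)
      (fun x hx => (hsz x (by omega)).trans (by simp only [B]; omega))
      (fun x hx => by
        have := hsz x (by omega)
        have := (h b p A _ hp (hpush x (by omega)) hA).1
        simp only [B]; omega)
      (fun x hx t ht1 ht2 ht3 => (h b p A _ hp (hpush x (by omega)) hA).2 _ _ t
        (fun i => by rw [ht1 i (by omega), k1])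
        (fun y => by
          cases y with
          | zero => exact ht2
          | succ y => simp only [pushVal_succ]; rw [ht1 _ (k3 y), k2])
        (fun y => by
          cases y with
          | zero => simp
          | succ y => have := k3 y; simp only [pushVal_succ]; omega)
        (by omega) (by rw [ht3, k5]))
    refine ⟨u, hu.mono ?_, by rw [hu1, hsi]; rfl, hu2, hu3⟩
    rw [hsi]
    have := Nat.mul_le_mul_right (f b + 11 * (B b + 1) ^ 2 + 3) (Nat.add_le_add_right hbi 1)
    dsimp only
    omega
  | prod i e ih =>
    obtain ⟨f, hf, h⟩ := ih
    let B : ℕ → ℕ := fun b => b + b * f b + f b + 3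
    have hB : PolyBounded B := .add (.add (.add .id (.mul .id hf)) hf) (.const _)
    refine ⟨fun b => (b + 1) * (f b + 11 * (B b + 1) ^ 2 + 3) + 4 * (B b + 1) ^ 2 + 2 + B b, ?_, ?_⟩
    · have h2 := (hB.add (.const 1)).pow 2
      exact .add (.add (.add (.mul (.add .id (.const _)) (.add (.add hf (.mul (.const _) h2))
        (.const _))) (.mul (.const _) h2)) (.const _)) hB
    intro b p A σ hp hσ hA
    have hpush : ∀ x < p i, ∀ y, (pushVal x σ y).size ≤ b := by
      intro x hx y
      cases y with
      | zero => exact (Nat.size_le_self x).trans (hx.le.trans (hp i))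
      | succ y => exact hσ y
    have hsz : ∀ m ≤ p i, (∏ x ∈ Finset.range m, e.eval p A (pushVal x σ)).size ≤ b * f b + 1 :=
      fun m hm => (Nat.size_prod_le _ (f b) m fun x hx =>
        (h b p A _ hp (hpush x (by omega)) hA).1).trans
          (by have := Nat.mul_le_mul_right (f b) (hm.trans (hp i)); omega)
    refine ⟨(hsz _ le_rfl).trans (by simp only [B]; omega), ?_⟩
    intro ρ j s k1 k2 k3 k4 k5
    have hsi : s.reg i = p i := k1 i
    have hbi := hp i
    obtain ⟨u, hu, hu1, hu2, hu3⟩ := foldLoop_reaches .mul 1 i j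
      (e.compile (pushVal (j + 1) ρ) (j + 2)) s (B b) (f b)
      (fun m => ∏ x ∈ Finset.range m, e.eval p A (pushVal x σ))
      (fun x => e.eval p A (pushVal x σ)) (by omega) rfl
      (fun x _ => Finset.prod_range_succ _ _) (by simp only [B]; omega)
      (fun x hx => (hsz x (by omega)).trans (by simp only [B]; omega))
      (fun x hx => by
        have := hsz x (by omega)
        have := (h b p A _ hp (hpush x (by omega)) hA).1
        simp only [B]; omega)
      (fun x hx t ht1 ht2 ht3 => (h b p A _ hp (hpush x (by omega)) hA).2 _ _ t
        (fun i => by rw [ht1 i (by omega), k1])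
        (fun y => by
          cases y with
          | zero => exact ht2
          | succ y => simp only [pushVal_succ]; rw [ht1 _ (k3 y), k2])
        (fun y => by
          cases y with
          | zero => simp
          | succ y => have := k3 y; simp only [pushVal_succ]; omega)
        (by omega) (by rw [ht3, k5]))
    refine ⟨u, hu.mono ?_, by rw [hu1, hsi]; rfl, hu2, hu3⟩
    rw [hsi]
    have := Nat.mul_le_mul_right (f b + 11 * (B b + 1) ^ 2 + 3) (Nat.add_le_add_right hbi 1)
    dsimp only
    omega

end ArithTerm

/-! ### Expressible functions and testable conditions -/

namespace ArithTerm

/-- Renaming of variables. -/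
def rename (ξ : ℕ → ℕ) : ArithTerm → ArithTerm
  | const c => const c
  | par i => par i
  | var i => var (ξ i)
  | inp e => inp (e.rename ξ)
  | op o e f => op o (e.rename ξ) (f.rename ξ)
  | sum i e => sum i (e.rename (pushVal 0 fun x => ξ x + 1))
  | prod i e => prod i (e.rename (pushVal 0 fun x => ξ x + 1))

theorem comp_pushVal_lift (ξ : ℕ → ℕ) (a : ℕ) (σ : ℕ → ℕ) :
    (fun i => pushVal a σ (pushVal 0 (fun x => ξ x + 1) i)) = pushVal a fun i => σ (ξ i) := by
  funext i; cases i <;> rfl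

theorem eval_rename (t : ArithTerm) (ξ : ℕ → ℕ) (p : Fin 5 → ℕ) (A σ : ℕ → ℕ) :
    (t.rename ξ).eval p A σ = t.eval p A fun i => σ (ξ i) := by
  induction t generalizing ξ σ with
  | const c => rfl
  | par i => rfl
  | var i => rfl
  | inp e ih => simp only [rename, eval, ih]
  | op o e f ihe ihf => simp only [rename, eval, ihe, ihf]
  | sum i e ih => simp only [rename, eval, ih, comp_pushVal_lift]
  | prod i e ih => simp only [rename, eval, ih, comp_pushVal_lift]

/-- A substitution carried under a binder. -/
def liftSubst (τ : ℕ → ArithTerm) : ℕ → ArithTerm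
  | 0 => var 0
  | i + 1 => (τ i).rename (· + 1)

/-- Simultaneous substitution of terms for the variables. -/
def subst : (ℕ → ArithTerm) → ArithTerm → ArithTerm
  | _, const c => const c
  | _, par i => par i
  | τ, var i => τ i
  | τ, inp e => inp (e.subst τ)
  | τ, op o e f => op o (e.subst τ) (f.subst τ)
  | τ, sum i e => sum i (e.subst (liftSubst τ))
  | τ, prod i e => prod i (e.subst (liftSubst τ))

theorem eval_liftSubst (τ : ℕ → ArithTerm) (p : Fin 5 → ℕ) (A : ℕ → ℕ) (a : ℕ) (σ : ℕ → ℕ) :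
    (fun i => (liftSubst τ i).eval p A (pushVal a σ)) =
      pushVal a fun i => (τ i).eval p A σ := by
  funext i
  cases i with
  | zero => rfl
  | succ i => simp only [liftSubst, eval_rename, pushVal_succ]

theorem eval_subst (t : ArithTerm) (τ : ℕ → ArithTerm) (p : Fin 5 → ℕ) (A σ : ℕ → ℕ) :
    (t.subst τ).eval p A σ = t.eval p A fun i => (τ i).eval p A σ := by
  induction t generalizing τ σ with
  | const c => rfl
  | par i => rfl
  | var i => rfl
  | inp e ih => simp only [subst, eval, ih]
  | op o e f ihe ihf => simp only [subst, eval, ihe, ihf]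
  | sum i e ih => simp only [subst, eval, ih, eval_liftSubst]
  | prod i e ih => simp only [subst, eval, ih, eval_liftSubst]

end ArithTerm

/-- A function of parameters, input and variables is expressible if it is the value of a term.
Parameter `4` is assumed to be `3 n + 1` for the parameter `n` numbered `1`; this makes sums over
all digits of a code available. -/
def Expressible (f : (Fin 5 → ℕ) → (ℕ → ℕ) → (ℕ → ℕ) → ℕ) : Prop :=
  ∃ t : ArithTerm, ∀ p A σ, p 4 = 3 * p 1 + 1 → t.eval p A σ = f p A σ

/-- A condition on parameters, input and variables is testable if some term is its indicator. -/
def Testable (P : (Fin 5 → ℕ) → (ℕ → ℕ) → (ℕ → ℕ) → Prop) : Prop :=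
  ∃ t : ArithTerm, ∀ p A σ, p 4 = 3 * p 1 + 1 →
    (P p A σ → t.eval p A σ = 1) ∧ (¬P p A σ → t.eval p A σ = 0)

section Expressible

variable {f g h : (Fin 5 → ℕ) → (ℕ → ℕ) → (ℕ → ℕ) → ℕ}
  {P Q : (Fin 5 → ℕ) → (ℕ → ℕ) → (ℕ → ℕ) → Prop}

namespace Expressible

theorem const (c : ℕ) : Expressible fun _ _ _ => c := ⟨.const c, fun _ _ _ _ => rfl⟩

theorem par (i : Fin 5) : Expressible fun p _ _ => p i := ⟨.par i, fun _ _ _ _ => rfl⟩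

theorem var (i : ℕ) : Expressible fun _ _ σ => σ i := ⟨.var i, fun _ _ _ _ => rfl⟩

theorem inp (hf : Expressible f) : Expressible fun p A σ => A (f p A σ) :=
  let ⟨t, ht⟩ := hf
  ⟨.inp t, fun p A σ h4 => by simp only [ArithTerm.eval, ht p A σ h4]⟩

theorem op (o : ArithOp) (hf : Expressible f) (hg : Expressible g) :
    Expressible fun p A σ => o.eval (f p A σ) (g p A σ) :=
  let ⟨t, ht⟩ := hf
  let ⟨u, hu⟩ := hg
  ⟨.op o t u, fun p A σ h4 => by simp only [ArithTerm.eval, ht p A σ h4, hu p A σ h4]⟩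

theorem add (hf : Expressible f) (hg : Expressible g) :
    Expressible fun p A σ => f p A σ + g p A σ := op .add hf hg

theorem sub (hf : Expressible f) (hg : Expressible g) :
    Expressible fun p A σ => f p A σ - g p A σ := op .sub hf hg

theorem mul (hf : Expressible f) (hg : Expressible g) :
    Expressible fun p A σ => f p A σ * g p A σ := op .mul hf hg

theorem div (hf : Expressible f) (hg : Expressible g) :
    Expressible fun p A σ => f p A σ / g p A σ := op .div hf hg

theorem mod (hf : Expressible f) (hg : Expressible g) :
    Expressible fun p A σ => f p A σ % g p A σ := op .mod hf hg

theorem sum (i : Fin 5) {F : ℕ → (Fin 5 → ℕ) → (ℕ → ℕ) → (ℕ → ℕ) → ℕ}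
    (hF : Expressible fun p A σ => F (σ 0) p A fun j => σ (j + 1)) :
    Expressible fun p A σ => ∑ x ∈ Finset.range (p i), F x p A σ :=
  let ⟨t, ht⟩ := hF
  ⟨.sum i t, fun p A σ h4 => by
    simp only [ArithTerm.eval, ht p A _ h4, pushVal_zero, pushVal_succ]⟩

theorem prod (i : Fin 5) {F : ℕ → (Fin 5 → ℕ) → (ℕ → ℕ) → (ℕ → ℕ) → ℕ}
    (hF : Expressible fun p A σ => F (σ 0) p A fun j => σ (j + 1)) :
    Expressible fun p A σ => ∏ x ∈ Finset.range (p i), F x p A σ :=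
  let ⟨t, ht⟩ := hF
  ⟨.prod i t, fun p A σ h4 => by
    simp only [ArithTerm.eval, ht p A _ h4, pushVal_zero, pushVal_succ]⟩

/-- Expressible functions may be substituted for the variables; the parameters and the input stay. -/
theorem subst (hf : Expressible f) {G : ℕ → (Fin 5 → ℕ) → (ℕ → ℕ) → (ℕ → ℕ) → ℕ}
    (hG : ∀ i, Expressible (G i)) :
    Expressible fun p A σ => f p A fun i => G i p A σ := by
  obtain ⟨t, ht⟩ := hf
  choose τ hτ using hG
  exact ⟨t.subst τ, fun p A σ h4 => by
    simp only [ArithTerm.eval_subst, ht p A _ h4, hτ _ p A σ h4]⟩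

theorem comp₂ {F : (Fin 5 → ℕ) → (ℕ → ℕ) → ℕ → ℕ → ℕ}
    (hF : Expressible fun p A σ => F p A (σ 0) (σ 1)) (hf : Expressible f) (hg : Expressible g) :
    Expressible fun p A σ => F p A (f p A σ) (g p A σ) := by
  refine hF.subst (G := fun i => if i = 0 then f else g) fun i => ?_
  split_ifs <;> assumption

theorem ite (hP : Testable P) (hf : Expressible f) (hg : Expressible g)
    [∀ p A σ, Decidable (P p A σ)] :
    Expressible fun p A σ => if P p A σ then f p A σ else g p A σ := by
  obtain ⟨t, ht⟩ := hP
  obtain ⟨u, hu⟩ := hf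
  obtain ⟨v, hv⟩ := hg
  refine ⟨.op .add (.op .mul t u) (.op .mul (.op .sub (.const 1) t) v), fun p A σ h4 => ?_⟩
  simp only [ArithTerm.eval, ArithOp.eval, hu p A σ h4, hv p A σ h4]
  split_ifs with hP
  · simp [(ht p A σ h4).1 hP]
  · simp [(ht p A σ h4).2 hP]

end Expressible

namespace Testable

theorem le (hf : Expressible f) (hg : Expressible g) :
    Testable fun p A σ => f p A σ ≤ g p A σ := by
  obtain ⟨t, ht⟩ := hf
  obtain ⟨u, hu⟩ := hg
  refine ⟨.op .sub (.const 1) (.op .sub t u), fun p A σ h4 => ?_⟩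
  simp only [ArithTerm.eval, ArithOp.eval, ht p A σ h4, hu p A σ h4]
  omega

theorem lt (hf : Expressible f) (hg : Expressible g) :
    Testable fun p A σ => f p A σ < g p A σ := le (hf.add (.const 1)) hg

theorem not (hP : Testable P) : Testable fun p A σ => ¬P p A σ := by
  obtain ⟨t, ht⟩ := hP
  refine ⟨.op .sub (.const 1) t, fun p A σ h4 => ?_⟩
  simp only [ArithTerm.eval, ArithOp.eval]
  exact ⟨fun h => by simp [(ht p A σ h4).2 h], fun h => by simp [(ht p A σ h4).1 (not_not.1 h)]⟩

theorem and (hP : Testable P) (hQ : Testable Q) :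
    Testable fun p A σ => P p A σ ∧ Q p A σ := by
  obtain ⟨t, ht⟩ := hP
  obtain ⟨u, hu⟩ := hQ
  refine ⟨.op .mul t u, fun p A σ h4 => ?_⟩
  simp only [ArithTerm.eval, ArithOp.eval]
  refine ⟨fun h => by simp [(ht p A σ h4).1 h.1, (hu p A σ h4).1 h.2], fun h => ?_⟩
  by_cases hP : P p A σ
  · simp [(hu p A σ h4).2 fun hQ => h ⟨hP, hQ⟩]
  · simp [(ht p A σ h4).2 hP]

theorem congr (hP : Testable P) (h : ∀ p A σ, P p A σ ↔ Q p A σ) : Testable Q := by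
  obtain ⟨t, ht⟩ := hP
  exact ⟨t, fun p A σ h4 => by rw [← h]; exact ht p A σ h4⟩

theorem eq (hf : Expressible f) (hg : Expressible g) :
    Testable fun p A σ => f p A σ = g p A σ :=
  ((le hf hg).and (le hg hf)).congr fun _ _ _ => le_antisymm_iff.symm

theorem imp (hP : Testable P) (hQ : Testable Q) :
    Testable fun p A σ => P p A σ → Q p A σ :=
  (hP.and hQ.not).not.congr fun _ _ _ => by tauto

theorem or (hP : Testable P) (hQ : Testable Q) :
    Testable fun p A σ => P p A σ ∨ Q p A σ :=
  (hP.not.and hQ.not).not.congr fun _ _ _ => by tauto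

theorem forall_lt (i : Fin 5) {R : ℕ → (Fin 5 → ℕ) → (ℕ → ℕ) → (ℕ → ℕ) → Prop}
    (hR : Testable fun p A σ => R (σ 0) p A fun j => σ (j + 1)) :
    Testable fun p A σ => ∀ x < p i, R x p A σ := by
  obtain ⟨t, ht⟩ := hR
  refine ⟨.prod i t, fun p A σ h4 => ?_⟩
  simp only [ArithTerm.eval]
  constructor
  · intro h
    exact Finset.prod_eq_one fun x hx => (ht p A (pushVal x σ) h4).1 (h x (Finset.mem_range.1 hx))
  · intro h
    push Not at h
    obtain ⟨x, hx, hR⟩ := h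
    exact Finset.prod_eq_zero (Finset.mem_range.2 hx) ((ht p A (pushVal x σ) h4).2 hR)

end Testable

end Expressible

/-! ### The transition function on encoded states -/

namespace AllenDP

/-- The power `a ^ e` for exponents `e ≤ N`, as a product of fixed length: the exponent need not be a
parameter, while products in terms range over parameters only. -/
def cappedPow (N a e : ℕ) : ℕ := ∏ j ∈ Finset.range N, if j < e then a else 1

/-- The base in which states are encoded. It exceeds all digits: statuses are at most `4`, keys and
overlap counts at most `n`, and the last digit is at most `2 n`. -/
def base (n : ℕ) : ℕ := 2 * n + 5

/-- The digit `i` of the code `s`, where codes have `3 n + 1` digits. -/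
def digit (n s i : ℕ) : ℕ := s / cappedPow (3 * n + 1) (base n) i % base n

/-- The code of a state, given by its digits. -/
def code (n : ℕ) (d : ℕ → ℕ) : ℕ :=
  ∑ i ∈ Finset.range (3 * n + 1), d i * cappedPow (3 * n + 1) (base n) i

/-- The number of variables with status `a`. -/
def statusCount (n : ℕ) (d : ℕ → ℕ) (a : ℕ) : ℕ := ∑ v ∈ Finset.range n, if d v = a then 1 else 0

/-- The number with binary digits `A o, …, A (o + w - 1)`. -/
def field (A : ℕ → ℕ) (w o : ℕ) : ℕ := ∑ i ∈ Finset.range w, A (o + i) * cappedPow w 2 i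

/-- The position at which the encoding of the constraint number `j` begins. -/
def blockStart (n w j : ℕ) : ℕ := n + 1 + j * (2 * w + 13)

/-- Every constraint of the input word `A` of length `L` on the pair `(u, v)` contains the atom
number `a`. The number of constraints is not a parameter, so `j` runs up to the length of the word
and the blocks that exceed the word are disregarded. -/
def AtomAllowed (L n w : ℕ) (A : ℕ → ℕ) (u v a : ℕ) : Prop :=
  ∀ j < L, blockStart n w (j + 1) ≤ L → field A w (blockStart n w j) = u →
    field A w (blockStart n w j + w) = v → A (blockStart n w j + 2 * w + a) = 1

/-- The input word `A` of length `L` encodes an instance with `n` variables. -/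
def ValidInput (L n w : ℕ) (A : ℕ → ℕ) : Prop :=
  n + 1 ≤ L ∧ (∀ i < n, A i = 1) ∧ A n = 0 ∧ (L - (n + 1)) % (2 * w + 13) = 0 ∧
    ∀ j < L, blockStart n w (j + 1) ≤ L →
      field A w (blockStart n w j) < n ∧ field A w (blockStart n w j + w) < n

/-- The number of the atom that relates `u` to `v`, if the part that is being closed settles it, and
`13` otherwise. A pair is settled by closing a part if one of the two ends in this part and the other
has started, or if one of the two starts in this part and the other has ended. The digits `d v` are
the statuses explained at `status`; the digits `d (n + v)` order the start-points. -/
def settledAtom (n : ℕ) (d : ℕ → ℕ) (u v : ℕ) : ℕ :=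
  if d u = 2 ∧ d v = 4 then 3
  else if d u = 4 ∧ d v = 2 then 4
  else if d u = 1 ∧ d v = 4 then 0
  else if d u = 4 ∧ d v = 1 then 1
  else if d u = 2 ∧ d v = 2 then
    if d (n + u) < d (n + v) then 12 else if d (n + v) < d (n + u) then 11 else 2
  else if d u = 2 ∧ d v = 3 then
    if d (n + u) < d (n + v) then 5 else if d (n + v) < d (n + u) then 9 else 7
  else if d u = 3 ∧ d v = 2 then
    if d (n + u) < d (n + v) then 10 else if d (n + v) < d (n + u) then 6 else 8
  else 13

/-- The letter `c` may be read in the state with digits `d`; `Al u v a` says that the atom number `a`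
is allowed for the pair `(u, v)`. Letters below `n` are end-points, letters from `n` to `2 n - 1` are
start-points, and `2 n` closes the current part, at which moment the overlaps with the variables that
start in it are added. -/
def StepOk (n k : ℕ) (Al : ℕ → ℕ → ℕ → Prop) (d : ℕ → ℕ) (c : ℕ) : Prop :=
  (c < n → d (3 * n) ≤ c ∧ d c = 3) ∧
  (n ≤ c → c < 2 * n → d (3 * n) ≤ c ∧ d (c - n) = 0 ∧
    statusCount n d 3 + statusCount n d 4 + 1 ≤ k) ∧
  (2 * n ≤ c → 0 < d (3 * n) ∧
    (∀ v < n, (d v = 3 → d (2 * n + v) + statusCount n d 4 < k) ∧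
      (d v = 4 → statusCount n d 3 + statusCount n d 4 ≤ k)) ∧
    ∀ u < n, ∀ v < n, settledAtom n d u v = 13 ∨ Al u v (settledAtom n d u v))

/-- The digits of the state after the letter `c`. Placing a point changes one status and the last
point; closing a part updates the statuses, and recomputes the order of the start-points and the
numbers of overlaps for the variables that remain open. -/
def stepDigits (n : ℕ) (d : ℕ → ℕ) (c i : ℕ) : ℕ :=
  if c < 2 * n then
    if i = 3 * n then c + 1
    else if c < n then if i = c then 2 else d i
    else if i = c - n then 4 else d i
  else if i < n then if d i = 2 then 1 else if d i = 4 then 3 else d i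
  else if i < 2 * n then
    if d (i - n) = 3 then
      ∑ w ∈ Finset.range n, if d w = 3 ∧ d (n + w) < d i then 1 else 0
    else if d (i - n) = 4 then statusCount n d 3 else 0
  else if i < 3 * n then
    if d (i - 2 * n) = 3 then d i + statusCount n d 4
    else if d (i - 2 * n) = 4 then statusCount n d 3 + statusCount n d 4 - 1 else 0
  else 0

open Classical in
/-- The transition function on codes: `0` if the letter cannot be read, and otherwise one more than
the code of the next state. -/
noncomputable def transition (n k : ℕ) (Al : ℕ → ℕ → ℕ → Prop) (s c : ℕ) : ℕ :=
  if StepOk n k Al (digit n s) c then code n (stepDigits n (digit n s) c) + 1 else 0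

/-- The state is final: all points are placed and the last part is closed. -/
def IsFinal (n : ℕ) (d : ℕ → ℕ) : Prop := d (3 * n) = 0 ∧ ∀ v < n, d v = 1

end AllenDP

/-! ### The transition function is expressible -/

namespace AllenDP

theorem cappedPow_eq {N a e : ℕ} (h : e ≤ N) : cappedPow N a e = a ^ e := by
  have : (Finset.range N).filter (· < e) = Finset.range e := by
    ext x; simp only [Finset.mem_filter, Finset.mem_range]; omega
  rw [cappedPow, ← Finset.prod_filter, this]
  simp

variable {f g h : (Fin 5 → ℕ) → (ℕ → ℕ) → (ℕ → ℕ) → ℕ}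

theorem _root_.Expressible.congr (hf : Expressible f)
    (h : ∀ p A σ, p 4 = 3 * p 1 + 1 → f p A σ = g p A σ) : Expressible g :=
  let ⟨t, ht⟩ := hf
  ⟨t, fun p A σ h4 => by rw [ht p A σ h4, h p A σ h4]⟩

theorem _root_.Expressible.cappedPow (i : Fin 5) (hf : Expressible f) (hg : Expressible g) :
    Expressible fun p A σ => cappedPow (p i) (f p A σ) (g p A σ) :=
  Expressible.comp₂ (F := fun p _ a e => AllenDP.cappedPow (p i) a e)
    (Expressible.prod i (F := fun j _ _ σ => if j < σ 1 then σ 0 else 1)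
      (.ite (.lt (.var 0) (.var 2)) (.var 1) (.const 1))) hf hg

theorem _root_.Expressible.digit (hf : Expressible f) (hg : Expressible g) :
    Expressible fun p A σ => digit (p 1) (f p A σ) (g p A σ) := by
  have h1 : Expressible fun p _ _ => 2 * p 1 + 5 := .add (.mul (.const 2) (.par 1)) (.const 5)
  refine (Expressible.mod (.div hf (.cappedPow 4 h1 hg)) h1).congr fun p A σ h4 => ?_
  rw [h4]; rfl

theorem _root_.Expressible.field (hf : Expressible f) :
    Expressible fun p A σ => field A (p 3) (f p A σ) :=
  Expressible.comp₂ (F := fun p A o _ => AllenDP.field A (p 3) o)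
    (Expressible.sum 3 (F := fun i p A σ => A (σ 0 + i) * AllenDP.cappedPow (p 3) 2 i)
      (.mul (.inp (.add (.var 1) (.var 0))) (.cappedPow 3 (.const 2) (.var 0)))) hf (.const 0)

theorem _root_.Expressible.blockStart (hf : Expressible f) :
    Expressible fun p A σ => blockStart (p 1) (p 3) (f p A σ) :=
  .add (.add (.par 1) (.const 1)) (.mul hf (.add (.mul (.const 2) (.par 3)) (.const 13)))

theorem expressible_statusCount (a : ℕ) (hf : Expressible f) :
    Expressible fun p A σ => statusCount (p 1) (digit (p 1) (f p A σ)) a :=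
  Expressible.comp₂ (F := fun p _ s _ => statusCount (p 1) (AllenDP.digit (p 1) s) a)
    (Expressible.sum 1 (F := fun v p _ σ => if AllenDP.digit (p 1) (σ 0) v = a then 1 else 0)
      (.ite (.eq (.digit (.var 1) (.var 0)) (.const a)) (.const 1) (.const 0))) hf (.const 0)

theorem testable_atomAllowed {f g h : (Fin 5 → ℕ) → (ℕ → ℕ) → (ℕ → ℕ) → ℕ} (hf : Expressible f)
    (hg : Expressible g) (hh : Expressible h) :
    Testable fun p A σ => AtomAllowed (p 0) (p 1) (p 3) A (f p A σ) (g p A σ) (h p A σ) := by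
  have key : Testable fun p A σ => AtomAllowed (p 0) (p 1) (p 3) A (σ 0) (σ 1) (σ 2) := by
    refine Testable.forall_lt 0 (R := fun j p A σ => blockStart (p 1) (p 3) (j + 1) ≤ p 0 →
      AllenDP.field A (p 3) (blockStart (p 1) (p 3) j) = σ 0 →
      AllenDP.field A (p 3) (blockStart (p 1) (p 3) j + p 3) = σ 1 →
      A (blockStart (p 1) (p 3) j + 2 * p 3 + σ 2) = 1) ?_
    exact .imp (.le (.blockStart (.add (.var 0) (.const 1))) (.par 0)) <|
      .imp (.eq (.field (.blockStart (.var 0))) (.var 1)) <|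
      .imp (.eq (.field (.add (.blockStart (.var 0)) (.par 3))) (.var 2)) <|
      .eq (.inp (.add (.add (.blockStart (.var 0)) (.mul (.const 2) (.par 3))) (.var 3))) (.const 1)
  obtain ⟨t, ht⟩ := key
  obtain ⟨tf, hf⟩ := hf
  obtain ⟨tg, hg⟩ := hg
  obtain ⟨th, hh⟩ := hh
  refine ⟨t.subst fun i => if i = 0 then tf else if i = 1 then tg else th, fun p A σ h4 => ?_⟩
  rw [ArithTerm.eval_subst]
  have := ht p A (fun i => (if i = 0 then tf else if i = 1 then tg else th).eval p A σ) h4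
  simpa [hf p A σ h4, hg p A σ h4, hh p A σ h4] using this

theorem expressible_settledAtom :
    Expressible fun p _ σ => settledAtom (p 1) (digit (p 1) (σ 2)) (σ 1) (σ 0) := by
  have hu : Expressible fun p _ σ => digit (p 1) (σ 2) (σ 1) := .digit (.var 2) (.var 1)
  have hv : Expressible fun p _ σ => digit (p 1) (σ 2) (σ 0) := .digit (.var 2) (.var 0)
  have hku : Expressible fun p _ σ => digit (p 1) (σ 2) (p 1 + σ 1) :=
    .digit (.var 2) (.add (.par 1) (.var 1))
  have hkv : Expressible fun p _ σ => digit (p 1) (σ 2) (p 1 + σ 0) :=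
    .digit (.var 2) (.add (.par 1) (.var 0))
  have hst : ∀ a b, Testable fun p _ σ => digit (p 1) (σ 2) (σ 1) = a ∧
      digit (p 1) (σ 2) (σ 0) = b := fun a b => .and (.eq hu (.const a)) (.eq hv (.const b))
  have hc : ∀ a b c : ℕ, Expressible fun p _ σ =>
      if digit (p 1) (σ 2) (p 1 + σ 1) < digit (p 1) (σ 2) (p 1 + σ 0) then a
      else if digit (p 1) (σ 2) (p 1 + σ 0) < digit (p 1) (σ 2) (p 1 + σ 1) then b else c :=
    fun a b c => .ite (.lt hku hkv) (.const a) (.ite (.lt hkv hku) (.const b) (.const c))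
  exact .ite (hst 2 4) (.const 3) <| .ite (hst 4 2) (.const 4) <| .ite (hst 1 4) (.const 0) <|
    .ite (hst 4 1) (.const 1) <| .ite (hst 2 2) (hc 12 11 2) <| .ite (hst 2 3) (hc 5 9 7) <|
    .ite (hst 3 2) (hc 10 6 8) (.const 13)

theorem testable_stepOk : Testable fun p A σ =>
    StepOk (p 1) (p 2) (AtomAllowed (p 0) (p 1) (p 3) A) (digit (p 1) (σ 0)) (σ 1) := by
  have h3 : Expressible fun p _ σ => digit (p 1) (σ 0) (3 * p 1) :=
    .digit (.var 0) (.mul (.const 3) (.par 1))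
  have hN : ∀ a, Expressible fun p _ σ => statusCount (p 1) (digit (p 1) (σ 0)) a :=
    fun a => expressible_statusCount a (.var 0)
  have hN' : ∀ a, Expressible fun p _ σ => statusCount (p 1) (digit (p 1) (σ 1)) a :=
    fun a => expressible_statusCount a (.var 1)
  refine .and (.imp (.lt (.var 1) (.par 1)) (.and (.le h3 (.var 1))
    (.eq (.digit (.var 0) (.var 1)) (.const 3)))) (.and (.imp (.le (.par 1) (.var 1))
    (.imp (.lt (.var 1) (.mul (.const 2) (.par 1))) (.and (.le h3 (.var 1))
      (.and (.eq (.digit (.var 0) (.sub (.var 1) (.par 1))) (.const 0))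
        (.le (.add (.add (hN 3) (hN 4)) (.const 1)) (.par 2))))))
    (.imp (.le (.mul (.const 2) (.par 1)) (.var 1)) (.and (.lt (.const 0) h3) (.and ?_ ?_))))
  · refine .forall_lt 1 (R := fun v p A σ =>
      (digit (p 1) (σ 0) v = 3 → digit (p 1) (σ 0) (2 * p 1 + v) +
        statusCount (p 1) (digit (p 1) (σ 0)) 4 < p 2) ∧
      (digit (p 1) (σ 0) v = 4 → statusCount (p 1) (digit (p 1) (σ 0)) 3 +
        statusCount (p 1) (digit (p 1) (σ 0)) 4 ≤ p 2)) ?_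
    exact .and (.imp (.eq (.digit (.var 1) (.var 0)) (.const 3)) (.lt (.add
      (.digit (.var 1) (.add (.mul (.const 2) (.par 1)) (.var 0))) (hN' 4)) (.par 2)))
      (.imp (.eq (.digit (.var 1) (.var 0)) (.const 4)) (.le (.add (hN' 3) (hN' 4)) (.par 2)))
  · refine .forall_lt 1 (R := fun u p A σ => ∀ v < p 1,
      settledAtom (p 1) (digit (p 1) (σ 0)) u v = 13 ∨
      AtomAllowed (p 0) (p 1) (p 3) A u v (settledAtom (p 1) (digit (p 1) (σ 0)) u v)) ?_
    refine .forall_lt 1 (R := fun v p A σ =>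
      settledAtom (p 1) (digit (p 1) (σ 1)) (σ 0) v = 13 ∨
      AtomAllowed (p 0) (p 1) (p 3) A (σ 0) v
        (settledAtom (p 1) (digit (p 1) (σ 1)) (σ 0) v)) ?_
    exact .or (.eq expressible_settledAtom (.const 13))
      (testable_atomAllowed (.var 1) (.var 0) expressible_settledAtom)

theorem expressible_stepDigits :
    Expressible fun p _ σ => stepDigits (p 1) (digit (p 1) (σ 1)) (σ 2) (σ 0) := by
  have hd : ∀ {f}, Expressible f → Expressible fun p A σ => digit (p 1) (σ 1) (f p A σ) :=
    fun hf => .digit (.var 1) hf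
  have hdi := hd (.var 0)
  have hN : ∀ a, Expressible fun p _ σ => statusCount (p 1) (digit (p 1) (σ 1)) a :=
    fun a => expressible_statusCount a (.var 1)
  have h3n : Expressible fun p _ _ => 3 * p 1 := .mul (.const 3) (.par 1)
  have h2n : Expressible fun p _ _ => 2 * p 1 := .mul (.const 2) (.par 1)
  have hd1 := hd (.sub (.var 0) (.par 1))
  have hd2 := hd (.sub (.var 0) h2n)
  refine .ite (.lt (.var 2) h2n)
    (.ite (.eq (.var 0) h3n) (.add (.var 2) (.const 1)) (.ite (.lt (.var 2) (.par 1))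
      (.ite (.eq (.var 0) (.var 2)) (.const 2) hdi)
      (.ite (.eq (.var 0) (.sub (.var 2) (.par 1))) (.const 4) hdi)))
    (.ite (.lt (.var 0) (.par 1)) (.ite (.eq hdi (.const 2)) (.const 1)
        (.ite (.eq hdi (.const 4)) (.const 3) hdi))
      (.ite (.lt (.var 0) h2n) (.ite (.eq hd1 (.const 3)) ?_
          (.ite (.eq hd1 (.const 4)) (hN 3) (.const 0)))
        (.ite (.lt (.var 0) h3n) (.ite (.eq hd2 (.const 3)) (.add hdi (hN 4))
          (.ite (.eq hd2 (.const 4)) (.sub (.add (hN 3) (hN 4)) (.const 1)) (.const 0)))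
          (.const 0))))
  refine .sum 1 (F := fun w p _ σ => if digit (p 1) (σ 1) w = 3 ∧
    digit (p 1) (σ 1) (p 1 + w) < digit (p 1) (σ 1) (σ 0) then 1 else 0) ?_
  exact .ite (.and (.eq (.digit (.var 2) (.var 0)) (.const 3))
    (.lt (.digit (.var 2) (.add (.par 1) (.var 0))) (.digit (.var 2) (.var 1))))
    (.const 1) (.const 0)

open Classical in
theorem expressible_transition :
    Expressible fun p A σ =>
      transition (p 1) (p 2) (AtomAllowed (p 0) (p 1) (p 3) A) (σ 0) (σ 1) := by
  refine .ite testable_stepOk (.add ?_ (.const 1)) (.const 0)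
  have hb : Expressible fun p _ _ => 2 * p 1 + 5 := .add (.mul (.const 2) (.par 1)) (.const 5)
  refine (Expressible.sum 4 (F := fun i p A σ => stepDigits (p 1) (digit (p 1) (σ 0)) (σ 1) i *
    cappedPow (p 4) (2 * p 1 + 5) i)
    (.mul expressible_stepDigits (.cappedPow 4 hb (.var 0)))).congr fun p A σ h4 => ?_
  rw [h4]; rfl

theorem testable_isFinal : Testable fun p _ σ => IsFinal (p 1) (digit (p 1) (σ 0)) :=
  .and (.eq (.digit (.var 0) (.mul (.const 3) (.par 1))) (.const 0))
    (.forall_lt 1 (R := fun v p _ σ => digit (p 1) (σ 0) v = 1)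
      (.eq (.digit (.var 1) (.var 0)) (.const 1)))

theorem testable_validInput :
    Testable fun p A _ => ValidInput (p 0) (p 1) (p 3) A := by
  refine .and (.le (.add (.par 1) (.const 1)) (.par 0)) (.and
    (.forall_lt 1 (R := fun i _ A _ => A i = 1) (.eq (.inp (.var 0)) (.const 1)))
    (.and (.eq (.inp (.par 1)) (.const 0)) (.and (.eq (.mod (.sub (.par 0) (.add (.par 1)
      (.const 1))) (.add (.mul (.const 2) (.par 3)) (.const 13))) (.const 0)) ?_)))
  refine .forall_lt 0 (R := fun j p A _ => blockStart (p 1) (p 3) (j + 1) ≤ p 0 →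
      field A (p 3) (blockStart (p 1) (p 3) j) < p 1 ∧
        field A (p 3) (blockStart (p 1) (p 3) j + p 3) < p 1) ?_
  exact .imp (.le (.blockStart (.add (.var 0) (.const 1))) (.par 0))
    (.and (.lt (.field (.blockStart (.var 0))) (.par 1))
      (.lt (.field (.add (.blockStart (.var 0)) (.par 3))) (.par 1)))

/-- The bit length of `n` is the number of powers of two that are at most `n`. -/
theorem expressible_size : Expressible fun p _ _ => (p 1).size := by
  refine (Expressible.sum 1 (F := fun i p _ _ => if cappedPow (p 1) 2 i ≤ p 1 then 1 else 0)
    (.ite (.le (.cappedPow 1 (.const 2) (.var 0)) (.par 1)) (.const 1) (.const 0))).congr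
    fun p A σ _ => ?_
  have h : ∀ i ∈ Finset.range (p 1), (if cappedPow (p 1) 2 i ≤ p 1 then 1 else 0)
      = if i < (p 1).size then 1 else 0 := fun i hi => by
    rw [cappedPow_eq (Finset.mem_range.1 hi).le]
    simp only [Nat.lt_size]
  have h2 : (Finset.range (p 1)).filter (· < (p 1).size) = Finset.range (p 1).size := by
    ext i
    have := Nat.size_le_self (p 1)
    simp only [Finset.mem_filter, Finset.mem_range]; omega
  rw [Finset.sum_congr rfl h, ← Finset.sum_filter, h2]
  simp

end AllenDP

/-! ### Partial ordered partitions -/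

namespace AllenDP

/-- The number of `v < n` with the property `P`. -/
def tally (n : ℕ) (P : ℕ → Prop) [DecidablePred P] : ℕ := ((Finset.range n).filter P).card

section tally

variable {n : ℕ} {P Q : ℕ → Prop} [DecidablePred P] [DecidablePred Q]

theorem tally_eq_sum : tally n P = ∑ v ∈ Finset.range n, if P v then 1 else 0 :=
  Finset.card_filter _ _

theorem tally_congr (h : ∀ v < n, P v ↔ Q v) : tally n P = tally n Q := by
  unfold tally
  rw [Finset.filter_congr fun v hv => h v (Finset.mem_range.1 hv)]

theorem tally_mono (h : ∀ v < n, P v → Q v) : tally n P ≤ tally n Q := by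
  refine Finset.card_le_card fun v hv => ?_
  simp only [Finset.mem_filter, Finset.mem_range] at hv ⊢
  exact ⟨hv.1, h v hv.1 hv.2⟩

theorem tally_lt (h : ∀ v < n, P v → Q v) {u : ℕ} (hu : u < n) (hP : ¬P u) (hQ : Q u) :
    tally n P < tally n Q := by
  refine Finset.card_lt_card ((Finset.ssubset_iff_of_subset fun v hv => ?_).2 ⟨u, ?_, ?_⟩)
  · simp only [Finset.mem_filter, Finset.mem_range] at hv ⊢
    exact ⟨hv.1, h v hv.1 hv.2⟩
  · simp [hu, hQ]
  · simp [hP]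

theorem tally_or (h : ∀ v < n, P v → ¬Q v) :
    tally n (fun v => P v ∨ Q v) = tally n P + tally n Q := by
  unfold tally
  rw [← Finset.card_union_of_disjoint, Finset.filter_or]
  rw [Finset.disjoint_filter]
  exact fun v hv => h v (Finset.mem_range.1 hv)

theorem tally_ne_and {u : ℕ} (hu : u < n) (hP : P u) :
    tally n (fun v => v ≠ u ∧ P v) = tally n P - 1 := by
  unfold tally
  rw [← Finset.card_erase_of_mem (a := u) (by simp [hu, hP])]
  congr 1
  ext v
  simp only [Finset.mem_filter, Finset.mem_range, Finset.mem_erase]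
  tauto

theorem tally_pos {u : ℕ} (hu : u < n) (hP : P u) : 0 < tally n P :=
  Finset.card_pos.2 ⟨u, by simp [hu, hP]⟩

end tally

/-- The number of the atom between two intervals with start-points `a`, `a'` and end-points `e`,
`e'`, where an end-point `0` counts as later than everything else. -/
def atomNumber (a e a' e' : ℕ) : ℕ :=
  if e ≠ 0 ∧ e < a' then 0
  else if e' ≠ 0 ∧ e' < a then 1
  else if e ≠ 0 ∧ e = a' then 3
  else if e' ≠ 0 ∧ e' = a then 4
  else if a < a' then
    if e ≠ 0 ∧ (e' = 0 ∨ e < e') then 5 else if e' ≠ 0 ∧ (e = 0 ∨ e' < e) then 10 else 12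
  else if a' < a then
    if e ≠ 0 ∧ (e' = 0 ∨ e < e') then 9 else if e' ≠ 0 ∧ (e = 0 ∨ e' < e) then 6 else 11
  else if e ≠ 0 ∧ (e' = 0 ∨ e < e') then 7 else if e' ≠ 0 ∧ (e = 0 ∨ e' < e) then 8 else 2

/-- The status of variable `v`, when the points have ranks `r` (`0` if not placed; the end-point of
`v` is the point `v`, its start-point the point `n + v`) and the part `cur` is being filled:
`0` before its start-point, `1` ended in an earlier part, `2` ended in this part, `3` started
earlier and not ended, `4` started in this part. -/
def status (n : ℕ) (r : ℕ → ℕ) (cur v : ℕ) : ℕ :=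
  if r (n + v) = 0 then 0 else if r (n + v) = cur then 4
  else if r v = 0 then 3 else if r v = cur then 2 else 1

/-- The started variables `u` and `v` overlap, as far as their end-points are placed. -/
abbrev Meet (n : ℕ) (r : ℕ → ℕ) (u v : ℕ) : Prop :=
  (r v = 0 ∨ r (n + u) < r v) ∧ (r u = 0 ∨ r (n + v) < r u)

/-- The number of variables that start before part `cur` and overlap with `v`. -/
def overlapCount (n : ℕ) (r : ℕ → ℕ) (cur v : ℕ) : ℕ :=
  tally n fun w => w ≠ v ∧ 0 < r (n + w) ∧ r (n + w) < cur ∧ Meet n r v w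

/-- The variable started before the current part and has not ended before it. -/
abbrev IsOld (n : ℕ) (r : ℕ → ℕ) (cur v : ℕ) : Prop :=
  status n r cur v = 2 ∨ status n r cur v = 3

/-- The digits of the state reached by a partial ordered partition. Digits `v < n` are the statuses.
For the variables that are relevant to the current part, digits `n + v` hold the order of the
start-points and digits `2 n + v` the number of overlaps. Digit `3 n` is one more than the largest
point in the current part. -/
def stateDigits (n : ℕ) (r : ℕ → ℕ) (cur i : ℕ) : ℕ :=
  if i < n then status n r cur i
  else if i < 2 * n then
    if IsOld n r cur (i - n) then tally n fun w => IsOld n r cur w ∧ r (n + w) < r i else 0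
  else if i < 3 * n then
    if IsOld n r cur (i - 2 * n) then overlapCount n r cur (i - 2 * n) else 0
  else if i = 3 * n then ((Finset.range (2 * n)).filter (r · = cur)).sup (· + 1)
  else 0

/-- The relation between `u` and `v` is settled by the parts before `cur`. -/
abbrev Settled (n : ℕ) (r : ℕ → ℕ) (cur u v : ℕ) : Prop :=
  (0 < r u ∧ r u < cur ∧ 0 < r (n + v) ∧ r (n + v) < cur) ∨
    (0 < r v ∧ r v < cur ∧ 0 < r (n + u) ∧ r (n + u) < cur)

/-- The ranks `r` describe an ordered partition of some of the `2 n` points into the parts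
`1, …, cur`, all of which except possibly the last are non-empty. -/
structure IsPartial (n : ℕ) (r : ℕ → ℕ) (cur : ℕ) : Prop where
  one_le : 1 ≤ cur
  le : ∀ p, r p ≤ cur
  eq_zero : ∀ p, 2 * n ≤ p → r p = 0
  nonempty : ∀ i, 1 ≤ i → i < cur → ∃ p, r p = i

/-- A partial ordered partition respects the bound `k` on the overlaps and the constraints, as far
as the parts before `cur` determine this; `Al u v a` says that the atom number `a` is allowed for the
pair `(u, v)`. The condition `active` is checked early, whenever a variable starts: the variables that
start in the current part overlap with each other and with all that stay open, so the condition is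
necessary for the part to be closed, and it keeps the number of states small. -/
structure IsValid (n k : ℕ) (Al : ℕ → ℕ → ℕ → Prop) (r : ℕ → ℕ) (cur : ℕ) : Prop where
  order : ∀ v < n, r v ≠ 0 → 0 < r (n + v) ∧ r (n + v) < r v
  overlap : ∀ v < n, 0 < r (n + v) → r (n + v) < cur → overlapCount n r cur v < k
  allowed : ∀ u < n, ∀ v < n, Settled n r cur u v →
    Al u v (atomNumber (r (n + u)) (r u) (r (n + v)) (r v))
  active : (∃ v < n, r (n + v) = cur) →
    tally n (status n r cur · = 3) + tally n (status n r cur · = 4) ≤ k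

/-- The ranks after the letter `c`: a letter `c < 2 n` puts the point `c` into the current part, the
letter `2 n` closes the current part. -/
def stepRank (n : ℕ) (r : ℕ → ℕ) (cur c : ℕ) : ℕ → ℕ :=
  if c < 2 * n then Function.update r c cur else r

/-- The current part after the letter `c`. -/
def stepPart (n cur c : ℕ) : ℕ := if c < 2 * n then cur else cur + 1

/-- The letter `c` can be read: the points of each part come in increasing order, and parts are not
empty. -/
def IsLetter (n : ℕ) (r : ℕ → ℕ) (cur c : ℕ) : Prop :=
  (c < 2 * n → r c = 0 ∧ ∀ q, r q = cur → q < c) ∧ (2 * n ≤ c → ∃ q, r q = cur)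

section

variable {n k : ℕ} {Al : ℕ → ℕ → ℕ → Prop} {r : ℕ → ℕ} {cur c : ℕ}

theorem IsPartial.step (h : IsPartial n r cur) (hc : IsLetter n r cur c) :
    IsPartial n (stepRank n r cur c) (stepPart n cur c) := by
  unfold stepRank stepPart
  by_cases hcn : c < 2 * n
  · simp only [hcn, if_true]
    obtain ⟨h0, -⟩ := hc.1 hcn
    refine ⟨h.one_le, fun p => ?_, fun p hp => ?_, fun i hi hi' => ?_⟩
    · rw [Function.update_apply]; split_ifs
      · exact le_rfl
      · exact h.le p
    · rw [Function.update_of_ne (by omega)]; exact h.eq_zero p hp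
    · obtain ⟨p, hp⟩ := h.nonempty i hi hi'
      refine ⟨p, ?_⟩
      rw [Function.update_of_ne (by rintro rfl; omega)]; exact hp
  · simp only [hcn, if_false]
    refine ⟨by omega, fun p => (h.le p).trans (by omega), h.eq_zero, fun i hi hi' => ?_⟩
    rcases Nat.lt_or_ge i cur with h1 | h1
    · exact h.nonempty i hi h1
    · obtain rfl : i = cur := by omega
      exact hc.2 (by omega)

theorem status_eq_zero (h : IsPartial n r cur) {v : ℕ} :
    status n r cur v = 0 ↔ r (n + v) = 0 := by
  have := h.one_le
  grind [status]

theorem status_eq_four (h : IsPartial n r cur) {v : ℕ} :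
    status n r cur v = 4 ↔ r (n + v) = cur := by
  have := h.one_le
  grind [status]

theorem status_eq_three (h : IsPartial n r cur) {v : ℕ} :
    status n r cur v = 3 ↔ 0 < r (n + v) ∧ r (n + v) < cur ∧ r v = 0 := by
  have := h.one_le
  have := h.le (n + v)
  grind [status]

theorem status_eq_two (h : IsPartial n r cur) {v : ℕ} :
    status n r cur v = 2 ↔ 0 < r (n + v) ∧ r (n + v) < cur ∧ r v = cur := by
  have := h.one_le
  have := h.le (n + v)
  grind [status]

theorem status_eq_one (h : IsPartial n r cur) (hV : IsValid n k Al r cur) {v : ℕ} (hv : v < n) :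
    status n r cur v = 1 ↔ 0 < r v ∧ r v < cur := by
  have := h.one_le
  have := h.le v
  have := h.le (n + v)
  have := hV.order v hv
  grind [status]

theorem isOld_iff (h : IsPartial n r cur) {v : ℕ} :
    IsOld n r cur v ↔ 0 < r (n + v) ∧ r (n + v) < cur ∧ (r v = 0 ∨ r v = cur) := by
  rw [IsOld, status_eq_two h, status_eq_three h]; omega

theorem status_le_four (v : ℕ) : status n r cur v ≤ 4 := by
  unfold status; split_ifs <;> omega

theorem stateDigits_status {v : ℕ} (hv : v < n) : stateDigits n r cur v = status n r cur v := by
  simp [stateDigits, hv]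

theorem stateDigits_key {v : ℕ} (hv : v < n) : stateDigits n r cur (n + v) =
    if IsOld n r cur v then tally n fun w => IsOld n r cur w ∧ r (n + w) < r (n + v) else 0 := by
  simp only [stateDigits]
  rw [if_neg (by omega), if_pos (by omega), show n + v - n = v by omega]

theorem stateDigits_overlap {v : ℕ} (hv : v < n) : stateDigits n r cur (2 * n + v) =
    if IsOld n r cur v then overlapCount n r cur v else 0 := by
  simp only [stateDigits]
  rw [if_neg (by omega), if_neg (by omega), if_pos (by omega), show 2 * n + v - 2 * n = v by omega]

theorem stateDigits_last : stateDigits n r cur (3 * n) =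
    ((Finset.range (2 * n)).filter (r · = cur)).sup (· + 1) := by
  simp only [stateDigits]
  rw [if_neg (by omega), if_neg (by omega), if_neg (by omega)]
  simp

/-- The keys in the state order the old variables by their start-points. -/
theorem key_lt_key {u v : ℕ} (hu : u < n) (hv : v < n) (hou : IsOld n r cur u)
    (hov : IsOld n r cur v) :
    stateDigits n r cur (n + u) < stateDigits n r cur (n + v) ↔ r (n + u) < r (n + v) := by
  rw [stateDigits_key hu, stateDigits_key hv, if_pos hou, if_pos hov]
  constructor
  · intro h
    by_contra h'
    exact absurd h (not_lt.2 (tally_mono fun w _ hw => ⟨hw.1, by omega⟩))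
  · intro h
    exact tally_lt (fun w _ hw => ⟨hw.1, by omega⟩) hu (by simp) ⟨hou, h⟩

theorem statusCount_stateDigits (a : ℕ) :
    statusCount n (stateDigits n r cur) a = tally n (status n r cur · = a) := by
  rw [tally_eq_sum]
  exact Finset.sum_congr rfl fun v hv => by rw [stateDigits_status (Finset.mem_range.1 hv)]

/-- Old variables overlap pairwise, so there are at most `k` of them. -/
theorem tally_isOld_le (h : IsPartial n r cur) (hV : IsValid n k Al r cur) :
    tally n (IsOld n r cur) ≤ k := by
  by_cases hex : ∃ v < n, IsOld n r cur v
  · obtain ⟨v, hv, hov⟩ := hex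
    have h1 := tally_ne_and hv hov
    have hov' := (isOld_iff h).1 hov
    have h2 := hV.overlap v hv hov'.1 hov'.2.1
    have h3 : tally n (fun w => w ≠ v ∧ IsOld n r cur w) ≤ overlapCount n r cur v := by
      refine tally_mono fun w _ hw => ?_
      have := (isOld_iff h).1 hw.2
      exact ⟨hw.1, this.1, this.2.1, by omega, by omega⟩
    omega
  · push Not at hex
    rw [show tally n (IsOld n r cur) = tally n fun _ => False from
      tally_congr fun v hv => by simp [hex v hv]]
    simp [tally]

theorem last_le_iff (h : IsPartial n r cur) (c : ℕ) :
    stateDigits n r cur (3 * n) ≤ c ↔ ∀ q, r q = cur → q < c := by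
  rw [stateDigits_last, Finset.sup_le_iff]
  simp only [Finset.mem_filter, Finset.mem_range]
  constructor
  · intro hq q hr
    by_contra hc
    have : q < 2 * n := by
      by_contra h2
      have := h.eq_zero q (by omega)
      have := h.one_le
      omega
    have := hq q ⟨this, hr⟩
    omega
  · intro hq q hr
    exact hq q hr.2

theorem last_pos_iff (h : IsPartial n r cur) :
    0 < stateDigits n r cur (3 * n) ↔ ∃ q, r q = cur := by
  have := last_le_iff h 0
  rw [← not_iff_not, not_lt, this]
  simp

end

end AllenDP

/-! ### The effect of a letter -/

namespace AllenDP

section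

variable {n k : ℕ} {Al : ℕ → ℕ → ℕ → Prop} {r : ℕ → ℕ} {cur c : ℕ}

theorem atomNumber_lt (a e a' e' : ℕ) : atomNumber a e a' e' < 13 := by
  unfold atomNumber; split_ifs <;> omega

/-- Closing the current part settles the pair `(u, v)`. -/
abbrev NewlySettled (n : ℕ) (r : ℕ → ℕ) (cur u v : ℕ) : Prop :=
  Settled n r (cur + 1) u v ∧ ¬Settled n r cur u v

set_option maxHeartbeats 1000000 in
/-- The transition function reads off the atoms between all pairs settled by closing a part. -/
theorem settledAtom_stateDigits (h : IsPartial n r cur) (hV : IsValid n k Al r cur) {u v : ℕ}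
    (hu : u < n) (hv : v < n) :
    settledAtom n (stateDigits n r cur) u v = if NewlySettled n r cur u v then
      atomNumber (r (n + u)) (r u) (r (n + v)) (r v) else 13 := by
  -- Everything is a statement about the statuses, keys and ranks of `u` and `v`, which are generalized.
  have k1 := fun h1 h2 => key_lt_key (r := r) (cur := cur) hu hv h1 h2
  have k2 := fun h1 h2 => key_lt_key (r := r) (cur := cur) hv hu h1 h2
  have o1 := hV.order u hu
  have o2 := hV.order v hv
  have l1 := h.le u
  have l2 := h.le v
  have l3 := h.le (n + u)
  have l4 := h.le (n + v)
  have l0 := h.one_le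
  rw [isOld_iff h, isOld_iff h] at k1 k2
  have cases : ∀ w < n, (stateDigits n r cur w = 0 ∧ r (n + w) = 0 ∧ r w = 0) ∨
      (stateDigits n r cur w = 4 ∧ r (n + w) = cur ∧ r w = 0) ∨
      (stateDigits n r cur w = 3 ∧ 0 < r (n + w) ∧ r (n + w) < cur ∧ r w = 0) ∨
      (stateDigits n r cur w = 2 ∧ 0 < r (n + w) ∧ r (n + w) < cur ∧ r w = cur) ∨
      (stateDigits n r cur w = 1 ∧ 0 < r (n + w) ∧ r (n + w) < r w ∧ r w < cur) := by
    intro w hw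
    rw [stateDigits_status hw, status_eq_zero h, status_eq_four h, status_eq_three h,
      status_eq_two h, status_eq_one h hV hw]
    have := hV.order w hw
    have := h.le w
    have := h.le (n + w)
    omega
  have c1 := cases u hu
  have c2 := cases v hv
  clear cases
  unfold settledAtom NewlySettled Settled
  generalize stateDigits n r cur (n + u) = ku at *
  generalize stateDigits n r cur (n + v) = kv at *
  generalize stateDigits n r cur u = su at *
  generalize stateDigits n r cur v = sv at *
  generalize r (n + u) = a at *
  generalize r (n + v) = a' at *
  generalize r u = e at *
  generalize r v = e' at *
  rcases c1 with c1 | c1 | c1 | c1 | c1 <;> rcases c2 with c2 | c2 | c2 | c2 | c2 <;>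
    obtain ⟨rfl, c1⟩ := c1 <;> obtain ⟨rfl, c2⟩ := c2 <;>
    simp +decide only [if_true, if_false] <;> symm <;>
    first
    | exact if_neg (by omega)
    | refine (if_pos (by omega)).trans ?_; unfold atomNumber; split_ifs <;> omega

end

end AllenDP

namespace AllenDP

section

variable {n k : ℕ} {Al : ℕ → ℕ → ℕ → Prop} {r : ℕ → ℕ} {cur c : ℕ}

/-- Placing a point in the current part does not change the overlaps with earlier variables: an open
end-point already counts as late. -/
theorem overlapCount_place (hl : ∀ p, r p ≤ cur) (h0 : r c = 0) {v : ℕ} (hv : r (n + v) < cur)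
    (hcv : c ≠ n + v) :
    overlapCount n (Function.update r c cur) cur v = overlapCount n r cur v := by
  unfold overlapCount Meet
  refine tally_congr fun w hw => ?_
  have := hl v
  have := hl w
  simp only [Function.update_apply]
  split_ifs <;> subst_vars <;> omega

/-- Placing a point in the current part settles no pair; this happens when the part is closed. -/
theorem settled_place_iff (h0 : r c = 0) {u v : ℕ} :
    Settled n (Function.update r c cur) cur u v ↔ Settled n r cur u v := by
  have key : ∀ q, (0 < Function.update r c cur q ∧ Function.update r c cur q < cur) ↔
      (0 < r q ∧ r q < cur) := by
    intro q
    by_cases hq : q = c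
    · subst hq; rw [Function.update_self]; omega
    · rw [Function.update_of_ne hq]
  have assoc : ∀ p q s t : Prop, (p ∧ q ∧ s ∧ t) ↔ ((p ∧ q) ∧ s ∧ t) := fun _ _ _ _ =>
    (and_assoc).symm
  simp only [Settled, assoc, key]

/-- Relative to an interval that has ended before, an open end-point behaves like a late one. -/
theorem atomNumber_open_left {a a' e' : ℕ} (h2 : a' < cur) (h3 : 0 < e')
    (h4 : e' < cur) : atomNumber a cur a' e' = atomNumber a 0 a' e' := by
  have c1 : ¬cur < a' := by omega
  have c2 : ¬cur = a' := by omega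
  have c3 : ¬cur < e' := by omega
  have c4 : ¬e' = 0 := by omega
  unfold atomNumber
  simp [c1, c2, c3, c4, h4]

/-- The mirror image of `atomNumber_open_left`. -/
theorem atomNumber_open_right {a e a' : ℕ} (h1 : a < cur) (h3 : 0 < e)
    (h4 : e < cur) : atomNumber a e a' cur = atomNumber a e a' 0 := by
  have c1 : ¬cur < a := by omega
  have c2 : ¬cur = a := by omega
  have c4 : ¬e = 0 := by omega
  unfold atomNumber
  simp [c1, c2, c4, h4]

theorem atomNumber_place (h0 : r c = 0) {u v : ℕ} (hs : Settled n r cur u v)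
    (hu : r u ≠ 0 → 0 < r (n + u) ∧ r (n + u) < r u)
    (hv : r v ≠ 0 → 0 < r (n + v) ∧ r (n + v) < r v) :
    atomNumber (Function.update r c cur (n + u)) (Function.update r c cur u)
        (Function.update r c cur (n + v)) (Function.update r c cur v) =
      atomNumber (r (n + u)) (r u) (r (n + v)) (r v) := by
  unfold Settled at hs
  have h1 : n + u ≠ c := by rintro rfl; omega
  have h2 : n + v ≠ c := by rintro rfl; omega
  rw [Function.update_of_ne h1, Function.update_of_ne h2]
  by_cases hcu : u = c
  · subst hcu
    have hcv : v ≠ u := by rintro rfl; omega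
    rw [Function.update_self, Function.update_of_ne hcv, h0]
    exact atomNumber_open_left (by omega) (by omega) (by omega)
  · rw [Function.update_of_ne hcu]
    by_cases hcv : v = c
    · subst hcv
      rw [Function.update_self, h0]
      exact atomNumber_open_right (by omega) (by omega) (by omega)
    · rw [Function.update_of_ne hcv]

/-- The end-point of `c` can be placed exactly if `c` has started in an earlier part and is open. -/
theorem isValid_place_end_iff (h : IsPartial n r cur) (hc : c < n) (h0 : r c = 0)
    (hl : ∀ q, r q = cur → q < c) :
    IsValid n k Al (Function.update r c cur) cur ↔
      IsValid n k Al r cur ∧ status n r cur c = 3 := by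
  have hs : ∀ v, Function.update r c cur (n + v) = r (n + v) := fun v =>
    Function.update_of_ne (by omega) _ _
  have hact : ¬∃ v < n, r (n + v) = cur := fun ⟨v, _, hv⟩ => by have := hl _ hv; omega
  have h1 := h.one_le
  rw [status_eq_three h]
  constructor
  · intro hV
    have hcc := hV.order c hc (by rw [Function.update_self]; omega)
    rw [hs, Function.update_self] at hcc
    have hord : ∀ v < n, r v ≠ 0 → 0 < r (n + v) ∧ r (n + v) < r v := fun v hv hrv => by
      have hne : v ≠ c := by rintro rfl; exact hrv h0
      have := hV.order v hv
      rw [hs, Function.update_of_ne hne] at this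
      exact this hrv
    refine ⟨⟨hord, fun v hv h2 h3 => ?_, fun u hu v hv hset => ?_, fun h => absurd h hact⟩,
      hcc.1, hcc.2, h0⟩
    · rw [← overlapCount_place h.le h0 h3 (by omega)]
      exact hV.overlap v hv (by rwa [hs]) (by rwa [hs])
    · rw [← atomNumber_place h0 hset (hord u hu) (hord v hv)]
      exact hV.allowed u hu v hv ((settled_place_iff h0).2 hset)
  · rintro ⟨hV, h2, h3, -⟩
    refine ⟨fun v hv hrv => ?_, fun v hv h4 h5 => ?_, fun u hu v hv hset => ?_, fun ⟨v, hv, h4⟩ => ?_⟩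
    · rw [hs]
      by_cases hne : v = c
      · subst hne; rw [Function.update_self]; exact ⟨h2, h3⟩
      · rw [Function.update_of_ne hne] at hrv ⊢
        exact hV.order v hv hrv
    · rw [hs] at h4 h5
      rw [overlapCount_place h.le h0 h5 (by omega)]
      exact hV.overlap v hv h4 h5
    · rw [settled_place_iff h0] at hset
      rw [atomNumber_place h0 hset (hV.order u hu) (hV.order v hv)]
      exact hV.allowed u hu v hv hset
    · rw [hs] at h4
      exact absurd ⟨v, hv, h4⟩ hact

theorem status_place_start (h : IsPartial n r cur) {u : ℕ} (hu : u < n) (h0 : r (n + u) = 0)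
    {v : ℕ} (hv : v < n) : status n (Function.update r (n + u) cur) cur v =
      if v = u then 4 else status n r cur v := by
  have h1 := h.one_le
  unfold status
  rw [Function.update_of_ne (show v ≠ n + u by omega)]
  by_cases hvu : v = u
  · subst hvu
    rw [Function.update_self, if_pos rfl, if_neg (by omega), if_pos rfl]
  · rw [if_neg hvu, Function.update_of_ne (by omega)]

/-- A start-point can be placed exactly if this leaves at most `k` variables active. -/
theorem isValid_place_start_iff (h : IsPartial n r cur) {u : ℕ} (hu : u < n) (h0 : r (n + u) = 0) :
    IsValid n k Al (Function.update r (n + u) cur) cur ↔ IsValid n k Al r cur ∧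
      tally n (status n r cur · = 3) + tally n (status n r cur · = 4) + 1 ≤ k := by
  have he : ∀ v < n, Function.update r (n + u) cur v = r v := fun v hv =>
    Function.update_of_ne (by omega) _ _
  have hs : ∀ v, v ≠ u → Function.update r (n + u) cur (n + v) = r (n + v) := fun v hv =>
    Function.update_of_ne (by omega) _ _
  have h1 := h.one_le
  have hst0 := (status_eq_zero h).2 h0
  have t3 : tally n (status n (Function.update r (n + u) cur) cur · = 3) =
      tally n (status n r cur · = 3) := tally_congr fun v hv => by
    rw [status_place_start h hu h0 hv]
    split_ifs with hvu
    · subst hvu; omega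
    · rfl
  have t4 : tally n (status n (Function.update r (n + u) cur) cur · = 4) =
      tally n (status n r cur · = 4) + 1 := by
    have h2 : tally n (fun v => v ≠ u ∧ status n (Function.update r (n + u) cur) cur v = 4)
        = tally n (status n r cur · = 4) := tally_congr fun v hv => by
      rw [status_place_start h hu h0 hv]
      split_ifs with hvu
      · subst hvu; omega
      · simp [hvu]
    have h3 : status n (Function.update r (n + u) cur) cur u = 4 := by
      rw [status_place_start h hu h0 hu, if_pos rfl]
    have h4 := tally_ne_and (P := (status n (Function.update r (n + u) cur) cur · = 4)) hu h3
    have h5 := tally_pos (P := (status n (Function.update r (n + u) cur) cur · = 4)) hu h3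
    omega
  have hactive : ∃ v < n, Function.update r (n + u) cur (n + v) = cur :=
    ⟨u, hu, Function.update_self _ _ _⟩
  constructor
  · intro hV
    have hord : ∀ v < n, r v ≠ 0 → 0 < r (n + v) ∧ r (n + v) < r v := fun v hv hrv => by
      have := hV.order v hv
      rw [he v hv] at this
      by_cases hvu : v = u
      · subst hvu
        have h2 := this hrv
        rw [Function.update_self] at h2
        have := h.le v
        omega
      · rw [hs v hvu] at this
        exact this hrv
    have hk := hV.active hactive
    rw [t3, t4] at hk
    refine ⟨⟨hord, fun v hv h2 h3 => ?_, fun u' hu' v hv hset => ?_, fun _ => by omega⟩, by omega⟩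
    · have hvu : v ≠ u := by rintro rfl; omega
      rw [← overlapCount_place h.le h0 h3 (by omega)]
      exact hV.overlap v hv (by rwa [hs v hvu]) (by rwa [hs v hvu])
    · rw [← atomNumber_place h0 hset (hord u' hu') (hord v hv)]
      exact hV.allowed u' hu' v hv ((settled_place_iff h0).2 hset)
  · rintro ⟨hV, hk⟩
    have hru : r u = 0 := by
      by_contra hru
      have := hV.order u hu hru
      omega
    refine ⟨fun v hv hrv => ?_, fun v hv h4 h5 => ?_, fun u' hu' v hv hset => ?_, fun _ => by omega⟩
    · rw [he v hv] at hrv ⊢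
      have hvu : v ≠ u := by rintro rfl; exact hrv hru
      rw [hs v hvu]
      exact hV.order v hv hrv
    · have hvu : v ≠ u := by rintro rfl; rw [Function.update_self] at h5; omega
      rw [hs v hvu] at h4 h5
      rw [overlapCount_place h.le h0 h5 (by omega)]
      exact hV.overlap v hv h4 h5
    · rw [settled_place_iff h0] at hset
      rw [atomNumber_place h0 hset (hV.order u' hu') (hV.order v hv)]
      exact hV.allowed u' hu' v hv hset

/-- An old open variable overlaps with everything that starts in the part being closed. -/
theorem overlapCount_close_old (h : IsPartial n r cur)
    (hord : ∀ v < n, r v ≠ 0 → 0 < r (n + v) ∧ r (n + v) < r v) {v : ℕ}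
    (hst : status n r cur v = 3) :
    overlapCount n r (cur + 1) v = overlapCount n r cur v + tally n (status n r cur · = 4) := by
  have hv3 := (status_eq_three h).1 hst
  unfold overlapCount
  rw [← tally_or]
  · refine tally_congr fun w hw => ?_
    rw [status_eq_four h]
    unfold Meet
    have := hord w hw
    have := h.le w
    by_cases hwv : w = v
    · subst hwv; omega
    · omega
  · intro w hw h1 h2
    rw [status_eq_four h] at h2
    omega

/-- A variable that starts in the part being closed overlaps with all others that are open after it. -/
theorem overlapCount_close_new (h : IsPartial n r cur)
    (hord : ∀ v < n, r v ≠ 0 → 0 < r (n + v) ∧ r (n + v) < r v) {v : ℕ} (hv : v < n)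
    (hst : status n r cur v = 4) : overlapCount n r (cur + 1) v =
      tally n (status n r cur · = 3) + tally n (status n r cur · = 4) - 1 := by
  have hv4 := (status_eq_four h).1 hst
  have hordv := hord v hv
  have hlev := h.le v
  have h1 := h.one_le
  rw [← tally_or (fun w _ h1 h2 => by omega), ← tally_ne_and hv (Or.inr hst)]
  unfold overlapCount
  refine tally_congr fun w hw => ?_
  rw [status_eq_four h, status_eq_three h]
  unfold Meet
  have := hord w hw
  have := h.le w
  by_cases hwv : w = v
  · subst hwv; omega
  · omega

theorem overlapCount_close_ended (h : IsPartial n r cur) {v : ℕ} (hv : r v ≠ 0) :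
    overlapCount n r (cur + 1) v = overlapCount n r cur v := by
  refine tally_congr fun w hw => ?_
  have := h.le v
  unfold Meet
  omega

/-- Closing a part adds its new variables to the overlap counts and settles new pairs. -/
theorem isValid_close_iff (h : IsPartial n r cur) :
    IsValid n k Al r (cur + 1) ↔ IsValid n k Al r cur ∧
      (∀ v < n, (status n r cur v = 3 →
          overlapCount n r cur v + tally n (status n r cur · = 4) < k) ∧
        (status n r cur v = 4 →
          tally n (status n r cur · = 3) + tally n (status n r cur · = 4) ≤ k)) ∧
      ∀ u < n, ∀ v < n, NewlySettled n r cur u v →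
        Al u v (atomNumber (r (n + u)) (r u) (r (n + v)) (r v)) := by
  constructor
  · intro hV
    have h3 : ∀ v < n, status n r cur v = 3 →
        overlapCount n r cur v + tally n (status n r cur · = 4) < k := fun v hv hst => by
      have hst' := (status_eq_three h).1 hst
      rw [← overlapCount_close_old h hV.order hst]
      exact hV.overlap v hv hst'.1 (by omega)
    have h4 : ∀ v < n, status n r cur v = 4 →
        tally n (status n r cur · = 3) + tally n (status n r cur · = 4) ≤ k := fun v hv hst => by
      have hst' := (status_eq_four h).1 hst
      have := hV.overlap v hv (by have := h.one_le; omega) (by omega)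
      rw [overlapCount_close_new h hV.order hv hst] at this
      omega
    refine ⟨⟨hV.order, fun v hv h1 h2 => ?_, fun u hu v hv hset => hV.allowed u hu v hv ?_,
      fun ⟨v, hv, hvc⟩ => h4 v hv ((status_eq_four h).2 hvc)⟩,
      fun v hv => ⟨h3 v hv, h4 v hv⟩, fun u hu v hv hset => hV.allowed u hu v hv hset.1⟩
    · refine lt_of_le_of_lt (tally_mono fun w _ hw => ?_) (hV.overlap v hv h1 (by omega))
      exact ⟨hw.1, hw.2.1, by omega, hw.2.2.2⟩
    · unfold Settled at hset ⊢; omega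
  · rintro ⟨hV, hcnt, hset⟩
    refine ⟨hV.order, fun v hv h1 h2 => ?_, fun u hu v hv hs => ?_, fun ⟨v, _, hvc⟩ => ?_⟩
    · by_cases hvc : r (n + v) = cur
      · have hst := (status_eq_four h).2 hvc
        rw [overlapCount_close_new h hV.order hv hst]
        have := (hcnt v hv).2 hst
        have := tally_pos (P := (status n r cur · = 4)) hv hst
        omega
      · by_cases hrv : r v = 0
        · have hst := (status_eq_three h).2 ⟨h1, by omega, hrv⟩
          rw [overlapCount_close_old h hV.order hst]
          exact (hcnt v hv).1 hst
        · rw [overlapCount_close_ended h hrv]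
          exact hV.overlap v hv h1 (by omega)
    · by_cases hs' : Settled n r cur u v
      · exact hV.allowed u hu v hv hs'
      · exact hset u hu v hv ⟨hs, hs'⟩
    · have := h.le (n + v)
      omega

end

end AllenDP

namespace AllenDP

section

variable {n k : ℕ} {Al : ℕ → ℕ → ℕ → Prop} {r : ℕ → ℕ} {cur c : ℕ}

/-- The state of a partial ordered partition decides which letters can be read next. -/
theorem isValid_step_iff (h : IsPartial n r cur) (hc : c ≤ 2 * n) :
    (IsLetter n r cur c ∧ IsValid n k Al (stepRank n r cur c) (stepPart n cur c)) ↔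
      IsValid n k Al r cur ∧ StepOk n k Al (stateDigits n r cur) c := by
  have hb := h.one_le
  unfold IsLetter stepRank stepPart StepOk
  rcases Nat.lt_or_ge c n with hcn | hcn
  · have c1 : c < 2 * n := by omega
    simp only [c1, if_true, forall_true_left, hcn, not_le.2 hcn, not_le.2 c1, IsEmpty.forall_iff,
      and_true, last_le_iff h, stateDigits_status hcn]
    constructor
    · rintro ⟨⟨h0, hl⟩, hV⟩
      rw [isValid_place_end_iff h hcn h0 hl] at hV
      exact ⟨hV.1, hl, hV.2⟩
    · rintro ⟨hV, hl, hst⟩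
      have h0 := ((status_eq_three h).1 hst).2.2
      exact ⟨⟨h0, hl⟩, (isValid_place_end_iff h hcn h0 hl).2 ⟨hV, hst⟩⟩
  rcases Nat.lt_or_ge c (2 * n) with hc2 | hc2
  · obtain ⟨u, rfl⟩ := Nat.exists_eq_add_of_le hcn
    have hu : u < n := by omega
    simp only [hc2, if_true, forall_true_left, hcn, not_lt.2 hcn, not_le.2 hc2, IsEmpty.forall_iff,
      and_true, true_and, last_le_iff h, Nat.add_sub_cancel_left, stateDigits_status hu,
      statusCount_stateDigits, status_eq_zero h]
    constructor
    · rintro ⟨⟨h0, hl⟩, hV⟩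
      rw [isValid_place_start_iff h hu h0] at hV
      exact ⟨hV.1, hl, h0, hV.2⟩
    · rintro ⟨hV, hl, h0, hk⟩
      exact ⟨⟨h0, hl⟩, (isValid_place_start_iff h hu h0).2 ⟨hV, hk⟩⟩
  · simp only [hc2, not_lt.2 hc2, not_lt.2 hcn, if_false, forall_true_left, IsEmpty.forall_iff,
      true_and, implies_true, last_pos_iff h, isValid_close_iff h, statusCount_stateDigits]
    have key : ∀ hV : IsValid n k Al r cur, ((∀ v < n, (status n r cur v = 3 →
          overlapCount n r cur v + tally n (status n r cur · = 4) < k) ∧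
        (status n r cur v = 4 →
          tally n (status n r cur · = 3) + tally n (status n r cur · = 4) ≤ k)) ∧
      ∀ u < n, ∀ v < n, NewlySettled n r cur u v →
        Al u v (atomNumber (r (n + u)) (r u) (r (n + v)) (r v))) ↔
      ((∀ v < n, (stateDigits n r cur v = 3 →
          stateDigits n r cur (2 * n + v) + tally n (status n r cur · = 4) < k) ∧
        (stateDigits n r cur v = 4 →
          tally n (status n r cur · = 3) + tally n (status n r cur · = 4) ≤ k)) ∧
      ∀ u < n, ∀ v < n, settledAtom n (stateDigits n r cur) u v = 13 ∨
        Al u v (settledAtom n (stateDigits n r cur) u v)) := by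
      intro hV
      refine and_congr (forall₂_congr fun v hv => ?_) (forall₂_congr fun u hu =>
        forall₂_congr fun v hv => ?_)
      · rw [stateDigits_status hv]
        refine and_congr (imp_congr_right fun hst => ?_) Iff.rfl
        rw [stateDigits_overlap hv, if_pos (Or.inr hst)]
      · rw [settledAtom_stateDigits h hV hu hv]
        by_cases hs : NewlySettled n r cur u v
        · rw [if_pos hs]
          have := atomNumber_lt (r (n + u)) (r u) (r (n + v)) (r v)
          exact ⟨fun h' => Or.inr (h' hs), fun h' _ => h'.resolve_left (by omega)⟩
        · rw [if_neg hs]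
          simp [hs]
    constructor
    · rintro ⟨hq, hV, hrest⟩
      exact ⟨hV, hq, (key hV).1 hrest⟩
    · rintro ⟨hV, hq, hrest⟩
      exact ⟨hq, hV, (key hV).2 hrest⟩

theorem stateDigits_eq_zero {i : ℕ} (hi : 3 * n < i) : stateDigits n r cur i = 0 := by
  unfold stateDigits
  rw [if_neg (by omega), if_neg (by omega), if_neg (by omega), if_neg (by omega)]

theorem last_place (hl : ∀ q, r q = cur → q < c) (hc : c < 2 * n) :
    stateDigits n (Function.update r c cur) cur (3 * n) = c + 1 := by
  rw [stateDigits_last]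
  apply le_antisymm
  · refine Finset.sup_le fun q hq => ?_
    simp only [Finset.mem_filter, Finset.mem_range, Function.update_apply] at hq
    have h2 := hq.2
    split_ifs at h2 with hqc
    · omega
    · have := hl q h2; omega
  · exact Finset.le_sup (f := (· + 1)) (b := c) (by simp [hc])

/-- Placing a point leaves the digits of all other variables unchanged. -/
theorem stateDigits_place (h : IsPartial n r cur) (h0 : r c = 0) (hold : ∀ v < n,
    IsOld n (Function.update r c cur) cur v ↔ IsOld n r cur v) {i : ℕ} (hi : n ≤ i)
    (hi' : i ≠ 3 * n) :
    stateDigits n (Function.update r c cur) cur i = stateDigits n r cur i := by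
  have hb := h.one_le
  rcases Nat.lt_or_ge i (2 * n) with h2 | h2
  · obtain ⟨v, rfl⟩ := Nat.exists_eq_add_of_le hi
    have hv : v < n := by omega
    rw [stateDigits_key hv, stateDigits_key hv]
    simp only [hold v hv]
    refine if_ctx_congr Iff.rfl (fun hov => tally_congr fun w hw => ?_) fun _ => rfl
    rw [hold w hw]
    refine and_congr_right fun how => ?_
    have h1 := (isOld_iff h).1 hov
    have h2 := (isOld_iff h).1 how
    rw [Function.update_of_ne (by rintro rfl; omega), Function.update_of_ne (by rintro rfl; omega)]
  · rcases Nat.lt_or_ge i (3 * n) with h3 | h3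
    · obtain ⟨v, rfl⟩ := Nat.exists_eq_add_of_le h2
      have hv : v < n := by omega
      rw [stateDigits_overlap hv, stateDigits_overlap hv]
      simp only [hold v hv]
      refine if_ctx_congr Iff.rfl (fun hov => ?_) fun _ => rfl
      have h1 := (isOld_iff h).1 hov
      exact overlapCount_place h.le h0 (by omega) (by rintro rfl; omega)
    · rw [stateDigits_eq_zero (by omega), stateDigits_eq_zero (by omega)]

/-- The state after a letter is determined by the state before it. -/
theorem stepDigits_stateDigits (h : IsPartial n r cur) (hV : IsValid n k Al r cur)
    (hc : c ≤ 2 * n) (hl : IsLetter n r cur c)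
    (hV' : IsValid n k Al (stepRank n r cur c) (stepPart n cur c)) :
    stepDigits n (stateDigits n r cur) c =
      stateDigits n (stepRank n r cur c) (stepPart n cur c) := by
  have hb := h.one_le
  have h' := h.step hl
  funext i
  unfold stepDigits
  unfold stepRank stepPart at *
  rcases Nat.lt_or_ge c (2 * n) with hc2 | hc2
  · obtain ⟨h0, hl⟩ := hl.1 hc2
    simp only [if_pos hc2] at hV' h' ⊢
    by_cases hi3 : i = 3 * n
    · subst hi3
      rw [if_pos rfl, last_place hl hc2]
    rw [if_neg hi3]
    rcases Nat.lt_or_ge c n with hcn | hcn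
    · rw [if_pos hcn]
      have hst := ((isValid_place_end_iff h hcn h0 hl).1 hV').2
      have hst' := (status_eq_three h).1 hst
      have hstv : ∀ v < n, status n (Function.update r c cur) cur v =
          if v = c then 2 else status n r cur v := fun v hv => by
        unfold status
        rw [Function.update_of_ne (show n + v ≠ c by omega)]
        by_cases hvc : v = c
        · subst hvc
          rw [Function.update_self, if_pos rfl]
          split_ifs <;> omega
        · rw [Function.update_of_ne hvc, if_neg hvc]
      rcases Nat.lt_or_ge i n with hin | hin
      · rw [stateDigits_status hin, stateDigits_status hin, hstv i hin]
      · rw [if_neg (by omega), stateDigits_place h h0 (fun v hv => ?_) hin hi3]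
        unfold IsOld
        rw [hstv v hv]
        split_ifs with hvc
        · subst hvc; simp [hst]
        · rfl
    · rw [if_neg (by omega)]
      obtain ⟨u, rfl⟩ := Nat.exists_eq_add_of_le hcn
      have hu : u < n := by omega
      rw [Nat.add_sub_cancel_left]
      rcases Nat.lt_or_ge i n with hin | hin
      · rw [stateDigits_status hin, stateDigits_status hin, status_place_start h hu h0 hin]
      · rw [if_neg (by omega), stateDigits_place h h0 (fun v hv => ?_) hin hi3]
        unfold IsOld
        rw [status_place_start h hu h0 hv]
        have := (status_eq_zero h).2 h0
        split_ifs with hvu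
        · subst hvu; omega
        · rfl
  · simp only [if_neg (not_lt.2 hc2)] at hV' h' ⊢
    have hst : ∀ v < n, status n r (cur + 1) v = if status n r cur v = 2 then 1 else
        if status n r cur v = 4 then 3 else status n r cur v := fun v hv => by
      have h1 := h.le v
      have h2 := h.le (n + v)
      have h3 := hV.order v hv
      unfold status
      split_ifs <;> omega
    have hold : ∀ v < n, IsOld n r (cur + 1) v ↔ status n r cur v = 3 ∨ status n r cur v = 4 :=
      fun v hv => by
        unfold IsOld
        rw [hst v hv]
        split_ifs <;> omega
    rcases Nat.lt_or_ge i n with hin | hin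
    · rw [if_pos hin]
      simp only [stateDigits_status hin, hst i hin]
    rw [if_neg (by omega)]
    rcases Nat.lt_or_ge i (2 * n) with hi2 | hi2
    · obtain ⟨v, rfl⟩ := Nat.exists_eq_add_of_le hin
      have hv : v < n := by omega
      rw [if_pos hi2, Nat.add_sub_cancel_left, stateDigits_status hv,
        stateDigits_key (cur := cur + 1) hv, statusCount_stateDigits]
      simp only [hold v hv]
      by_cases h3 : status n r cur v = 3
      · rw [if_pos h3, if_pos (Or.inl h3), ← tally_eq_sum]
        refine tally_congr fun w hw => ?_
        rw [hold w hw, stateDigits_status hw]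
        have h3' := (status_eq_three h).1 h3
        have h4 := status_eq_four (v := w) h
        constructor
        · rintro ⟨h5, h6⟩
          rw [key_lt_key hw hv (Or.inr h5) (Or.inr h3)] at h6
          exact ⟨Or.inl h5, h6⟩
        · rintro ⟨h5, h6⟩
          have h5 : status n r cur w = 3 := h5.resolve_right fun h5 => by
            have := h4.1 h5; omega
          rw [key_lt_key hw hv (Or.inr h5) (Or.inr h3)]
          exact ⟨h5, h6⟩
      · rw [if_neg h3]
        by_cases h4 : status n r cur v = 4
        · rw [if_pos h4, if_pos (Or.inr h4)]
          refine tally_congr fun w hw => ?_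
          rw [hold w hw, (status_eq_four h).1 h4, status_eq_three h, status_eq_four h]
          omega
        · rw [if_neg h4, if_neg (by omega)]
    rw [if_neg (by omega)]
    rcases Nat.lt_or_ge i (3 * n) with hi3 | hi3
    · obtain ⟨v, rfl⟩ := Nat.exists_eq_add_of_le hi2
      have hv : v < n := by omega
      rw [if_pos hi3, Nat.add_sub_cancel_left, stateDigits_status hv,
        stateDigits_overlap hv, stateDigits_overlap hv, statusCount_stateDigits,
        statusCount_stateDigits]
      simp only [hold v hv]
      by_cases h3 : status n r cur v = 3
      · rw [if_pos h3, if_pos (Or.inl h3), if_pos (Or.inr h3),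
          overlapCount_close_old h hV.order h3]
      · rw [if_neg h3]
        by_cases h4 : status n r cur v = 4
        · rw [if_pos h4, if_pos (Or.inr h4), overlapCount_close_new h hV.order hv h4]
        · rw [if_neg h4, if_neg (by omega)]
    · rw [if_neg (by omega)]
      rcases Nat.lt_or_ge (3 * n) i with hi4 | hi4
      · rw [stateDigits_eq_zero hi4]
      · obtain rfl : i = 3 * n := by omega
        have := (last_le_iff h' 0).2 fun q hq => by have := h.le q; omega
        omega

end

end AllenDP

/-! ### Counting partial ordered partitions by their states -/

namespace AllenDP

theorem sum_digits_lt (d : ℕ → ℕ) {D : ℕ} (hd : ∀ i, d i < D) (N : ℕ) :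
    ∑ i ∈ Finset.range N, d i * D ^ i < D ^ N := by
  induction N with
  | zero => simp
  | succ N ih =>
    rw [Finset.sum_range_succ, pow_succ']
    calc _ < D ^ N + d N * D ^ N := by omega
      _ = (d N + 1) * D ^ N := by ring
      _ ≤ D * D ^ N := Nat.mul_le_mul_right _ (hd N)

theorem sum_digits_div_mod (d : ℕ → ℕ) {D : ℕ} (hd : ∀ i, d i < D) (N i : ℕ) :
    (∑ j ∈ Finset.range N, d j * D ^ j) / D ^ i % D = if i < N then d i else 0 := by
  have hD : 0 < D := (Nat.zero_le _).trans_lt (hd 0)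
  induction N with
  | zero => simp
  | succ N ih =>
    rcases lt_trichotomy i N with h | rfl | h
    · rw [if_pos h] at ih
      rw [if_pos (by omega), Finset.sum_range_succ, ← ih]
      obtain ⟨e, rfl⟩ := Nat.exists_eq_add_of_lt h
      rw [show d (i + e + 1) * D ^ (i + e + 1) = D ^ i * (D * (d (i + e + 1) * D ^ e)) by ring,
        Nat.add_mul_div_left _ _ (by positivity), Nat.add_mul_mod_self_left]
    · rw [if_pos (by omega), Finset.sum_range_succ, mul_comm (d i),
        Nat.add_mul_div_left _ _ (by positivity), Nat.div_eq_of_lt (sum_digits_lt d hd i), zero_add,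
        Nat.mod_eq_of_lt (hd i)]
    · rw [if_neg (by omega), Nat.div_eq_of_lt, Nat.zero_mod]
      exact (sum_digits_lt d hd (N + 1)).trans_le (Nat.pow_le_pow_right hD h)

theorem code_eq_sum (n : ℕ) (d : ℕ → ℕ) :
    code n d = ∑ i ∈ Finset.range (3 * n + 1), d i * base n ^ i :=
  Finset.sum_congr rfl fun i hi => by rw [cappedPow_eq (Finset.mem_range.1 hi).le]

theorem code_lt {n : ℕ} {d : ℕ → ℕ} (hd : ∀ i, d i < base n) : code n d < base n ^ (3 * n + 1) := by
  rw [code_eq_sum]; exact sum_digits_lt d hd _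

theorem digit_code {n : ℕ} {d : ℕ → ℕ} (hd : ∀ i, d i < base n) (h0 : ∀ i, 3 * n < i → d i = 0) :
    digit n (code n d) = d := by
  funext i
  unfold digit
  rcases Nat.lt_or_ge i (3 * n + 1) with h | h
  · rw [cappedPow_eq h.le, code_eq_sum, sum_digits_div_mod d hd, if_pos h]
  · have : cappedPow (3 * n + 1) (base n) i = base n ^ (3 * n + 1) := by
      rw [cappedPow, Finset.prod_congr rfl fun j hj => if_pos (by
        have := Finset.mem_range.1 hj; omega)]
      simp
    rw [this, Nat.div_eq_of_lt (code_lt hd), Nat.zero_mod, h0 i (by omega)]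

theorem tally_le (n : ℕ) (P : ℕ → Prop) [DecidablePred P] : tally n P ≤ n :=
  (Finset.card_filter_le _ _).trans (by simp)

theorem stateDigits_lt (n : ℕ) (r : ℕ → ℕ) (cur i : ℕ) : stateDigits n r cur i < base n := by
  unfold stateDigits base overlapCount
  split_ifs
  · have := status_le_four (n := n) (r := r) (cur := cur) i; omega
  · exact (tally_le _ _).trans_lt (by omega)
  · omega
  · exact (tally_le _ _).trans_lt (by omega)
  · omega
  · refine lt_of_le_of_lt (Finset.sup_le (a := 2 * n) fun p hp => ?_) (by omega)
    have := (Finset.mem_filter.1 hp).1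
    rw [Finset.mem_range] at this
    omega
  · omega

/-- The code of the state of a partial ordered partition, given by ranks and the current part. -/
def stateCode (n : ℕ) (x : (ℕ → ℕ) × ℕ) : ℕ := code n (stateDigits n x.1 x.2)

theorem digit_stateCode (n : ℕ) (x : (ℕ → ℕ) × ℕ) :
    digit n (stateCode n x) = stateDigits n x.1 x.2 :=
  digit_code (stateDigits_lt n x.1 x.2) fun _ => stateDigits_eq_zero

/-- A partial ordered partition after the letter `c`. -/
def stepPair (n : ℕ) (x : (ℕ → ℕ) × ℕ) (c : ℕ) : (ℕ → ℕ) × ℕ :=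
  (stepRank n x.1 x.2 c, stepPart n x.2 c)

/-- The number of placed points. -/
def placed (n : ℕ) (r : ℕ → ℕ) : ℕ := tally (2 * n) (r · ≠ 0)

/-- The valid partial ordered partitions that are reached by reading `m` letters. -/
def layerSet (n k : ℕ) (Al : ℕ → ℕ → ℕ → Prop) (m : ℕ) : Set ((ℕ → ℕ) × ℕ) :=
  {x | IsPartial n x.1 x.2 ∧ IsValid n k Al x.1 x.2 ∧ placed n x.1 + x.2 = m + 1}

section

variable {n k : ℕ} {Al : ℕ → ℕ → ℕ → Prop} {m : ℕ} {x : (ℕ → ℕ) × ℕ} {c : ℕ}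

theorem placed_update {r : ℕ → ℕ} {a : ℕ} (hc : c < 2 * n) (h0 : r c = 0) (ha : a ≠ 0) :
    placed n (Function.update r c a) = placed n r + 1 := by
  unfold placed
  have h1 : tally (2 * n) (fun v => v ≠ c ∧ Function.update r c a v ≠ 0) = tally (2 * n) (r · ≠ 0) :=
    tally_congr fun v _ => by
      by_cases hv : v = c
      · subst hv; simp [h0]
      · simp [hv]
  have hP : Function.update r c a c ≠ 0 := by simpa using ha
  have h2 := tally_ne_and (P := (Function.update r c a · ≠ 0)) hc hP
  have h3 := tally_pos (P := (Function.update r c a · ≠ 0)) hc hP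
  omega

theorem stepPair_mem_layerSet (hx : x ∈ layerSet n k Al m) (hc : c ≤ 2 * n)
    (hok : StepOk n k Al (stateDigits n x.1 x.2) c) :
    IsLetter n x.1 x.2 c ∧ stepPair n x c ∈ layerSet n k Al (m + 1) := by
  obtain ⟨hp, hV, hm⟩ := hx
  obtain ⟨hl, hV'⟩ := (isValid_step_iff hp hc).2 ⟨hV, hok⟩
  refine ⟨hl, hp.step hl, hV', ?_⟩
  have := hp.one_le
  simp only [stepPair, stepRank, stepPart]
  by_cases h2 : c < 2 * n
  · rw [if_pos h2, if_pos h2, placed_update h2 (hl.1 h2).1 (by omega)]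
    omega
  · rw [if_neg h2, if_neg h2]
    omega

/-- Every partial ordered partition has at most one predecessor. -/
theorem stepPair_injective {x x' : (ℕ → ℕ) × ℕ} {c c' : ℕ} (hp : IsPartial n x.1 x.2)
    (hp' : IsPartial n x'.1 x'.2) (hc : c ≤ 2 * n) (hc' : c' ≤ 2 * n) (hl : IsLetter n x.1 x.2 c)
    (hl' : IsLetter n x'.1 x'.2 c') (h : stepPair n x c = stepPair n x' c') : x = x' ∧ c = c' := by
  obtain ⟨r, cur⟩ := x
  obtain ⟨r', cur'⟩ := x'
  simp only [stepPair, Prod.mk.injEq, stepRank, stepPart] at *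
  obtain ⟨h1, h2⟩ := h
  by_cases h3 : c < 2 * n <;> by_cases h4 : c' < 2 * n
  · rw [if_pos h3, if_pos h4] at h1 h2
    subst h2
    obtain ⟨h5, h6⟩ := hl.1 h3
    obtain ⟨h7, h8⟩ := hl'.1 h4
    have hcc : c = c' := by
      by_contra hne
      have e1 := congrFun h1 c
      have e2 := congrFun h1 c'
      rw [Function.update_self, Function.update_of_ne hne] at e1
      rw [Function.update_self, Function.update_of_ne (Ne.symm hne)] at e2
      have := h6 c' e2
      have := h8 c e1.symm
      omega
    subst hcc
    refine ⟨⟨funext fun q => ?_, rfl⟩, rfl⟩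
    by_cases hq : q = c
    · rw [hq, h5, h7]
    · have := congrFun h1 q
      rwa [Function.update_of_ne hq, Function.update_of_ne hq] at this
  · rw [if_pos h3, if_neg h4] at h1 h2
    have e1 := congrFun h1 c
    rw [Function.update_self] at e1
    have := hp'.le c
    omega
  · rw [if_neg h3, if_pos h4] at h1 h2
    have e1 := congrFun h1 c'
    rw [Function.update_self] at e1
    have := hp.le c'
    omega
  · rw [if_neg h3, if_neg h4] at h1 h2
    exact ⟨⟨h1, by omega⟩, by omega⟩

/-- Every valid partial ordered partition other than the empty one has a valid predecessor: the
largest point of the current part is removed, or the last closing is undone if this part is empty. -/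
theorem exists_pred {y : (ℕ → ℕ) × ℕ} (hy : y ∈ layerSet n k Al (m + 1)) :
    ∃ x ∈ layerSet n k Al m, ∃ c ≤ 2 * n, StepOk n k Al (stateDigits n x.1 x.2) c ∧
      stepPair n x c = y := by
  obtain ⟨r, cur⟩ := y
  obtain ⟨hp, hV, hm⟩ := hy
  simp only at hp hV hm
  have hone := hp.one_le
  by_cases hex : ∃ p, r p = cur
  · have hlt : ∀ p, r p = cur → p < 2 * n := fun p hpc => by
      by_contra h2
      have := hp.eq_zero p (by omega)
      omega
    -- The last letter placed the largest point of the current part.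
    obtain ⟨c, hc, hmax⟩ : ∃ c, r c = cur ∧ ∀ q, r q = cur → q ≤ c := by
      obtain ⟨p, hpc⟩ := hex
      obtain ⟨c, hc, hmax⟩ := Finset.exists_max_image ((Finset.range (2 * n)).filter (r · = cur)) id
        ⟨p, by simp [hpc, hlt p hpc]⟩
      simp only [Finset.mem_filter, Finset.mem_range] at hc hmax
      exact ⟨c, hc.2, fun q hq => hmax q ⟨hlt q hq, hq⟩⟩
    have hc2 := hlt c hc
    have hupd : Function.update (Function.update r c 0) c cur = r := by
      rw [Function.update_idem, ← hc, Function.update_eq_self]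
    have hstep : stepPair n (Function.update r c 0, cur) c = (r, cur) := by
      simp only [stepPair, stepRank, stepPart, if_pos hc2, hupd]
    have hp' : IsPartial n (Function.update r c 0) cur := by
      refine ⟨hone, fun p => ?_, fun p h2 => ?_, fun i h1 h2 => ?_⟩
      · rw [Function.update_apply]; split_ifs
        · omega
        · exact hp.le p
      · rw [Function.update_of_ne (by omega)]; exact hp.eq_zero p h2
      · obtain ⟨p, hpi⟩ := hp.nonempty i h1 h2
        exact ⟨p, by rw [Function.update_of_ne (by rintro rfl; omega)]; exact hpi⟩
    have hl : IsLetter n (Function.update r c 0) cur c := by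
      refine ⟨fun _ => ⟨Function.update_self _ _ _, fun q hq => ?_⟩, fun h => by omega⟩
      by_cases hqc : q = c
      · subst hqc; rw [Function.update_self] at hq; omega
      · rw [Function.update_of_ne hqc] at hq
        have := hmax q hq
        omega
    obtain ⟨hV', hok⟩ := (isValid_step_iff (k := k) (Al := Al) hp' hc2.le).1 ⟨hl, by
      have h1 := congrArg Prod.fst hstep
      have h2 := congrArg Prod.snd hstep
      simp only [stepPair] at h1 h2
      rw [h1, h2]; exact hV⟩
    refine ⟨_, ⟨hp', hV', ?_⟩, c, hc2.le, hok, hstep⟩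
    have := placed_update (r := Function.update r c 0) hc2 (Function.update_self _ _ _)
      (show cur ≠ 0 by omega)
    rw [hupd] at this
    simp only
    omega
  · have hcur : 2 ≤ cur := by
      by_contra h2
      have h0 : ∀ p, r p = 0 := fun p => by
        have h3 := hp.le p
        have h4 : r p ≠ cur := fun h => hex ⟨p, h⟩
        omega
      have : placed n r = 0 := by simp [placed, tally, h0]
      omega
    have hl : IsLetter n r (cur - 1) (2 * n) :=
      ⟨fun h => by omega, fun _ => hp.nonempty (cur - 1) (by omega) (by omega)⟩
    have hp' : IsPartial n r (cur - 1) := by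
      refine ⟨by omega, fun p => ?_, hp.eq_zero, fun i h1 h2 => hp.nonempty i h1 (by omega)⟩
      have h3 := hp.le p
      have h4 : r p ≠ cur := fun h => hex ⟨p, h⟩
      omega
    have hstep : stepPair n (r, cur - 1) (2 * n) = (r, cur) := by
      simp only [stepPair, stepRank, stepPart, lt_irrefl, if_false]
      rw [show cur - 1 + 1 = cur by omega]
    obtain ⟨hV', hok⟩ := (isValid_step_iff (k := k) (Al := Al) hp' le_rfl).1 ⟨hl, by
      have h1 := congrArg Prod.fst hstep
      have h2 := congrArg Prod.snd hstep
      simp only [stepPair] at h1 h2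
      rw [h1, h2]; exact hV⟩
    refine ⟨_, ⟨hp', hV', ?_⟩, 2 * n, le_rfl, hok, hstep⟩
    simp only
    omega

theorem layerSet_zero : layerSet n k Al 0 = {(fun _ => 0, 1)} := by
  ext ⟨r, cur⟩
  simp only [layerSet, Set.mem_ofPred_eq, Set.mem_singleton_iff, Prod.mk.injEq]
  constructor
  · rintro ⟨hp, -, hm⟩
    have hone := hp.one_le
    refine ⟨funext fun p => ?_, by omega⟩
    by_contra hpc
    have h2 : p < 2 * n := by
      by_contra h2; exact hpc (hp.eq_zero p (by omega))
    have : 0 < placed n r := tally_pos (P := (r · ≠ 0)) h2 hpc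
    omega
  · rintro ⟨rfl, rfl⟩
    refine ⟨⟨le_rfl, by simp, by simp, fun i h1 h2 => by omega⟩,
      ⟨by simp, by simp, fun u _ v _ h => by unfold Settled at h; omega, by simp⟩, ?_⟩
    simp [placed, tally]

theorem finite_layerSet (n k : ℕ) (Al : ℕ → ℕ → ℕ → Prop) (m : ℕ) :
    (layerSet n k Al m).Finite := by
  induction m with
  | zero => rw [layerSet_zero]; exact Set.finite_singleton _
  | succ m ih =>
    refine ((ih.prod (Set.finite_Iic (2 * n))).image fun p => stepPair n p.1 p.2).subset ?_
    intro y hy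
    obtain ⟨x, hx, c, hc, -, rfl⟩ := exists_pred hy
    exact ⟨(x, c), ⟨hx, hc⟩, rfl⟩

/-- The finite set of the valid partial ordered partitions reached by reading `m` letters. -/
noncomputable def layer (n k : ℕ) (Al : ℕ → ℕ → ℕ → Prop) (m : ℕ) : Finset ((ℕ → ℕ) × ℕ) :=
  (finite_layerSet n k Al m).toFinset

theorem mem_layer : x ∈ layer n k Al m ↔ x ∈ layerSet n k Al m := Set.Finite.mem_toFinset _

/-- The codes of the states reached by reading `m` letters. -/
noncomputable def layerStates (n k : ℕ) (Al : ℕ → ℕ → ℕ → Prop) (m : ℕ) : Finset ℕ :=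
  (layer n k Al m).image (stateCode n)

/-- The number of valid partial ordered partitions that are reached by reading `m` letters and have
the state `t`. -/
noncomputable def stateCount (n k : ℕ) (Al : ℕ → ℕ → ℕ → Prop) (m t : ℕ) : ℕ :=
  ((layer n k Al m).filter (stateCode n · = t)).card

theorem transition_stateCode (hx : x ∈ layerSet n k Al m) (hc : c ≤ 2 * n) (t : ℕ) :
    transition n k Al (stateCode n x) c = t + 1 ↔
      StepOk n k Al (stateDigits n x.1 x.2) c ∧ stateCode n (stepPair n x c) = t := by
  unfold transition
  rw [digit_stateCode]
  by_cases hok : StepOk n k Al (stateDigits n x.1 x.2) c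
  · obtain ⟨hl, -, hV', -⟩ := stepPair_mem_layerSet hx hc hok
    rw [if_pos hok, stepDigits_stateDigits hx.1 hx.2.1 hc hl hV']
    simp [hok, stateCode, stepPair]
  · simp [hok]

/-- The recursion evaluated by the dynamic program: a state is counted once for every predecessor
and every letter leading to it. -/
theorem stateCount_succ (t : ℕ) : stateCount n k Al (m + 1) t =
    ∑ s ∈ layerStates n k Al m, ∑ c ∈ Finset.range (2 * n + 1),
      if transition n k Al s c = t + 1 then stateCount n k Al m s else 0 := by
  classical
  have h1 : stateCount n k Al (m + 1) t = (((layer n k Al m) ×ˢ Finset.range (2 * n + 1)).filter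
      fun p => transition n k Al (stateCode n p.1) p.2 = t + 1).card := by
    symm
    unfold stateCount
    have hmem : ∀ p ∈ ((layer n k Al m) ×ˢ Finset.range (2 * n + 1)).filter
        (fun p => transition n k Al (stateCode n p.1) p.2 = t + 1),
        p.1 ∈ layerSet n k Al m ∧ p.2 ≤ 2 * n ∧ StepOk n k Al (stateDigits n p.1.1 p.1.2) p.2 ∧
          stateCode n (stepPair n p.1 p.2) = t := by
      intro p hp
      simp only [Finset.mem_filter, Finset.mem_product, mem_layer, Finset.mem_range] at hp
      have hc : p.2 ≤ 2 * n := by omega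
      exact ⟨hp.1.1, hc, (transition_stateCode hp.1.1 hc t).1 hp.2⟩
    refine Finset.card_bij (fun p _ => stepPair n p.1 p.2) (fun p hp => ?_)
      (fun p hp q hq hpq => ?_) fun y hy => ?_
    · obtain ⟨h1, h2, h3, h4⟩ := hmem p hp
      rw [Finset.mem_filter, mem_layer]
      exact ⟨(stepPair_mem_layerSet h1 h2 h3).2, h4⟩
    · obtain ⟨h1, h2, h3, h4⟩ := hmem p hp
      obtain ⟨h1', h2', h3', h4'⟩ := hmem q hq
      obtain ⟨e1, e2⟩ := stepPair_injective h1.1 h1'.1 h2 h2' (stepPair_mem_layerSet h1 h2 h3).1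
        (stepPair_mem_layerSet h1' h2' h3').1 hpq
      exact Prod.ext e1 e2
    · rw [Finset.mem_filter, mem_layer] at hy
      obtain ⟨x, hx, c, hc, hok, rfl⟩ := exists_pred hy.1
      refine ⟨(x, c), ?_, rfl⟩
      simp only [Finset.mem_filter, Finset.mem_product, mem_layer, Finset.mem_range]
      exact ⟨⟨hx, by omega⟩, (transition_stateCode hx hc t).2 ⟨hok, hy.2⟩⟩
  rw [h1, Finset.card_filter, Finset.sum_product]
  rw [Finset.sum_comp (fun s => ∑ c ∈ Finset.range (2 * n + 1),
    if transition n k Al s c = t + 1 then 1 else 0) (stateCode n)]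
  refine Finset.sum_congr rfl fun s _ => ?_
  rw [smul_eq_mul, Finset.mul_sum]
  exact Finset.sum_congr rfl fun c _ => by simp only [mul_ite, mul_one, mul_zero]; rfl

theorem stateCount_zero (t : ℕ) : stateCount n k Al 0 t = if t = 0 then 1 else 0 := by
  have hl : layer n k Al 0 = {(fun _ => 0, 1)} := by
    ext x; rw [mem_layer, layerSet_zero]; simp
  have hd : stateDigits n (fun _ => 0) 1 = fun _ => 0 := by
    funext i
    simp [stateDigits, status, IsOld]
  have hc : stateCode n (fun _ => 0, 1) = 0 := by
    simp [stateCode, hd, code]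
  unfold stateCount
  rw [hl, Finset.filter_singleton, hc]
  split_ifs with h1 h2 h2
  · simp
  · omega
  · omega
  · simp

theorem mem_layerStates (t : ℕ) : t ∈ layerStates n k Al m ↔ stateCount n k Al m t ≠ 0 := by
  unfold layerStates stateCount
  rw [Finset.card_ne_zero, Finset.mem_image]
  constructor
  · rintro ⟨x, hx, rfl⟩
    exact ⟨x, by simp [hx]⟩
  · rintro ⟨x, hx⟩
    rw [Finset.mem_filter] at hx
    exact ⟨x, hx⟩

theorem layerStates_lt {t : ℕ} (ht : t ∈ layerStates n k Al m) : t < base n ^ (3 * n + 1) := by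
  obtain ⟨x, -, rfl⟩ := Finset.mem_image.1 ht
  exact code_lt (stateDigits_lt n x.1 x.2)

theorem card_layer_le (m : ℕ) : (layer n k Al m).card ≤ (2 * n + 1) ^ m := by
  classical
  induction m with
  | zero =>
    have hl : layer n k Al 0 = {(fun _ => 0, 1)} := by
      ext x; rw [mem_layer, layerSet_zero]; simp
    simp [hl]
  | succ m ih =>
    have hsub : layer n k Al (m + 1) ⊆ ((layer n k Al m) ×ˢ Finset.range (2 * n + 1)).image
        fun p => stepPair n p.1 p.2 := by
      intro y hy
      rw [mem_layer] at hy
      obtain ⟨x, hx, c, hc, -, rfl⟩ := exists_pred hy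
      exact Finset.mem_image.2 ⟨(x, c), by simp [mem_layer, hx]; omega, rfl⟩
    calc _ ≤ _ := Finset.card_le_card hsub
      _ ≤ _ := Finset.card_image_le
      _ ≤ _ := by
        rw [Finset.card_product, Finset.card_range, pow_succ]
        exact Nat.mul_le_mul_right _ ih

theorem stateCount_le (t : ℕ) : stateCount n k Al m t ≤ (2 * n + 1) ^ m :=
  (Finset.card_filter_le _ _).trans (card_layer_le m)

end

end AllenDP

/-! ### The number of states -/

namespace AllenDP

/-- Succinct descriptions of states: the last point, a bit for every variable (it has ended), at most
`k` variables that started before the current part and had not ended by then (with their order and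
their number of overlaps), and at most `k` variables that start in the current part.  An entry `n`
stands for an empty slot. -/
abbrev StateDescription (n k : ℕ) : Type :=
  Fin (2 * n + 1) × (Fin n → Bool) × (Fin k → Fin (n + 1) × Fin k × Fin k) × (Fin k → Fin (n + 1))

theorem card_stateDescription (n k : ℕ) : Fintype.card (StateDescription n k) =
    (2 * n + 1) * 2 ^ n * ((n + 1) * k) ^ (2 * k) := by
  simp only [StateDescription, Fintype.card_prod, Fintype.card_fun, Fintype.card_fin,
    Fintype.card_bool]
  rw [pow_mul, ← mul_pow (n := k), pow_two, mul_assoc (2 * n + 1),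
    show (n + 1) * (k * k) * (n + 1) = (n + 1) * k * ((n + 1) * k) by ring]

open Classical in
/-- The digits of the state that is described by `X`. -/
noncomputable def StateDescription.digits {n k : ℕ} (X : StateDescription n k) (i : ℕ) : ℕ :=
  if h : i < n then
    if ∃ j, (X.2.2.2 j : ℕ) = i then 4
    else if ∃ j, ((X.2.2.1 j).1 : ℕ) = i then if X.2.1 ⟨i, h⟩ then 2 else 3
    else if X.2.1 ⟨i, h⟩ then 1 else 0
  else if i < 2 * n then
    if h : ∃ j, ((X.2.2.1 j).1 : ℕ) = i - n then (X.2.2.1 h.choose).2.1 else 0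
  else if i < 3 * n then
    if h : ∃ j, ((X.2.2.1 j).1 : ℕ) = i - 2 * n then (X.2.2.1 h.choose).2.2 else 0
  else if i = 3 * n then X.1 else 0

/-- A set of at most `k` numbers below `n` fills `k` slots, with `n` as the entry of empty slots. -/
theorem exists_enumeration {n k : ℕ} (S : Finset ℕ) (hS : S.card ≤ k) (hn : ∀ v ∈ S, v < n) :
    ∃ e : Fin k → Fin (n + 1), ∀ v < n, (∃ j, (e j : ℕ) = v) ↔ v ∈ S := by
  refine ⟨fun j => if h : (j : ℕ) < S.card then ⟨S.equivFin.symm ⟨j, h⟩, ?_⟩ else Fin.last n, ?_⟩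
  · have := hn _ (S.equivFin.symm ⟨j, h⟩).2
    omega
  intro v hv
  constructor
  · rintro ⟨j, hj⟩
    dsimp only at hj
    split_ifs at hj with h
    · rw [← hj]; exact (S.equivFin.symm ⟨j, h⟩).2
    · simp only [Fin.val_last] at hj; omega
  · intro hvS
    have hlt := (S.equivFin ⟨v, hvS⟩).2
    refine ⟨⟨S.equivFin ⟨v, hvS⟩, by omega⟩, ?_⟩
    simp only [hlt, dif_pos, Fin.eta, Equiv.symm_apply_apply]

/-- The state of a valid partial ordered partition has a succinct description, because at most `k`
variables are old and at most `k` are new. -/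
theorem exists_description {n k : ℕ} {Al : ℕ → ℕ → ℕ → Prop} {r : ℕ → ℕ} {cur : ℕ}
    (h : IsPartial n r cur) (hV : IsValid n k Al r cur) :
    ∃ X : StateDescription n k, X.digits = stateDigits n r cur := by
  obtain ⟨e, he⟩ := exists_enumeration (n := n) ((Finset.range n).filter (IsOld n r cur))
    (tally_isOld_le h hV) fun v hv => Finset.mem_range.1 (Finset.mem_filter.1 hv).1
  have hnew : tally n (status n r cur · = 4) ≤ k := by
    by_cases hex : ∃ v < n, r (n + v) = cur
    · have := hV.active hex; omega
    · push Not at hex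
      rw [show tally n (status n r cur · = 4) = tally n fun _ => False from
        tally_congr fun v hv => by simp [status_eq_four h, hex v hv]]
      simp [tally]
  obtain ⟨f, hf⟩ := exists_enumeration (n := n) ((Finset.range n).filter (status n r cur · = 4))
    hnew fun v hv => Finset.mem_range.1 (Finset.mem_filter.1 hv).1
  have he' : ∀ v < n, (∃ j, (e j : ℕ) = v) ↔ IsOld n r cur v := fun v hv => by
    rw [he v hv]; simp [hv]
  have hf' : ∀ v < n, (∃ j, (f j : ℕ) = v) ↔ status n r cur v = 4 := fun v hv => by
    rw [hf v hv]; simp [hv]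
  have hlast : stateDigits n r cur (3 * n) < 2 * n + 1 := by
    have := (last_le_iff h (2 * n)).2 fun q hq => by
      by_contra h2
      have := h.eq_zero q (by omega)
      have := h.one_le
      omega
    omega
  -- Reduction modulo `k` only serves to obtain elements of `Fin k`; the entries that matter are below `k`.
  have hmod : ∀ (j : Fin k) (a : ℕ), a % k < k := fun j a => Nat.mod_lt _ (by have := j.2; omega)
  refine ⟨(⟨_, hlast⟩, fun v => decide (status n r cur v = 1 ∨ status n r cur v = 2),
    fun j => (e j, ⟨stateDigits n r cur (n + e j) % k, hmod j _⟩,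
      ⟨stateDigits n r cur (2 * n + e j) % k, hmod j _⟩), f), ?_⟩
  funext i
  simp only [StateDescription.digits]
  rcases Nat.lt_or_ge i n with hi | hi
  · rw [dif_pos hi, stateDigits_status hi]
    simp only [he' i hi, hf' i hi, decide_eq_true_eq, IsOld]
    have := status_le_four (n := n) (r := r) (cur := cur) i
    split_ifs <;> omega
  rw [dif_neg (by omega)]
  rcases Nat.lt_or_ge i (2 * n) with hi2 | hi2
  · obtain ⟨v, rfl⟩ := Nat.exists_eq_add_of_le hi
    have hv : v < n := by omega
    rw [if_pos hi2]
    simp only [Nat.add_sub_cancel_left]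
    by_cases hov : IsOld n r cur v
    · have hex := (he' v hv).2 hov
      rw [dif_pos hex, hex.choose_spec]
      refine Nat.mod_eq_of_lt ?_
      rw [stateDigits_key hv, if_pos hov]
      exact (tally_lt (fun w _ hw => hw.1) hv (by simp) hov).trans_le (tally_isOld_le h hV)
    · rw [dif_neg (by rw [he' v hv]; exact hov), stateDigits_key hv, if_neg hov]
  rw [if_neg (by omega)]
  rcases Nat.lt_or_ge i (3 * n) with hi3 | hi3
  · obtain ⟨v, rfl⟩ := Nat.exists_eq_add_of_le hi2
    have hv : v < n := by omega
    rw [if_pos hi3]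
    simp only [Nat.add_sub_cancel_left]
    by_cases hov : IsOld n r cur v
    · have hex := (he' v hv).2 hov
      rw [dif_pos hex, hex.choose_spec]
      refine Nat.mod_eq_of_lt ?_
      rw [stateDigits_overlap hv, if_pos hov]
      have := (isOld_iff h).1 hov
      exact hV.overlap v hv this.1 this.2.1
    · rw [dif_neg (by rw [he' v hv]; exact hov), stateDigits_overlap hv, if_neg hov]
  rw [if_neg (by omega)]
  split_ifs with hi4
  · rw [hi4]
  · rw [stateDigits_eq_zero (by omega)]

theorem card_layerStates_le (n k : ℕ) (Al : ℕ → ℕ → ℕ → Prop) (m : ℕ) :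
    (layerStates n k Al m).card ≤ (2 * n + 1) * 2 ^ n * ((n + 1) * k) ^ (2 * k) := by
  classical
  rw [← card_stateDescription]
  have hsub : layerStates n k Al m ⊆
      (Finset.univ : Finset (StateDescription n k)).image fun X => code n X.digits := by
    intro t ht
    obtain ⟨x, hx, rfl⟩ := Finset.mem_image.1 ht
    rw [mem_layer] at hx
    obtain ⟨X, hX⟩ := exists_description hx.1 hx.2.1
    exact Finset.mem_image.2 ⟨X, Finset.mem_univ _, by rw [hX]; rfl⟩
  exact (Finset.card_le_card hsub).trans Finset.card_image_le

end AllenDP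

/-! ### Ordered partitions and ranks -/

namespace OrderedPartition

variable {S : Type} (π : OrderedPartition S)

theorem mem_parts_iff_rank (x : S) {i : ℕ} (hi : i < π.parts.length) :
    x ∈ π.parts[i] ↔ π.rank x = i + 1 := by
  classical
  have hlt : π.parts.findIdx (fun A => decide (x ∈ A)) < π.parts.length := by
    obtain ⟨A, hA, hx⟩ := π.cover x
    exact List.findIdx_lt_length_of_exists ⟨A, hA, by simpa using hx⟩
  have hmem : x ∈ π.parts[π.parts.findIdx (fun A => decide (x ∈ A))] := by
    simpa using List.findIdx_getElem (w := hlt)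
  have hrank : π.rank x = π.parts.findIdx (fun A => decide (x ∈ A)) + 1 := by
    unfold rank; congr
  rw [hrank]
  constructor
  · intro hx
    by_contra hne
    have hne' : π.parts.findIdx (fun A => decide (x ∈ A)) ≠ i := fun h => hne (by omega)
    have hdis := List.pairwise_iff_getElem.1 π.disjoint
    rcases Nat.lt_or_gt_of_ne hne' with h | h
    · exact Finset.disjoint_left.1 (hdis _ _ hlt hi h) hmem hx
    · exact Finset.disjoint_left.1 (hdis _ _ hi hlt h) hx hmem
  · intro h
    obtain rfl : i = π.parts.findIdx (fun A => decide (x ∈ A)) := by omega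
    exact hmem

theorem rank_pos (x : S) : 0 < π.rank x := Nat.succ_pos _

theorem rank_le (x : S) : π.rank x ≤ π.parts.length := by
  classical
  obtain ⟨A, hA, hx⟩ := π.cover x
  obtain ⟨i, hi, rfl⟩ := List.mem_iff_getElem.1 hA
  rw [(π.mem_parts_iff_rank x hi).1 hx]
  exact hi

theorem exists_rank_eq {i : ℕ} (h1 : 1 ≤ i) (hi : i ≤ π.parts.length) : ∃ x, π.rank x = i := by
  obtain ⟨x, hx⟩ := π.nonempty _ (List.getElem_mem (show i - 1 < π.parts.length by omega))
  exact ⟨x, by rw [(π.mem_parts_iff_rank x _).1 hx]; omega⟩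

/-- An ordered partition is determined by its ranking function and the number of its parts. -/
theorem eq_of_rank {π π' : OrderedPartition S} (hlen : π.parts.length = π'.parts.length)
    (h : ∀ x, π.rank x = π'.rank x) : π = π' := by
  have hparts : π.parts = π'.parts := by
    refine List.ext_getElem hlen fun i hi hi' => ?_
    ext x
    rw [π.mem_parts_iff_rank, π'.mem_parts_iff_rank, h]
  cases π
  cases π'
  cases hparts
  rfl

/-- A function onto `{1, …, l}` is the ranking function of an ordered partition. -/
theorem exists_of_rank [Fintype S] (ρ : S → ℕ) (l : ℕ) (hpos : ∀ x, 0 < ρ x) (hle : ∀ x, ρ x ≤ l)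
    (hsurj : ∀ i, 1 ≤ i → i ≤ l → ∃ x, ρ x = i) :
    ∃ π : OrderedPartition S, π.parts.length = l ∧ ∀ x, π.rank x = ρ x := by
  classical
  let parts : List (Finset S) := (List.range l).map fun i => Finset.univ.filter (ρ · = i + 1)
  have hlen : parts.length = l := by simp [parts]
  have hget : ∀ i (hi : i < parts.length), parts[i] = Finset.univ.filter (ρ · = i + 1) := by
    intro i hi; simp [parts]
  let π : OrderedPartition S :=
    { parts := parts
      nonempty := by
        intro A hA
        obtain ⟨i, hi, rfl⟩ := List.mem_iff_getElem.1 hA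
        obtain ⟨x, hx⟩ := hsurj (i + 1) (by omega) (by omega)
        exact ⟨x, by rw [hget]; simp [hx]⟩
      disjoint := by
        rw [List.pairwise_iff_getElem]
        intro i j hi hj hij
        rw [hget, hget, Finset.disjoint_filter]
        intro x _ h1 h2
        omega
      cover := fun x => by
        have hx : ρ x - 1 < parts.length := by have := hpos x; have := hle x; omega
        refine ⟨parts[ρ x - 1], List.getElem_mem hx, ?_⟩
        rw [hget]
        have := hpos x
        simp only [Finset.mem_filter, Finset.mem_univ, true_and]
        omega }
  refine ⟨π, hlen, fun x => ?_⟩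
  have hx : ρ x - 1 < π.parts.length := by
    have := hpos x
    have := hle x
    change ρ x - 1 < parts.length
    omega
  rw [(π.mem_parts_iff_rank x hx).1 ?_]
  · have := hpos x; omega
  · change x ∈ parts[ρ x - 1]
    rw [hget]
    have := hpos x
    simp only [Finset.mem_filter, Finset.mem_univ, true_and]
    omega

end OrderedPartition

theorem LineInterval.overlaps_iff (I J : LineInterval) :
    I.Overlaps J ↔ I.lo < J.hi ∧ J.lo < I.hi := by
  constructor
  · rintro ⟨x, ⟨h1, h2⟩, h3, h4⟩
    exact ⟨h1.trans h4, h3.trans h2⟩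
  · rintro ⟨h1, h2⟩
    obtain ⟨x, hx1, hx2⟩ := exists_between
      (show max I.lo J.lo < min I.hi J.hi from
        max_lt (lt_min I.lo_lt_hi h1) (lt_min h2 J.lo_lt_hi))
    rw [max_lt_iff] at hx1
    rw [lt_min_iff] at hx2
    exact ⟨x, ⟨hx1.1, hx2.1⟩, hx1.2, hx2.2⟩

/-- The position of an atom in the enumeration of the atoms. -/
def AllenAtom.number : AllenAtom → ℕ
  | precedes => 0
  | precededBy => 1
  | equals => 2
  | meets => 3
  | metBy => 4
  | overlaps => 5
  | overlappedBy => 6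
  | starts => 7
  | startedBy => 8
  | during => 9
  | contains => 10
  | finishes => 11
  | finishedBy => 12

theorem AllenAtom.number_lt (a : AllenAtom) : a.number < 13 := by
  cases a <;> simp [number]

theorem AllenAtom.enumeration_getElem (a : AllenAtom) :
    enumeration[a.number]'(by cases a <;> simp [number, enumeration]) = a := by
  cases a <;> rfl

theorem AllenAtom.exists_number_eq {i : ℕ} (hi : i < 13) : ∃ a : AllenAtom, a.number = i := by
  have : i = 0 ∨ i = 1 ∨ i = 2 ∨ i = 3 ∨ i = 4 ∨ i = 5 ∨ i = 6 ∨ i = 7 ∨ i = 8 ∨ i = 9 ∨ i = 10 ∨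
    i = 11 ∨ i = 12 := by omega
  rcases this with rfl | rfl | rfl | rfl | rfl | rfl | rfl | rfl | rfl | rfl | rfl | rfl | rfl
  exacts [⟨precedes, rfl⟩, ⟨precededBy, rfl⟩, ⟨equals, rfl⟩, ⟨meets, rfl⟩, ⟨metBy, rfl⟩,
    ⟨overlaps, rfl⟩, ⟨overlappedBy, rfl⟩, ⟨starts, rfl⟩, ⟨startedBy, rfl⟩, ⟨during, rfl⟩,
    ⟨contains, rfl⟩, ⟨finishes, rfl⟩, ⟨finishedBy, rfl⟩]

theorem AllenDP.atomNumber_cases {a e a' e' : ℕ} (h : a < e) (h' : a' < e') :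
    (atomNumber a e a' e' = 0 ∧ e < a') ∨ (atomNumber a e a' e' = 1 ∧ e' < a) ∨
    (atomNumber a e a' e' = 2 ∧ a = a' ∧ e = e') ∨ (atomNumber a e a' e' = 3 ∧ e = a') ∨
    (atomNumber a e a' e' = 4 ∧ e' = a) ∨
    (atomNumber a e a' e' = 5 ∧ a < a' ∧ a' < e ∧ e < e') ∨
    (atomNumber a e a' e' = 6 ∧ a' < a ∧ a < e' ∧ e' < e) ∨
    (atomNumber a e a' e' = 7 ∧ a = a' ∧ e < e') ∨ (atomNumber a e a' e' = 8 ∧ a = a' ∧ e' < e) ∨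
    (atomNumber a e a' e' = 9 ∧ a' < a ∧ e < e') ∨ (atomNumber a e a' e' = 10 ∧ a < a' ∧ e' < e) ∨
    (atomNumber a e a' e' = 11 ∧ a' < a ∧ a < e' ∧ e = e') ∨
    (atomNumber a e a' e' = 12 ∧ a < a' ∧ a' < e ∧ e = e') := by
  have he : e ≠ 0 := by omega
  have he' : e' ≠ 0 := by omega
  unfold atomNumber
  simp only [he, he', ne_eq, not_false_eq_true, true_and, false_or]
  split_ifs <;> simp <;> omega

/-- The atom that holds between two intervals with natural end-points is the one computed by
`atomNumber`. -/
theorem AllenAtom.holds_iff_number (I J : LineInterval) {a e a' e' : ℕ} (h1 : I.lo = a)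
    (h2 : I.hi = e) (h3 : J.lo = a') (h4 : J.hi = e') (at' : AllenAtom) :
    at'.Holds I J ↔ AllenDP.atomNumber a e a' e' = at'.number := by
  have hI := I.lo_lt_hi
  have hJ := J.lo_lt_hi
  rw [h1, h2, Nat.cast_lt] at hI
  rw [h3, h4, Nat.cast_lt] at hJ
  have key : at'.Holds I J ↔ match at' with
      | precedes => e < a'
      | precededBy => e' < a
      | equals => a = a' ∧ e = e'
      | meets => e = a'
      | metBy => e' = a
      | overlaps => a < a' ∧ a' < e ∧ e < e'
      | overlappedBy => a' < a ∧ a < e' ∧ e' < e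
      | starts => a = a' ∧ e < e'
      | startedBy => a = a' ∧ e' < e
      | during => a' < a ∧ e < e'
      | contains => a < a' ∧ e' < e
      | finishes => a' < a ∧ e = e'
      | finishedBy => a < a' ∧ e = e' := by
    cases at' <;> simp only [Holds, h1, h2, h3, h4, Nat.cast_lt, Nat.cast_inj]
  rw [key]
  rcases AllenDP.atomNumber_cases hI hJ with h | h | h | h | h | h | h | h | h | h | h | h | h <;>
    rw [h.1] <;> cases at' <;> simp [number] <;> omega

/-! ### Solutions and valid ordered partitions -/

namespace AllenDP

/-- The ranking function of an ordered partition as a function of the number of a point. -/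
noncomputable def pointRank {n : ℕ} (π : OrderedPartition (Fin n ⊕ Fin n)) (p : ℕ) : ℕ :=
  if h : p < n then π.rank (.inr ⟨p, h⟩)
  else if h : p < 2 * n then π.rank (.inl ⟨p - n, by omega⟩) else 0

section

variable {n k : ℕ} {Al : ℕ → ℕ → ℕ → Prop}

theorem pointRank_end (π : OrderedPartition (Fin n ⊕ Fin n)) (u : Fin n) :
    pointRank π u = π.rank (.inr u) := by
  simp [pointRank]

theorem pointRank_start (π : OrderedPartition (Fin n ⊕ Fin n)) (u : Fin n) :
    pointRank π (n + u) = π.rank (.inl u) := by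
  unfold pointRank
  rw [dif_neg (by omega), dif_pos (by omega)]
  congr 2
  ext
  simp

theorem forall_point {P : ℕ → Prop} (h1 : ∀ u : Fin n, P (n + u)) (h2 : ∀ u : Fin n, P u) :
    ∀ p < 2 * n, P p := by
  intro p hp
  rcases Nat.lt_or_ge p n with h | h
  · exact h2 ⟨p, h⟩
  · have := h1 ⟨p - n, by omega⟩
    rwa [show n + (⟨p - n, by omega⟩ : Fin n).1 = p by simp; omega] at this

theorem pointRank_mem (π : OrderedPartition (Fin n ⊕ Fin n)) :
    ∀ p < 2 * n, 0 < pointRank π p ∧ pointRank π p < π.parts.length + 1 := by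
  refine forall_point (fun u => ?_) fun u => ?_
  · rw [pointRank_start]; exact ⟨π.rank_pos _, Nat.lt_succ_of_le (π.rank_le _)⟩
  · rw [pointRank_end]; exact ⟨π.rank_pos _, Nat.lt_succ_of_le (π.rank_le _)⟩

theorem isPartial_pointRank (π : OrderedPartition (Fin n ⊕ Fin n)) :
    IsPartial n (pointRank π) (π.parts.length + 1) := by
  have h0 : ∀ p, 2 * n ≤ p → pointRank π p = 0 := fun p hp => by
    unfold pointRank
    rw [dif_neg (by omega), dif_neg (by omega)]
  refine ⟨by omega, fun p => ?_, h0, fun i h1 h2 => ?_⟩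
  · rcases Nat.lt_or_ge p (2 * n) with h | h
    · exact (pointRank_mem π p h).2.le
    · rw [h0 p h]; omega
  · obtain ⟨x, hx⟩ := π.exists_rank_eq h1 (by omega)
    rcases x with u | u
    · exact ⟨n + u, by rw [pointRank_start, hx]⟩
    · exact ⟨u, by rw [pointRank_end, hx]⟩

/-- For a total ordered partition, validity is what the ranks say about the intervals. -/
theorem isValid_iff_of_total {r : ℕ → ℕ} {cur : ℕ}
    (htot : ∀ p < 2 * n, 0 < r p ∧ r p < cur) : IsValid n k Al r cur ↔
      (∀ v < n, r (n + v) < r v) ∧ (∀ v < n, overlapCount n r cur v < k) ∧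
        ∀ u < n, ∀ v < n, Al u v (atomNumber (r (n + u)) (r u) (r (n + v)) (r v)) := by
  constructor
  · intro hV
    refine ⟨fun v hv => (hV.order v hv (htot v (by omega)).1.ne').2, fun v hv => ?_,
      fun u hu v hv => hV.allowed u hu v hv (Or.inl ?_)⟩
    · obtain ⟨h1, h2⟩ := htot (n + v) (by omega)
      exact hV.overlap v hv h1 h2
    · have h1 := htot u (by omega)
      have h2 := htot (n + v) (by omega)
      exact ⟨h1.1, h1.2, h2.1, h2.2⟩
  · rintro ⟨h1, h2, h3⟩
    refine ⟨fun v hv _ => ⟨(htot (n + v) (by omega)).1, h1 v hv⟩, fun v hv _ _ => h2 v hv,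
      fun u hu v hv _ => h3 u hu v hv, fun ⟨v, hv, hvc⟩ => ?_⟩
    have := htot (n + v) (by omega)
    omega

theorem ncard_overlaps {r : ℕ → ℕ} {cur : ℕ} (htot : ∀ p < 2 * n, 0 < r p ∧ r p < cur)
    {f : Fin n → LineInterval} (hf : ∀ u : Fin n, (f u).lo = r (n + u) ∧ (f u).hi = r u)
    (u : Fin n) : {v : Fin n | v ≠ u ∧ (f u).Overlaps (f v)}.ncard = overlapCount n r cur u := by
  classical
  rw [Set.ncard_eq_toFinset_card', Set.toFinset_ofPred, Finset.card_filter, overlapCount, tally_eq_sum,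
    ← Fin.sum_univ_eq_sum_range
      (fun w => if w ≠ u ∧ 0 < r (n + w) ∧ r (n + w) < cur ∧ Meet n r u w then 1 else 0)]
  refine Finset.sum_congr rfl fun v _ => if_congr ?_ rfl rfl
  rw [LineInterval.overlaps_iff, (hf u).1, (hf u).2, (hf v).1, (hf v).2, Nat.cast_lt, Nat.cast_lt]
  have h1 := htot (n + v) (by omega)
  have h2 := htot v (by omega)
  have h3 := htot u (by omega)
  unfold Meet
  rw [Ne, Fin.ext_iff]
  omega

/-- The predicate `Al` describes the constraints `C`. -/
def Describes (Al : ℕ → ℕ → ℕ → Prop) (C : List (AllenConstraint n)) : Prop :=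
  ∀ (u v : Fin n) (a : AllenAtom),
    Al u v a.number ↔ ∀ c ∈ C, c.fst = u → c.snd = v → a ∈ c.rel

/-- For intervals given by ranks, satisfying the constraints means that the atom of every pair is
allowed. -/
theorem satisfies_iff {C : List (AllenConstraint n)} (hAl : Describes Al C) {r : ℕ → ℕ}
    {f : Fin n → LineInterval} (hf : ∀ u : Fin n, (f u).lo = r (n + u) ∧ (f u).hi = r u) :
    Satisfies C f ↔
      ∀ u < n, ∀ v < n, Al u v (atomNumber (r (n + u)) (r u) (r (n + v)) (r v)) := by
  have key : ∀ (u v : Fin n) (a : AllenAtom), a.Holds (f u) (f v) ↔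
      atomNumber (r (n + u)) (r u) (r (n + v)) (r v) = a.number := fun u v a =>
    AllenAtom.holds_iff_number _ _ (hf u).1 (hf u).2 (hf v).1 (hf v).2 a
  have hex : ∀ u v : Fin n, ∃ a : AllenAtom,
      a.number = atomNumber (r (n + u)) (r u) (r (n + v)) (r v) := fun u v =>
    AllenAtom.exists_number_eq (atomNumber_lt _ _ _ _)
  constructor
  · intro hsat u hu v hv
    obtain ⟨a, ha⟩ := hex ⟨u, hu⟩ ⟨v, hv⟩
    simp only at ha
    rw [← ha]
    refine (hAl ⟨u, hu⟩ ⟨v, hv⟩ a).2 fun c hc h1 h2 => ?_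
    obtain ⟨a', ha', hol⟩ := hsat c hc
    rw [h1, h2, key] at hol
    simp only at hol
    have : a = a' := by
      have e1 := a.enumeration_getElem
      have e2 := a'.enumeration_getElem
      simp only [show a.number = a'.number by rw [ha, hol]] at e1
      exact e1.symm.trans e2
    rwa [this]
  · intro hall c hc
    obtain ⟨a, ha⟩ := hex c.fst c.snd
    refine ⟨a, ?_, (key _ _ _).2 ha.symm⟩
    have := hall c.fst c.fst.2 c.snd c.snd.2
    rw [← ha] at this
    exact (hAl _ _ a).1 this c hc rfl rfl

/-- The solutions are the ordered partitions whose ranks are valid. -/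
theorem isSolution_iff {C : List (AllenConstraint n)} (hAl : Describes Al C)
    (π : OrderedPartition (Fin n ⊕ Fin n)) :
    π.IsSolution C k ↔ IsValid n k Al (pointRank π) (π.parts.length + 1) := by
  have htot := pointRank_mem π
  rw [isValid_iff_of_total htot]
  constructor
  · rintro ⟨f, hf, hsat, hov⟩
    have hf' : ∀ u : Fin n, (f u).lo = pointRank π (n + u) ∧ (f u).hi = pointRank π u := fun u => by
      rw [pointRank_start, pointRank_end]; exact hf u
    refine ⟨fun v hv => ?_, fun v hv => ?_, (satisfies_iff hAl hf').1 hsat⟩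
    · have := (f ⟨v, hv⟩).lo_lt_hi
      rw [(hf' ⟨v, hv⟩).1, (hf' ⟨v, hv⟩).2, Nat.cast_lt] at this
      exact this
    · have := hov ⟨v, hv⟩
      rwa [ncard_overlaps htot hf'] at this
  · rintro ⟨h1, h2, h3⟩
    let f : Fin n → LineInterval := fun u =>
      ⟨pointRank π (n + u), pointRank π u, Nat.cast_lt.2 (h1 u u.2)⟩
    have hf' : ∀ u : Fin n, (f u).lo = pointRank π (n + u) ∧ (f u).hi = pointRank π u :=
      fun u => ⟨rfl, rfl⟩
    refine ⟨f, fun u => ?_, (satisfies_iff hAl hf').2 h3, fun u => ?_⟩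
    · rw [← pointRank_start, ← pointRank_end]; exact hf' u
    · rw [ncard_overlaps htot hf']; exact h2 u u.2

/-- The valid ordered partitions of all points, as they are reached by the dynamic program. A word for
`2 n` points and at most `2 n` parts has at most `4 n` letters. -/
noncomputable def finalSet (n k : ℕ) (Al : ℕ → ℕ → ℕ → Prop) : Finset ((ℕ → ℕ) × ℕ) := by
  classical
  exact (Finset.range (4 * n + 1)).biUnion fun m =>
    (layer n k Al m).filter fun x => IsFinal n (stateDigits n x.1 x.2)

theorem isFinal_iff {r : ℕ → ℕ} {cur : ℕ} (h : IsPartial n r cur) (hV : IsValid n k Al r cur) :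
    IsFinal n (stateDigits n r cur) ↔ ∀ p < 2 * n, 0 < r p ∧ r p < cur := by
  have hlast := last_pos_iff h
  have hone := h.one_le
  unfold IsFinal
  constructor
  · rintro ⟨h0, h1⟩ p hp
    have hne : r p ≠ cur := fun hpc => by have := hlast.2 ⟨p, hpc⟩; omega
    have hle := h.le p
    refine ⟨?_, by omega⟩
    rcases Nat.lt_or_ge p n with hpn | hpn
    · have := h1 p hpn
      rw [stateDigits_status hpn, status_eq_one h hV hpn] at this
      exact this.1
    · obtain ⟨v, rfl⟩ := Nat.exists_eq_add_of_le hpn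
      have hv : v < n := by omega
      have := h1 v hv
      rw [stateDigits_status hv, status_eq_one h hV hv] at this
      exact (hV.order v hv this.1.ne').1
  · intro htot
    refine ⟨?_, fun v hv => ?_⟩
    · by_contra h0
      obtain ⟨q, hq⟩ := hlast.1 (by omega)
      rcases Nat.lt_or_ge q (2 * n) with h2 | h2
      · have := htot q h2; omega
      · have := h.eq_zero q h2; omega
    · rw [stateDigits_status hv, status_eq_one h hV hv]
      exact htot v (by omega)

theorem mem_finalSet {x : (ℕ → ℕ) × ℕ} : x ∈ finalSet n k Al ↔
    IsPartial n x.1 x.2 ∧ IsValid n k Al x.1 x.2 ∧ ∀ p < 2 * n, 0 < x.1 p ∧ x.1 p < x.2 := by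
  classical
  unfold finalSet
  simp only [Finset.mem_biUnion, Finset.mem_filter, mem_layer, Finset.mem_range]
  constructor
  · rintro ⟨m, -, ⟨h1, h2, -⟩, h3⟩
    exact ⟨h1, h2, (isFinal_iff h1 h2).1 h3⟩
  · rintro ⟨h1, h2, h3⟩
    obtain ⟨r, cur⟩ := x
    simp only at h1 h2 h3
    have hplaced : placed n r = 2 * n := by
      unfold placed
      rw [show tally (2 * n) (r · ≠ 0) = tally (2 * n) fun _ => True from
        tally_congr fun p hp => by simp [(h3 p hp).1.ne']]
      simp [tally]
    have hcur : cur - 1 ≤ 2 * n := by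
      have hsub : Finset.Ico 1 cur ⊆ (Finset.range (2 * n)).image r := by
        intro i hi
        rw [Finset.mem_Ico] at hi
        obtain ⟨p, hp⟩ := h1.nonempty i hi.1 hi.2
        refine Finset.mem_image.2 ⟨p, ?_, hp⟩
        rw [Finset.mem_range]
        by_contra h4
        have := h1.eq_zero p (by omega)
        omega
      have := (Finset.card_le_card hsub).trans Finset.card_image_le
      simpa using this
    have := h1.one_le
    exact ⟨2 * n + cur - 1, by omega, ⟨h1, h2, by simp only; omega⟩, (isFinal_iff h1 h2).2 h3⟩

/-- The solutions correspond to the valid ordered partitions counted by the dynamic program. -/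
theorem card_isSolution {C : List (AllenConstraint n)} (hAl : Describes Al C) :
    Nat.card {π : OrderedPartition (Fin n ⊕ Fin n) // π.IsSolution C k} =
      (finalSet n k Al).card := by
  have hmem : ∀ π : OrderedPartition (Fin n ⊕ Fin n), π.IsSolution C k →
      (pointRank π, π.parts.length + 1) ∈ finalSet n k Al := fun π hπ =>
    mem_finalSet.2 ⟨isPartial_pointRank π, (isSolution_iff hAl π).1 hπ, pointRank_mem π⟩
  let Φ : {π : OrderedPartition (Fin n ⊕ Fin n) // π.IsSolution C k} → finalSet n k Al :=
    fun π => ⟨_, hmem π.1 π.2⟩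
  have hΦ : Function.Bijective Φ := by
    constructor
    · rintro ⟨π, hπ⟩ ⟨π', hπ'⟩ h
      simp only [Φ, Subtype.mk.injEq, Prod.mk.injEq, Nat.add_right_cancel_iff] at h
      refine Subtype.ext (OrderedPartition.eq_of_rank h.2 fun x => ?_)
      rcases x with u | u
      · rw [← pointRank_start, ← pointRank_start, h.1]
      · rw [← pointRank_end, ← pointRank_end, h.1]
    · rintro ⟨⟨r, cur⟩, hx⟩
      obtain ⟨h1, h2, h3⟩ := mem_finalSet.1 hx
      simp only at h1 h2 h3
      have hone := h1.one_le
      let ρ : Fin n ⊕ Fin n → ℕ := Sum.elim (fun u => r (n + u)) fun u => r u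
      have hρ : ∀ x, 0 < ρ x ∧ ρ x < cur := by
        rintro (u | u)
        · exact h3 _ (by omega)
        · exact h3 _ (by omega)
      obtain ⟨π, hlen, hrank⟩ := OrderedPartition.exists_of_rank ρ (cur - 1) (fun x => (hρ x).1)
        (fun x => by have := (hρ x).2; omega) fun i hi hi' => by
          obtain ⟨p, hp⟩ := h1.nonempty i hi (by omega)
          have hp2 : p < 2 * n := by
            by_contra h4
            have := h1.eq_zero p (by omega)
            omega
          revert hp
          exact forall_point (P := fun p => r p = i → ∃ x, ρ x = i)
            (fun u hu => ⟨.inl u, hu⟩) (fun u hu => ⟨.inr u, hu⟩) p hp2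
      have hr : pointRank π = r := by
        funext p
        rcases Nat.lt_or_ge p (2 * n) with hp | hp
        · refine forall_point (P := fun p => pointRank π p = r p) (fun u => ?_) (fun u => ?_) p hp
          · rw [pointRank_start, hrank]; rfl
          · rw [pointRank_end, hrank]; rfl
        · rw [h1.eq_zero p hp, (isPartial_pointRank π).eq_zero p hp]
      have hcur : π.parts.length + 1 = cur := by omega
      refine ⟨⟨π, (isSolution_iff hAl π).2 (by rw [hr, hcur]; exact h2)⟩, ?_⟩
      simp only [Φ, hr, hcur]
  rw [Nat.card_congr (Equiv.ofBijective Φ hΦ), Nat.card_eq_fintype_card, Fintype.card_coe]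

open Classical in
/-- The number of solutions, as a sum over the final states. -/
theorem card_finalSet (n k : ℕ) (Al : ℕ → ℕ → ℕ → Prop) : (finalSet n k Al).card =
    ∑ m ∈ Finset.range (4 * n + 1), ∑ t ∈ layerStates n k Al m,
      if IsFinal n (digit n t) then stateCount n k Al m t else 0 := by
  unfold finalSet
  rw [Finset.card_biUnion]
  · refine Finset.sum_congr rfl fun m _ => ?_
    have h1 : ∀ x, IsFinal n (stateDigits n x.1 x.2) ↔ IsFinal n (digit n (stateCode n x)) :=
      fun x => by rw [digit_stateCode]
    rw [Finset.card_filter]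
    simp only [h1]
    rw [Finset.sum_comp (fun t => if IsFinal n (digit n t) then 1 else 0) (stateCode n)]
    refine Finset.sum_congr rfl fun t _ => ?_
    simp only [smul_eq_mul, mul_ite, mul_one, mul_zero]
    rfl
  · intro m _ m' _ hne
    simp only [Function.onFun]
    rw [Finset.disjoint_left]
    intro x hx hx'
    rw [Finset.mem_filter, mem_layer] at hx hx'
    have h1 := hx.1.2.2
    have h2 := hx'.1.2.2
    exact hne (by omega)

/-- Only the order of the end-points of an assignment matters: a solution on the real line yields
an ordered partition. -/
theorem exists_isSolution_iff (C : List (AllenConstraint n)) (k : ℕ) :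
    (∃ π : OrderedPartition (Fin n ⊕ Fin n), π.IsSolution C k) ↔
      ∃ f : Fin n → LineInterval, Satisfies C f ∧ OverlapsFewerThan k f := by
  classical
  refine ⟨fun ⟨π, f, _, h1, h2⟩ => ⟨f, h1, h2⟩, fun ⟨f, h1, h2⟩ => ?_⟩
  -- Ranks are positions in the sorted list of all values of the assignment.
  let val : Fin n ⊕ Fin n → ℝ := Sum.elim (fun u => (f u).lo) fun u => (f u).hi
  let V : Finset ℝ := Finset.univ.image val
  have hval : ∀ x, val x ∈ V := fun x => Finset.mem_image_of_mem _ (Finset.mem_univ x)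
  let o := V.orderIsoOfFin rfl
  let ρ : Fin n ⊕ Fin n → ℕ := fun x => (o.symm ⟨val x, hval x⟩ : ℕ) + 1
  have hρ : ∀ x y, ρ x < ρ y ↔ val x < val y := fun x y => by
    simp only [ρ, Nat.add_lt_add_iff_right, ← Fin.lt_def, OrderIso.lt_iff_lt, Subtype.mk_lt_mk]
  have hρ' : ∀ x y, ρ x = ρ y ↔ val x = val y := fun x y => by
    have h1 := hρ x y
    have h2 := hρ y x
    constructor
    · intro h
      exact le_antisymm (not_lt.1 fun h' => by have := h2.2 h'; omega)
        (not_lt.1 fun h' => by have := h1.2 h'; omega)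
    · intro h
      rw [h] at h1 h2
      simp only [lt_irrefl, iff_false] at h1 h2
      omega
  obtain ⟨π, -, hrank⟩ := OrderedPartition.exists_of_rank ρ V.card (fun x => Nat.succ_pos _)
    (fun x => (o.symm ⟨val x, hval x⟩).2) fun i hi hi' => by
      obtain ⟨x, -, hx⟩ := Finset.mem_image.1 (o ⟨i - 1, by omega⟩).2
      refine ⟨x, ?_⟩
      simp only [ρ]
      have : (⟨val x, hval x⟩ : V) = o ⟨i - 1, by omega⟩ := Subtype.ext hx
      rw [this, OrderIso.symm_apply_apply]
      simp only
      omega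
  let g : Fin n → LineInterval := fun u => ⟨π.rank (.inl u), π.rank (.inr u), by
    rw [Nat.cast_lt, hrank, hrank, hρ]
    exact (f u).lo_lt_hi⟩
  have hlt : ∀ x y, (π.rank x : ℝ) < π.rank y ↔ val x < val y := fun x y => by
    rw [Nat.cast_lt, hrank, hrank, hρ]
  have heq : ∀ x y, (π.rank x : ℝ) = π.rank y ↔ val x = val y := fun x y => by
    rw [Nat.cast_inj, hrank, hrank, hρ']
  refine ⟨π, g, fun u => ⟨rfl, rfl⟩, fun c hc => ?_, fun u => ?_⟩
  · obtain ⟨a, ha, hol⟩ := h1 c hc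
    refine ⟨a, ha, ?_⟩
    cases a <;> simp only [AllenAtom.Holds, g, hlt, heq] at hol ⊢ <;> exact hol
  · have : {v : Fin n | v ≠ u ∧ (g u).Overlaps (g v)} =
        {v : Fin n | v ≠ u ∧ (f u).Overlaps (f v)} := by
      ext v
      simp only [Set.mem_ofPred_eq, LineInterval.overlaps_iff, g, hlt]
      rfl
    rw [this]
    exact h2 u

/-- A variable overlaps with fewer than `n` others, so bounds above `n` are not needed. -/
theorem overlapsFewerThan_min (k : ℕ) (f : Fin n → LineInterval) :
    OverlapsFewerThan (min k n) f ↔ OverlapsFewerThan k f := by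
  unfold OverlapsFewerThan
  refine forall_congr' fun u => ?_
  have : {v : Fin n | v ≠ u ∧ (f u).Overlaps (f v)}.ncard < n := by
    have h1 : {v : Fin n | v ≠ u ∧ (f u).Overlaps (f v)} ⊂ Set.univ :=
      ⟨Set.subset_univ _, fun h => (h (Set.mem_univ u)).1 rfl⟩
    simpa using Set.ncard_lt_ncard h1
  rw [lt_min_iff]
  exact and_iff_left this

theorem isSolution_min (C : List (AllenConstraint n)) (k : ℕ)
    (π : OrderedPartition (Fin n ⊕ Fin n)) : π.IsSolution C (min k n) ↔ π.IsSolution C k := by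
  unfold OrderedPartition.IsSolution
  simp only [overlapsFewerThan_min]

end

end AllenDP

/-! ### Encoded instances -/

/-- The symbol number `i` of a word as a number, `0` beyond its end. -/
def wordBit (x : List Bool) (i : ℕ) : ℕ := if x[i]? = some true then 1 else 0

theorem wordBit_le_one (x : List Bool) (i : ℕ) : wordBit x i ≤ 1 := by
  unfold wordBit; split_ifs <;> omega

theorem wordBit_append (x y : List Bool) (i : ℕ) :
    wordBit (x ++ y) i = if i < x.length then wordBit x i else wordBit y (i - x.length) := by
  unfold wordBit
  rw [List.getElem?_append]
  split_ifs <;> simp_all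

theorem eq_of_wordBit {x y : List Bool} (hlen : x.length = y.length)
    (h : ∀ i < x.length, wordBit x i = wordBit y i) : x = y := by
  refine List.ext_getElem hlen fun i hi hi' => ?_
  have := h i hi
  unfold wordBit at this
  rw [List.getElem?_eq_getElem hi, List.getElem?_eq_getElem hi'] at this
  cases hx : x[i] <;> cases hy : y[i] <;> simp_all

theorem wordBit_map_range (f : ℕ → Bool) {w i : ℕ} (hi : i < w) :
    wordBit ((List.range w).map f) i = (f i).toNat := by
  unfold wordBit
  rw [List.getElem?_map, List.getElem?_range hi]
  cases h : f i <;> simp [h]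

theorem wordBit_flatMap {α : Type*} {B : ℕ} {f : α → List Bool} (C : List α)
    (hf : ∀ c ∈ C, (f c).length = B) {j t : ℕ} (hj : j < C.length) (ht : t < B) :
    wordBit (C.flatMap f) (j * B + t) = wordBit (f C[j]) t := by
  induction C generalizing j with
  | nil => simp at hj
  | cons c C ih =>
    have hc : (f c).length = B := hf c (by simp)
    rw [List.flatMap_cons, wordBit_append, hc]
    cases j with
    | zero => simp [ht]
    | succ j =>
      rw [if_neg (by rw [Nat.succ_mul]; omega),
        show (j + 1) * B + t - B = j * B + t by rw [Nat.succ_mul]; omega,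
        ih (fun c hc => hf c (by simp [hc])) (by simpa using hj)]
      simp

namespace AllenDP

theorem field_succ (A : ℕ → ℕ) (w o : ℕ) : field A (w + 1) o = A o + 2 * field A w (o + 1) := by
  unfold field
  rw [Finset.sum_range_succ', Finset.mul_sum, add_comm]
  congr 1
  · simp [cappedPow]
  · refine Finset.sum_congr rfl fun i hi => ?_
    have := Finset.mem_range.1 hi
    rw [cappedPow_eq (by omega), cappedPow_eq (by omega), pow_succ,
      show o + (i + 1) = o + 1 + i by omega]
    ring

theorem field_lt {A : ℕ → ℕ} (hA : ∀ i, A i ≤ 1) (w o : ℕ) : field A w o < 2 ^ w := by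
  induction w generalizing o with
  | zero => simp [field]
  | succ w ih =>
    rw [field_succ, pow_succ]
    have := ih (o + 1)
    have := hA o
    omega

theorem testBit_field {A : ℕ → ℕ} (hA : ∀ i, A i ≤ 1) {w i : ℕ} (hi : i < w) (o : ℕ) :
    ((field A w o).testBit i).toNat = A (o + i) := by
  induction w generalizing o i with
  | zero => omega
  | succ w ih =>
    have h0 := hA o
    rw [field_succ]
    cases i with
    | zero =>
      rw [Nat.testBit_zero, add_zero]
      interval_cases A o <;> simp
    | succ i =>
      rw [Nat.testBit_succ, show (A o + 2 * field A w (o + 1)) / 2 = field A w (o + 1) by omega,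
        ih (by omega), show o + 1 + i = o + (i + 1) by omega]

/-- A field of the word has the value `m` if it shows the binary digits of `m`. -/
theorem field_eq {A : ℕ → ℕ} (hA : ∀ i, A i ≤ 1) {w o m : ℕ} (hm : m < 2 ^ w)
    (h : ∀ i < w, A (o + i) = (m.testBit i).toNat) : field A w o = m := by
  refine Nat.eq_of_testBit_eq fun i => ?_
  rcases Nat.lt_or_ge i w with hi | hi
  · have := testBit_field hA hi o
    rw [h i hi] at this
    revert this
    generalize (field A w o).testBit i = a
    generalize m.testBit i = b
    revert a b
    decide
  · rw [Nat.testBit_lt_two_pow, Nat.testBit_lt_two_pow]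
    · exact hm.trans_le (Nat.pow_le_pow_right (by omega) hi)
    · exact (field_lt hA w o).trans_le (Nat.pow_le_pow_right (by omega) hi)

theorem length_binaryDigits (w m : ℕ) : (binaryDigits w m).length = w := by simp [binaryDigits]

variable {n : ℕ}

theorem length_encode (c : AllenConstraint n) : c.encode.length = 2 * n.size + 13 := by
  simp only [AllenConstraint.encode, List.length_append, length_binaryDigits, List.length_map]
  simp [AllenAtom.enumeration]
  omega

theorem wordBit_encode_fst (c : AllenConstraint n) {t : ℕ} (ht : t < n.size) :
    wordBit c.encode t = (c.fst.1.testBit t).toNat := by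
  unfold AllenConstraint.encode
  rw [List.append_assoc, wordBit_append, length_binaryDigits, if_pos ht]
  exact wordBit_map_range _ ht

theorem wordBit_encode_snd (c : AllenConstraint n) {t : ℕ} (ht : t < n.size) :
    wordBit c.encode (n.size + t) = (c.snd.1.testBit t).toNat := by
  unfold AllenConstraint.encode
  rw [List.append_assoc, wordBit_append, length_binaryDigits, if_neg (by omega), wordBit_append,
    length_binaryDigits, if_pos (by omega), Nat.add_sub_cancel_left]
  exact wordBit_map_range _ ht

theorem wordBit_encode_rel (c : AllenConstraint n) (a : AllenAtom) :
    wordBit c.encode (2 * n.size + a.number) = (decide (a ∈ c.rel)).toNat := by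
  unfold AllenConstraint.encode
  rw [wordBit_append, List.length_append, length_binaryDigits, length_binaryDigits,
    if_neg (by omega), show 2 * n.size + a.number - (n.size + n.size) = a.number by omega]
  unfold wordBit
  rw [List.getElem?_map, List.getElem?_eq_some_iff.2 ⟨_, a.enumeration_getElem⟩]
  by_cases h : a ∈ c.rel <;> simp [h]

theorem length_flatMap_encode (C : List (AllenConstraint n)) :
    (C.flatMap AllenConstraint.encode).length = C.length * (2 * n.size + 13) := by
  rw [List.length_flatMap]
  simp only [length_encode, List.map_const', List.sum_replicate, smul_eq_mul]

theorem length_encodeInstance (C : List (AllenConstraint n)) :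
    (encodeInstance n C).length = blockStart n n.size C.length := by
  simp only [encodeInstance, List.length_append, List.length_replicate, List.length_cons,
    length_flatMap_encode, blockStart]
  omega

theorem wordBit_encodeInstance_lt (C : List (AllenConstraint n)) {i : ℕ} (hi : i < n) :
    wordBit (encodeInstance n C) i = 1 := by
  unfold encodeInstance
  rw [wordBit_append, List.length_replicate, if_pos hi, wordBit, List.getElem?_replicate]
  simp [hi]

theorem wordBit_encodeInstance_self (C : List (AllenConstraint n)) :
    wordBit (encodeInstance n C) n = 0 := by
  unfold encodeInstance
  rw [wordBit_append, List.length_replicate, if_neg (by omega)]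
  simp [wordBit]

theorem wordBit_encodeInstance_block (C : List (AllenConstraint n)) {j t : ℕ} (hj : j < C.length)
    (ht : t < 2 * n.size + 13) :
    wordBit (encodeInstance n C) (blockStart n n.size j + t) = wordBit C[j].encode t := by
  unfold encodeInstance blockStart
  rw [wordBit_append, List.length_replicate, if_neg (by omega),
    show n + 1 + j * (2 * n.size + 13) + t - n = (j * (2 * n.size + 13) + t) + 1 by omega,
    ← wordBit_flatMap C (fun c _ => length_encode c) hj ht]
  simp only [wordBit, List.getElem?_cons_succ]

theorem blockStart_succ_le_iff (w j m : ℕ) : blockStart n w (j + 1) ≤ blockStart n w m ↔ j < m := by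
  unfold blockStart
  rw [Nat.add_le_add_iff_left, Nat.mul_le_mul_right_iff (by omega)]
  exact Iff.rfl

theorem lt_of_blockStart_succ_le {w j L : ℕ} (h : blockStart n w (j + 1) ≤ L) : j < L := by
  unfold blockStart at h
  nlinarith

theorem field_encodeInstance_fst (C : List (AllenConstraint n)) {j : ℕ} (hj : j < C.length) :
    field (wordBit (encodeInstance n C)) n.size (blockStart n n.size j) = C[j].fst :=
  field_eq (wordBit_le_one _) (C[j].fst.2.trans (Nat.lt_size_self n)) fun i hi => by
    rw [wordBit_encodeInstance_block C hj (by omega), wordBit_encode_fst _ hi]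

theorem field_encodeInstance_snd (C : List (AllenConstraint n)) {j : ℕ} (hj : j < C.length) :
    field (wordBit (encodeInstance n C)) n.size (blockStart n n.size j + n.size) = C[j].snd :=
  field_eq (wordBit_le_one _) (C[j].snd.2.trans (Nat.lt_size_self n)) fun i hi => by
    rw [add_assoc, wordBit_encodeInstance_block C hj (by omega), wordBit_encode_snd _ hi]

/-- On encodings of instances, the atoms allowed by the word are those allowed by the constraints. -/
theorem describes_encodeInstance (C : List (AllenConstraint n)) :
    Describes (AtomAllowed (encodeInstance n C).length n n.size (wordBit (encodeInstance n C)))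
      C := by
  intro u v a
  have hbit : ∀ {j} (hj : j < C.length), wordBit (encodeInstance n C)
      (blockStart n n.size j + 2 * n.size + a.number) = 1 ↔ a ∈ C[j].rel := fun hj => by
    have := a.number_lt
    rw [add_assoc, wordBit_encodeInstance_block C hj (by omega), wordBit_encode_rel]
    simp
  unfold AtomAllowed
  rw [length_encodeInstance]
  constructor
  · intro h c hc hu hv
    obtain ⟨j, hj, rfl⟩ := List.mem_iff_getElem.1 hc
    have hle := (blockStart_succ_le_iff (n := n) n.size j C.length).2 hj
    refine (hbit hj).1 (h j (lt_of_blockStart_succ_le hle) hle ?_ ?_)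
    · rw [field_encodeInstance_fst C hj, hu]
    · rw [field_encodeInstance_snd C hj, hv]
  · intro h j _ hle hu hv
    have hj := (blockStart_succ_le_iff (n := n) n.size j C.length).1 hle
    rw [field_encodeInstance_fst C hj] at hu
    rw [field_encodeInstance_snd C hj] at hv
    exact (hbit hj).2 (h C[j] (List.getElem_mem hj) (Fin.ext hu) (Fin.ext hv))

/-- The validity test recognizes the encodings of instances. -/
theorem validInput_iff (x : List Bool) : ValidInput x.length n n.size (wordBit x) ↔
    ∃ C : List (AllenConstraint n), x = encodeInstance n C := by
  constructor
  · rintro ⟨hlen, h1, h0, hmod, hf⟩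
    obtain ⟨m, hm⟩ := Nat.dvd_of_mod_eq_zero hmod
    have hL : x.length = blockStart n n.size m := by
      unfold blockStart; rw [mul_comm m, ← hm]; omega
    have hf' : ∀ j : Fin m, field (wordBit x) n.size (blockStart n n.size j) < n ∧
        field (wordBit x) n.size (blockStart n n.size j + n.size) < n := fun j => by
      have hle := (blockStart_succ_le_iff (n := n) n.size j m).2 j.2
      rw [← hL] at hle
      exact hf j (lt_of_blockStart_succ_le hle) hle
    let C : List (AllenConstraint n) := List.ofFn fun j : Fin m =>
      ⟨⟨_, (hf' j).1⟩, ⟨_, (hf' j).2⟩, AllenAtom.enumeration.toFinset.filter fun a =>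
        wordBit x (blockStart n n.size j + 2 * n.size + a.number) = 1⟩
    have hC : C.length = m := by simp [C]
    refine ⟨C, eq_of_wordBit (by rw [length_encodeInstance, hC, hL]) fun i hi => ?_⟩
    rcases Nat.lt_trichotomy i n with h | rfl | h
    · rw [wordBit_encodeInstance_lt C h, h1 i h]
    · rw [wordBit_encodeInstance_self, h0]
    · obtain ⟨i, rfl⟩ := Nat.exists_eq_add_of_lt h
      obtain ⟨j, t, ht, hjt⟩ : ∃ j t, t < 2 * n.size + 13 ∧ i = j * (2 * n.size + 13) + t :=
        ⟨i / (2 * n.size + 13), i % (2 * n.size + 13), Nat.mod_lt _ (by omega),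
          (Nat.div_add_mod' _ _).symm⟩
      have hi' : n + i + 1 = blockStart n n.size j + t := by unfold blockStart; omega
      have hj : j < m := by
        rw [hL, hi'] at hi
        unfold blockStart at hi
        by_contra hjm
        have := Nat.mul_le_mul_right (2 * n.size + 13) (not_lt.1 hjm)
        omega
      rw [hi', wordBit_encodeInstance_block C (hC.symm ▸ hj) ht]
      have hCj : C[j]'(hC.symm ▸ hj) = ⟨⟨_, (hf' ⟨j, hj⟩).1⟩, ⟨_, (hf' ⟨j, hj⟩).2⟩,
          AllenAtom.enumeration.toFinset.filter fun a =>
            wordBit x (blockStart n n.size j + 2 * n.size + a.number) = 1⟩ := by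
        simp [C]
      rw [hCj]
      rcases Nat.lt_or_ge t n.size with h1 | h1
      · rw [wordBit_encode_fst _ h1]
        exact (testBit_field (wordBit_le_one x) h1 _).symm
      · obtain ⟨t, rfl⟩ := Nat.exists_eq_add_of_le h1
        rcases Nat.lt_or_ge t n.size with h2 | h2
        · rw [wordBit_encode_snd _ h2, ← add_assoc]
          exact (testBit_field (wordBit_le_one x) h2 _).symm
        · obtain ⟨t, rfl⟩ := Nat.exists_eq_add_of_le h2
          obtain ⟨a, rfl⟩ := AllenAtom.exists_number_eq (show t < 13 by omega)
          rw [show n.size + (n.size + a.number) = 2 * n.size + a.number by omega,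
            wordBit_encode_rel, ← add_assoc]
          have ha : a ∈ AllenAtom.enumeration := by cases a <;> simp [AllenAtom.enumeration]
          have hle := wordBit_le_one x (blockStart n n.size j + 2 * n.size + a.number)
          by_cases hb : wordBit x (blockStart n n.size j + 2 * n.size + a.number) = 1
          · simp [hb, ha]
          · simp [hb, ha]; omega
  · rintro ⟨C, rfl⟩
    refine ⟨?_, fun i hi => wordBit_encodeInstance_lt C hi, wordBit_encodeInstance_self C, ?_,
      fun j _ hle => ?_⟩
    · rw [length_encodeInstance]; unfold blockStart; omega
    · rw [length_encodeInstance]; unfold blockStart; rw [Nat.add_sub_cancel_left]; simp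
    · rw [length_encodeInstance, blockStart_succ_le_iff] at hle
      rw [field_encodeInstance_fst C hle, field_encodeInstance_snd C hle]
      exact ⟨C[j].fst.2, C[j].snd.2⟩

/-- The value computed by the dynamic program on valid inputs: the sum over the final states. -/
noncomputable def finalCount (x : List Bool) (n k : ℕ) : ℕ :=
  (finalSet n (min k n) (AtomAllowed x.length n n.size (wordBit x))).card

/-- Two lists of constraints with the same encoding have the same solutions, since these depend on the
encoding only. -/
theorem kCSPAllenCount_eq_finalCount {x : List Bool} {k : ℕ}
    (hx : ValidInput x.length n n.size (wordBit x)) :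
    kCSPAllenCount x n k = finalCount x n k := by
  obtain ⟨C, rfl⟩ := (validInput_iff x).1 hx
  unfold finalCount kCSPAllenCount
  rw [← card_isSolution (describes_encodeInstance C)]
  refine Nat.card_congr (Equiv.subtypeEquivRight fun π => ?_)
  rw [isSolution_min]
  refine ⟨fun ⟨C', he, h⟩ => ?_, fun h => ⟨C, rfl, h⟩⟩
  have hd := describes_encodeInstance C'
  rw [← he] at hd
  rw [isSolution_iff hd] at h
  rwa [isSolution_iff (describes_encodeInstance C)]

theorem kCSPAllenCount_eq_zero {x : List Bool} {k : ℕ}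
    (hx : ¬ValidInput x.length n n.size (wordBit x)) : kCSPAllenCount x n k = 0 := by
  rw [validInput_iff] at hx
  unfold kCSPAllenCount
  rw [Nat.card_eq_zero]
  exact Or.inl ⟨fun π => hx (π.2.imp fun C h => h.1)⟩

/-- An instance is a yes-instance if and only if its number of solutions is not zero. -/
theorem mem_kCSPAllen_iff (x : List Bool) (n k : ℕ) :
    (x, n, k) ∈ kCSPAllen ↔ kCSPAllenCount x n k ≠ 0 := by
  unfold kCSPAllenCount
  rw [Ne, Nat.card_eq_zero, not_or, not_isEmpty_iff, nonempty_subtype]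
  have hfin : ¬Infinite {π : OrderedPartition (Fin n ⊕ Fin n) //
      ∃ C : List (AllenConstraint n), x = encodeInstance n C ∧ π.IsSolution C k} :=
    not_infinite_iff_finite.2 inferInstance
  rw [and_iff_left hfin]
  constructor
  · rintro ⟨C, hx, hf⟩
    obtain ⟨π, hπ⟩ := (exists_isSolution_iff C k).2 hf
    exact ⟨π, C, hx, hπ⟩
  · rintro ⟨π, C, hx, hπ⟩
    exact ⟨C, hx, (exists_isSolution_iff C k).1 ⟨π, hπ⟩⟩

end AllenDP

/-! ### A program for layered dynamic programs -/

namespace RamProg.Reaches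

theorem set_eq {b c v : ℕ} {s : RamState} {e : RamExpr} (r : ℕ) (hv : e.eval s = v)
    (h : e.Fits b s) (hc : e.nodes + 1 ≤ c) :
    (RamProg.set r e).Reaches s (s.setReg r v) (c * (b + 1) ^ 2) := by
  subst hv
  exact (set r h).mono (Nat.mul_le_mul_right _ hc)

theorem store_eq {b c v j : ℕ} {s : RamState} {i e : RamExpr} (a : ℕ) (hj : i.eval s = j)
    (hv : e.eval s = v) (hi : i.Fits b s) (he : e.Fits b s) (hc : i.nodes + e.nodes + 1 ≤ c) :
    (RamProg.store a i e).Reaches s (s.setMem a j v) (c * (b + 1) ^ 2) := by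
  subst hj hv
  exact (store a hi he).mono (Nat.mul_le_mul_right _ hc)

end RamProg.Reaches

namespace AllenDP

/-- Registers `0` to `4` hold the parameters, array `0` holds the input. -/
def Env (p : Fin 5 → ℕ) (A : ℕ → ℕ) (s : RamState) : Prop :=
  (∀ i : Fin 5, s.reg i = p i) ∧ s.mem 0 = A

/-- The program `P` computes `F` of registers `10` and `12` into register `14`, within time `T` for
arguments of at most `b` bits, and uses only registers from `14` on. -/
def Computes (P : RamProg) (p : Fin 5 → ℕ) (A : ℕ → ℕ) (b T : ℕ) (F : ℕ → ℕ → ℕ) : Prop :=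
  ∀ s, Env p A s → (s.reg 10).size ≤ b → (s.reg 12).size ≤ b →
    ∃ s', P.Reaches s s' T ∧ s'.reg 14 = F (s.reg 10) (s.reg 12) ∧
      (∀ r < 14, s'.reg r = s.reg r) ∧ s'.mem = s.mem

/-- The number `4 n + 2` of columns of the table of counts. -/
def widthExpr : RamExpr := .add (.mul (.const 4) (.reg 1)) (.const 2)

/-- Enter the weight in register `11` for the target state whose code plus one is in register `14`:
a state that is met for the first time is appended to the queue in array `1`. -/
def pushProg : RamProg :=
  .seq (.set 13 (.add (.mul (.sub (.reg 14) (.const 1)) widthExpr) (.add (.reg 6) (.const 1)))) <|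
  .seq (.ite (.mem 3 (.reg 13)) .skip
    (.seq (.store 1 (.reg 8) (.sub (.reg 14) (.const 1))) (.set 8 (.add (.reg 8) (.const 1))))) <|
  .store 3 (.reg 13) (.add (.mem 3 (.reg 13)) (.reg 11))

/-- Process one letter (register `12`) for the current state (register `10`). -/
def letterProg (Pδ : RamProg) : RamProg :=
  .seq Pδ <| .seq (.ite (.reg 14) pushProg .skip) (.set 12 (.add (.reg 12) (.const 1)))

/-- Process the state at the head of the queue (position in register `7`): its multiplicity is added to
the result in register `5` if it is final, and passed on along all letters. -/
def elementProg (Pδ Pφ : RamProg) : RamProg :=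
  .seq (.set 10 (.mem 1 (.reg 7))) <|
  .seq (.set 11 (.mem 3 (.add (.mul (.reg 10) widthExpr) (.reg 6)))) <|
  .seq (.set 12 (.const 0)) <|
  .seq Pφ <|
  .seq (.set 5 (.add (.reg 5) (.mul (.reg 14) (.reg 11)))) <|
  .seq (.while (.sub (.add (.mul (.const 2) (.reg 1)) (.const 1)) (.reg 12)) (letterProg Pδ))
    (.set 7 (.add (.reg 7) (.const 1)))

/-- Process a layer (its number is in register `6`). The states of the layer are those in the queue up
to its present end, which is kept in register `9`. -/
def layerProg (Pδ Pφ : RamProg) : RamProg :=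
  .seq (.set 9 (.reg 8)) <|
  .seq (.while (.sub (.reg 9) (.reg 7)) (elementProg Pδ Pφ))
    (.set 6 (.add (.reg 6) (.const 1)))

/-- The dynamic program: process the layers `0` to `4 n`. The queue in array `1` initially holds the
state with code `0` (arrays are zero at the start), whose multiplicity in the table is set to `1`. -/
def layersProg (Pδ Pφ : RamProg) : RamProg :=
  .seq (.set 8 (.const 1)) <| .seq (.store 3 (.const 0) (.const 1)) <|
  .while (.sub (.add (.mul (.const 4) (.reg 1)) (.const 1)) (.reg 6)) (layerProg Pδ Pφ)

/-- The data of a layered count: the states of the layer `m`, with their multiplicities, arise from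
those of the layer before by a transition function `δ` in `2 n + 1` letters. -/
structure LayeredCount (n : ℕ) (δ : ℕ → ℕ → ℕ) (S : ℕ → Finset ℕ) (cnt : ℕ → ℕ → ℕ) : Prop where
  zero : ∀ t, cnt 0 t = if t = 0 then 1 else 0
  succ : ∀ m t, cnt (m + 1) t =
    ∑ s ∈ S m, ∑ c ∈ Finset.range (2 * n + 1), if δ s c = t + 1 then cnt m s else 0
  mem : ∀ m t, t ∈ S m ↔ cnt m t ≠ 0

/-- The number of queue positions taken by the layers before `m`. -/
def offset (S : ℕ → Finset ℕ) (m : ℕ) : ℕ := ∑ i ∈ Finset.range m, (S i).card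

/-- The contribution of the layer `m` to the result. -/
def layerTotal (φ : ℕ → ℕ) (S : ℕ → Finset ℕ) (cnt : ℕ → ℕ → ℕ) (m : ℕ) : ℕ :=
  ∑ t ∈ S m, φ t * cnt m t

/-- All numbers that occur in the dynamic program have at most `b` bits. -/
structure Bounded (b n : ℕ) (p : Fin 5 → ℕ) (φ : ℕ → ℕ) (S : ℕ → Finset ℕ) (cnt : ℕ → ℕ → ℕ) :
    Prop where
  param : p 1 = n
  address : ∀ m ≤ 4 * n + 1, ∀ t ∈ S m, t * (4 * n + 2) + (4 * n + 10) < 2 ^ b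
  count : ∀ m ≤ 4 * n + 1, ∀ t, cnt m t < 2 ^ b
  offset : offset S (4 * n + 2) + 1 < 2 ^ b
  total : ∑ m ∈ Finset.range (4 * n + 1), layerTotal φ S cnt m < 2 ^ b
  final : ∀ t, φ t ≤ 1

theorem Env.setReg {p : Fin 5 → ℕ} {A : ℕ → ℕ} {s : RamState} (h : Env p A s) {r : ℕ} (v : ℕ)
    (hr : 5 ≤ r) : Env p A (s.setReg r v) := by
  refine ⟨fun i => ?_, h.2⟩
  rw [RamState.reg_setReg, if_neg (by omega), h.1]

theorem Env.setMem {p : Fin 5 → ℕ} {A : ℕ → ℕ} {s : RamState} (h : Env p A s) {a : ℕ} (i v : ℕ)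
    (ha : a ≠ 0) : Env p A (s.setMem a i v) := by
  refine ⟨h.1, ?_⟩
  rw [← h.2]
  funext j
  rw [RamState.mem_setMem, if_neg (by tauto)]

theorem Env.congr {p : Fin 5 → ℕ} {A : ℕ → ℕ} {s s' : RamState} (h : Env p A s)
    (hr : ∀ r < 5, s'.reg r = s.reg r) (hm : s'.mem = s.mem) : Env p A s' :=
  ⟨fun i => by rw [hr _ i.2, h.1], by rw [hm, h.2]⟩

/-- The queue and the table while the layer `m` is being processed: the old part of the queue ends at
`hi`, and `g` is the part of the layer `m + 1` that has been entered. -/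
structure Front (n hi m : ℕ) (cnt : ℕ → ℕ → ℕ) (a g : ℕ → ℕ) (s : RamState) : Prop where
  old : ∀ q < hi, s.mem 1 q = a q
  table : ∀ t m', m' ≤ 4 * n + 1 → s.mem 3 (t * (4 * n + 2) + m') =
    if m' ≤ m then cnt m' t else if m' = m + 1 then g t else 0
  hi_le : hi ≤ s.reg 8
  inj : ∀ q q', hi ≤ q → q < q' → q' < s.reg 8 → s.mem 1 q ≠ s.mem 1 q'
  mem : ∀ t, g t ≠ 0 ↔ ∃ q, hi ≤ q ∧ q < s.reg 8 ∧ s.mem 1 q = t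

section

variable {n hi m b : ℕ} {cnt : ℕ → ℕ → ℕ} {a g : ℕ → ℕ} {s s' : RamState} {p : Fin 5 → ℕ}
  {A : ℕ → ℕ} {S : ℕ → Finset ℕ} {δ : ℕ → ℕ → ℕ} {φ : ℕ → ℕ}

theorem Front.congr (h : Front n hi m cnt a g s) (h8 : s'.reg 8 = s.reg 8)
    (hm : s'.mem = s.mem) : Front n hi m cnt a g s' := by
  obtain ⟨h1, h2, h3, h4, h5⟩ := h
  constructor
  · rwa [hm]
  · rwa [hm]
  · rwa [h8]
  · rwa [h8, hm]
  · rwa [h8, hm]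

theorem Front.image_eq (h : Front n hi m cnt a g s) {X : Finset ℕ} (hX : ∀ t, t ∈ X ↔ g t ≠ 0) :
    (Finset.Ico hi (s.reg 8)).image (s.mem 1) = X := by
  ext t
  rw [hX, h.mem, Finset.mem_image]
  simp only [Finset.mem_Ico, and_assoc]

/-- If `g` has support `X`, then the new part of the queue lists `X` without repetition. -/
theorem Front.card_eq (h : Front n hi m cnt a g s) {X : Finset ℕ} (hX : ∀ t, t ∈ X ↔ g t ≠ 0) :
    s.reg 8 = hi + X.card := by
  rw [← h.image_eq hX, Finset.card_image_of_injOn, Nat.card_Ico]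
  · have := h.hi_le; omega
  · intro q hq q' hq' he
    simp only [Finset.coe_Ico, Set.mem_Ico] at hq hq'
    rcases Nat.lt_trichotomy q q' with h1 | h1 | h1
    · exact absurd he (h.inj q q' hq.1 h1 hq'.2)
    · exact h1
    · exact absurd he.symm (h.inj q' q hq'.1 h1 hq.2)

theorem Front.reg_le (h : Front n hi m cnt a g s) {X : Finset ℕ} (hX : ∀ t, g t ≠ 0 → t ∈ X) :
    s.reg 8 ≤ hi + X.card := by
  classical
  rw [h.card_eq (X := X.filter (g · ≠ 0)) fun t => by
    rw [Finset.mem_filter]; exact ⟨fun h => h.2, fun h => ⟨hX t h, h⟩⟩]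
  exact Nat.add_le_add_left (Finset.card_filter_le _ _) _

/-- Cells of the table are addressed without collisions. -/
theorem table_index_inj {t t' m m' : ℕ} (hm : m ≤ 4 * n + 1) (hm' : m' ≤ 4 * n + 1) :
    t * (4 * n + 2) + m = t' * (4 * n + 2) + m' ↔ t = t' ∧ m = m' := by
  refine ⟨fun h => ?_, fun ⟨h1, h2⟩ => by rw [h1, h2]⟩
  have h1 := congrArg (· / (4 * n + 2)) h
  rw [Nat.mul_comm t, Nat.mul_comm t'] at h1
  rw [Nat.mul_add_div (by omega), Nat.mul_add_div (by omega), Nat.div_eq_of_lt (by omega),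
    Nat.div_eq_of_lt (by omega)] at h1
  obtain rfl : t = t' := by omega
  exact ⟨rfl, by omega⟩

/-- Entering a weight for the state `t`. -/
theorem pushProg_reaches {t : ℕ} (hE : Env p A s) (hp : p 1 = n) (hF : Front n hi m cnt a g s)
    (h6 : s.reg 6 = m) (h14 : s.reg 14 = t + 1) (h11 : s.reg 11 ≠ 0) (hm : m < 4 * n + 1)
    (ht : t * (4 * n + 2) + (4 * n + 10) < 2 ^ b) (hg : g t + s.reg 11 < 2 ^ b)
    (h8 : s.reg 8 + 1 < 2 ^ b) :
    ∃ s', pushProg.Reaches s s' (60 * (b + 1) ^ 2) ∧ Env p A s' ∧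
      Front n hi m cnt a (fun u => if u = t then g t + s.reg 11 else g u) s' ∧
      ∀ r < 13, r ≠ 8 → s'.reg r = s.reg r := by
  have h1 : s.reg 1 = n := (hE.1 1).trans hp
  have hQ : 1 ≤ (b + 1) ^ 2 := Nat.one_le_pow _ _ (by omega)
  have htt : t ≤ t * (4 * n + 2) := Nat.le_mul_of_pos_right t (by omega)
  set i := t * (4 * n + 2) + (m + 1) with hi_def
  have hcell : s.mem 3 i = g t := by
    rw [hi_def, hF.table t (m + 1) (by omega), if_neg (by omega), if_pos rfl]
  have hg1 : g t < 2 ^ b := by omega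
  have hib : i < 2 ^ b := by omega
  -- The constant `1` has one bit.
  have hb1 : 1 ≤ b := by
    by_contra hb
    obtain rfl : b = 0 := by omega
    omega
  set s1 := s.setReg 13 i with hs1
  have hE1 : Env p A s1 := hE.setReg _ (by omega)
  have e1 : RamProg.Reaches (.set 13 (.add (.mul (.sub (.reg 14) (.const 1)) widthExpr)
      (.add (.reg 6) (.const 1)))) s s1 (14 * (b + 1) ^ 2) := by
    refine .set_eq _ ?_ ?_ (by simp [widthExpr, RamExpr.nodes])
    · simp [RamExpr.eval, widthExpr, h14, h1, h6, hi_def]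
    · simp only [RamExpr.Fits, RamExpr.eval, widthExpr, Nat.size_le, h14, h1, h6,
        Nat.add_sub_cancel]
      omega
  -- the state after the conditional extension of the queue
  obtain ⟨s2, e2, hE2, hreg2, hmem2, hold2, h82, hinj2, hq2⟩ : ∃ s2, RamProg.Reaches
      (.ite (.mem 3 (.reg 13)) .skip (.seq (.store 1 (.reg 8) (.sub (.reg 14) (.const 1)))
        (.set 8 (.add (.reg 8) (.const 1))))) s1 s2 (20 * (b + 1) ^ 2) ∧ Env p A s2 ∧
      (∀ r, r ≠ 8 → s2.reg r = s1.reg r) ∧ (∀ j, s2.mem 3 j = s1.mem 3 j) ∧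
      (∀ q < hi, s2.mem 1 q = a q) ∧ hi ≤ s2.reg 8 ∧
      (∀ q q', hi ≤ q → q < q' → q' < s2.reg 8 → s2.mem 1 q ≠ s2.mem 1 q') ∧
      ∀ u, (u = t ∨ g u ≠ 0) ↔ ∃ q, hi ≤ q ∧ q < s2.reg 8 ∧ s2.mem 1 q = u := by
    have hfit : RamExpr.Fits b s1 (.mem 3 (.reg 13)) := by
      simp [hs1, RamExpr.Fits, RamExpr.eval, Nat.size_le, hcell, hg1, hib]
    have hle := hF.hi_le
    by_cases h0 : g t = 0
    · have hne : ∀ q, hi ≤ q → q < s.reg 8 → s.mem 1 q ≠ t := fun q h1 h2 h3 =>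
        (hF.mem t).2 ⟨q, h1, h2, h3⟩ h0
      refine ⟨(s1.setMem 1 (s.reg 8) t).setReg 8 (s.reg 8 + 1), ?_,
        (hE1.setMem _ _ (by omega)).setReg _ (by omega), fun r hr => by simp [hr], ?_, ?_, ?_, ?_, ?_⟩
      · refine (RamProg.Reaches.ite_neg hfit (by simp [hs1, RamExpr.eval, hcell, h0])
          (.seq (.store_eq (b := b) (c := 5) 1 ?_ ?_ ?_ ?_ ?_)
            (.set_eq (b := b) (c := 5) 8 ?_ ?_ ?_))).mono ?_
        · simp [RamExpr.eval, hs1]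
        · simp [RamExpr.eval, hs1, h14]
        · simp [RamExpr.Fits, hs1, Nat.size_le]; omega
        · simp [RamExpr.Fits, hs1, Nat.size_le, h14]; omega
        · simp [RamExpr.nodes]
        · simp [RamExpr.eval, hs1]
        · simp [RamExpr.Fits, RamExpr.eval, hs1, Nat.size_le]; omega
        · simp [RamExpr.nodes]
        · simp only [RamExpr.nodes]; omega
      · intro j; simp
      · intro q hq
        have : q ≠ s.reg 8 := by omega
        simp [this, hs1, hF.old q hq]
      · simp; omega
      · intro q q' hq hqq hq'
        simp only [RamState.reg_setReg, if_pos] at hq'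
        have hq1 : q ≠ s.reg 8 := by omega
        have := hne q hq (by omega)
        by_cases h : q' = s.reg 8
        · simp [h, hq1, hs1, this]
        · simpa [h, hq1, hs1] using hF.inj q q' hq hqq (by omega)
      · intro u
        rw [hF.mem]
        simp only [RamState.reg_setReg, if_pos, RamState.mem_setReg, RamState.mem_setMem, true_and,
          hs1]
        constructor
        · rintro (rfl | ⟨q, h1, h2, h3⟩)
          · exact ⟨s.reg 8, hle, by omega, by simp⟩
          · exact ⟨q, h1, by omega, by rw [if_neg (by omega), h3]⟩
        · rintro ⟨q, h1, h2, h3⟩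
          split_ifs at h3 with h
          · exact Or.inl h3.symm
          · exact Or.inr ⟨q, h1, by omega, h3⟩
    · refine ⟨s1, (RamProg.Reaches.ite_pos hfit (by simp [hs1, RamExpr.eval, hcell, h0])
          (.skip _)).mono (by simp only [RamExpr.nodes]; omega), hE1, fun _ _ => rfl, fun _ => rfl,
          hF.old, by simpa [hs1] using hle, by simpa [hs1] using hF.inj, fun u => ?_⟩
      simp only [hs1, RamState.reg_setReg, RamState.mem_setReg]
      rw [if_neg (by omega), ← hF.mem]
      exact ⟨fun h => h.elim (fun h => h ▸ h0) id, Or.inr⟩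
  have hi2 : s2.reg 13 = i := by rw [hreg2 _ (by omega)]; simp [hs1]
  have h112 : s2.reg 11 = s.reg 11 := by rw [hreg2 _ (by omega)]; simp [hs1]
  have hcell2 : s2.mem 3 i = g t := by rw [hmem2]; simp [hs1, hcell]
  refine ⟨s2.setMem 3 i (g t + s.reg 11), (e1.seq (e2.seq (.store_eq (b := b) (c := 6) 3 ?_ ?_ ?_ ?_
    ?_))).mono (by omega), hE2.setMem _ _ (by omega), ⟨?_, ?_, h82, ?_, ?_⟩, fun r h1 h2 => ?_⟩
  · simp [RamExpr.eval, hi2]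
  · simp [RamExpr.eval, hi2, hcell2, h112]
  · simp [RamExpr.Fits, Nat.size_le, hi2, hib]
  · simp [RamExpr.Fits, RamExpr.eval, Nat.size_le, hi2, hib, hcell2, h112]; omega
  · simp [RamExpr.nodes]
  · simpa using hold2
  · intro t' m' hm'
    simp only [RamState.mem_setMem, hi_def, table_index_inj hm' (show m + 1 ≤ 4 * n + 1 by omega),
      hmem2, hs1, RamState.mem_setReg, hF.table t' m' hm', true_and]
    by_cases h1 : m' = m + 1
    · subst h1
      by_cases h2 : t' = t <;> simp [h2]
    · simp [h1]
  · simpa using hinj2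
  · intro u
    simp only [RamState.mem_setMem, RamState.reg_setMem]
    rw [show (∃ q, hi ≤ q ∧ q < s2.reg 8 ∧ (if 1 = 3 ∧ q = i then g t + s.reg 11 else s2.mem 1 q) = u)
      ↔ ∃ q, hi ≤ q ∧ q < s2.reg 8 ∧ s2.mem 1 q = u by simp, ← hq2]
    by_cases h : u = t
    · simp only [h, if_true, true_or, iff_true]; omega
    · simp [h]
  · rw [RamState.reg_setMem, hreg2 r h2]
    simp only [hs1, RamState.reg_setReg]
    rw [if_neg (by omega)]

end

end AllenDP

/-! ### Correctness and running time of the dynamic program -/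

namespace AllenDP

section

variable {n hi m b : ℕ} {cnt : ℕ → ℕ → ℕ} {a g : ℕ → ℕ} {s s' : RamState} {p : Fin 5 → ℕ}
  {A : ℕ → ℕ} {S : ℕ → Finset ℕ} {δ : ℕ → ℕ → ℕ} {φ : ℕ → ℕ} {Pδ Pφ : RamProg} {Tδ Tφ : ℕ}

theorem offset_mono (S : ℕ → Finset ℕ) {i j : ℕ} (h : i ≤ j) : offset S i ≤ offset S j :=
  Finset.sum_le_sum_of_subset (Finset.range_mono h)

theorem Front.congr_fun (h : Front n hi m cnt a g s) {g' : ℕ → ℕ} (hg : ∀ t, g t = g' t) :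
    Front n hi m cnt a g' s := by
  obtain rfl : g = g' := funext hg
  exact h

/-- The queue never outgrows the bound: its new part lists states of the layer `m + 1`. -/
theorem tail_add_one_lt (hB : Bounded b n p φ S cnt) (hL : LayeredCount n δ S cnt)
    (hF : Front n (offset S (m + 1)) m cnt a g s) (hm : m < 4 * n + 1)
    (hg : ∀ t, g t ≤ cnt (m + 1) t) : s.reg 8 + 1 < 2 ^ b := by
  have h1 := hF.reg_le (X := S (m + 1)) fun t ht => (hL.mem _ _).2 (by have := hg t; omega)
  have h2 : offset S (m + 2) = offset S (m + 1) + (S (m + 1)).card := Finset.sum_range_succ _ _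
  have h3 := offset_mono S (show m + 2 ≤ 4 * n + 2 by omega)
  have := hB.offset
  omega

/-- One letter passes the multiplicity of the state `x` on to the next state, if there is one. -/
theorem letterProg_reaches {x c : ℕ} (hB : Bounded b n p φ S cnt) (hL : LayeredCount n δ S cnt)
    (hδ : Computes Pδ p A b Tδ δ) (hE : Env p A s) (hm : m < 4 * n + 1)
    (hF : Front n (offset S (m + 1)) m cnt a g s) (h6 : s.reg 6 = m) (h10 : s.reg 10 = x)
    (h11 : s.reg 11 = cnt m x) (h12 : s.reg 12 = c) (hx : x ∈ S m) (hc : c ≤ 2 * n)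
    (hg : ∀ t, g t + (if δ x c = t + 1 then cnt m x else 0) ≤ cnt (m + 1) t) :
    ∃ s', (letterProg Pδ).Reaches s s' (Tδ + 80 * (b + 1) ^ 2) ∧ Env p A s' ∧
      Front n (offset S (m + 1)) m cnt a
        (fun t => g t + if δ x c = t + 1 then cnt m x else 0) s' ∧
      s'.reg 12 = c + 1 ∧ ∀ r < 12, r ≠ 8 → s'.reg r = s.reg r := by
  have hQ : 1 ≤ (b + 1) ^ 2 := Nat.one_le_pow _ _ (by omega)
  have hx0 : cnt m x ≠ 0 := (hL.mem _ _).1 hx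
  have hxb := hB.address m (by omega) x hx
  have hxx : x ≤ x * (4 * n + 2) := Nat.le_mul_of_pos_right x (by omega)
  obtain ⟨s1, e1, v1, r1, m1⟩ := hδ s hE (by rw [h10, Nat.size_le]; omega)
    (by rw [h12, Nat.size_le]; omega)
  rw [h10, h12] at v1
  have hE1 : Env p A s1 := hE.congr (fun r hr => r1 r (by omega)) m1
  have hF1 : Front n (offset S (m + 1)) m cnt a g s1 := hF.congr (r1 8 (by omega)) m1
  have h121 : s1.reg 12 = c := by rw [r1 12 (by omega), h12]
  have h111 : s1.reg 11 = cnt m x := by rw [r1 11 (by omega), h11]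
  have key : ∃ s2, (RamProg.ite (.reg 14) pushProg .skip).Reaches s1 s2 (70 * (b + 1) ^ 2) ∧
      Env p A s2 ∧ Front n (offset S (m + 1)) m cnt a
        (fun t => g t + if δ x c = t + 1 then cnt m x else 0) s2 ∧
      ∀ r < 13, r ≠ 8 → s2.reg r = s1.reg r := by
    rcases Nat.eq_zero_or_pos (δ x c) with h0 | hpos
    · refine ⟨s1, (RamProg.Reaches.ite_neg (b := b) ?_ ?_ (.skip _)).mono ?_, hE1,
        hF1.congr_fun fun t => ?_, fun _ _ _ => rfl⟩
      · simp [RamExpr.Fits, v1, h0]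
      · simp [RamExpr.eval, v1, h0]
      · simp only [RamExpr.nodes]; omega
      · simp [h0]
    · obtain ⟨t, ht⟩ : ∃ t, δ x c = t + 1 := ⟨δ x c - 1, by omega⟩
      have hgt := hg t
      rw [if_pos ht] at hgt
      have htS : t ∈ S (m + 1) := (hL.mem _ _).2 (by omega)
      have htb := hB.address (m + 1) (by omega) t htS
      have htt : t ≤ t * (4 * n + 2) := Nat.le_mul_of_pos_right t (by omega)
      have hcb := hB.count (m + 1) (by omega) t
      obtain ⟨s2, e2, hE2, hF2, r2⟩ := pushProg_reaches (b := b) (t := t) hE1 hB.param hF1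
        (by rw [r1 6 (by omega), h6]) (by rw [v1, ht]) (by rw [h111]; exact hx0) hm htb
        (by rw [h111]; omega) (tail_add_one_lt hB hL hF1 hm fun t => (Nat.le_add_right _ _).trans (hg t))
      refine ⟨s2, (RamProg.Reaches.ite_pos (b := b) ?_ ?_ e2).mono ?_, hE2,
        hF2.congr_fun fun u => ?_, r2⟩
      · simp [RamExpr.Fits, v1, ht, Nat.size_le]; omega
      · simp [RamExpr.eval, v1, ht]
      · simp only [RamExpr.nodes]; omega
      · rw [ht, h111]
        by_cases hu : u = t
        · simp [hu]
        · have : t ≠ u := fun h => hu h.symm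
          simp [hu, this]
  obtain ⟨s2, e2, hE2, hF2, r2⟩ := key
  have h122 : s2.reg 12 = c := by rw [r2 12 (by omega) (by omega), h121]
  refine ⟨s2.setReg 12 (c + 1), (e1.seq (e2.seq (.set_eq (b := b) (c := 4) 12 ?_ ?_ ?_))).mono ?_,
    hE2.setReg _ (by omega), hF2.congr (by simp) (by simp), by simp, fun r hr h8 => ?_⟩
  · simp [RamExpr.eval, h122]
  · simp only [RamExpr.Fits, RamExpr.eval, h122, Nat.size_le]; omega
  · simp [RamExpr.nodes]
  · omega
  · rw [RamState.reg_setReg, if_neg (by omega), r2 r (by omega) h8, r1 r (by omega)]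

/-- The multiplicities that pass from the state `x` of the layer `m` to the state `t`. -/
def outflow (n : ℕ) (δ : ℕ → ℕ → ℕ) (cnt : ℕ → ℕ → ℕ) (m x t : ℕ) : ℕ :=
  ∑ c ∈ Finset.range (2 * n + 1), if δ x c = t + 1 then cnt m x else 0

/-- Processing the state `x` enters its outflow and adds its contribution to the result. -/
theorem elementProg_reaches {x q v : ℕ} (hB : Bounded b n p φ S cnt) (hL : LayeredCount n δ S cnt)
    (hδ : Computes Pδ p A b Tδ δ) (hφ : Computes Pφ p A b Tφ fun x _ => φ x) (hE : Env p A s)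
    (hm : m < 4 * n + 1) (hF : Front n (offset S (m + 1)) m cnt a g s) (h5 : s.reg 5 = v)
    (h6 : s.reg 6 = m) (h7 : s.reg 7 = q) (hq : q < offset S (m + 1)) (haq : a q = x) (hx : x ∈ S m)
    (hv : v + φ x * cnt m x < 2 ^ b)
    (hg : ∀ t, g t + outflow n δ cnt m x t ≤ cnt (m + 1) t) :
    ∃ s', (elementProg Pδ Pφ).Reaches s s'
        (Tφ + 50 * (b + 1) ^ 2 + (2 * n + 2) * (Tδ + 90 * (b + 1) ^ 2)) ∧ Env p A s' ∧
      Front n (offset S (m + 1)) m cnt a (fun t => g t + outflow n δ cnt m x t) s' ∧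
      s'.reg 5 = v + φ x * cnt m x ∧ s'.reg 6 = m ∧ s'.reg 7 = q + 1 ∧ s'.reg 9 = s.reg 9 := by
  have hQ : 1 ≤ (b + 1) ^ 2 := Nat.one_le_pow _ _ (by omega)
  have hxb := hB.address m (by omega) x hx
  have hxx : x ≤ x * (4 * n + 2) := Nat.le_mul_of_pos_right x (by omega)
  have h1 : s.reg 1 = n := (hE.1 1).trans hB.param
  have hb1 : 1 ≤ b := by
    by_contra hb
    obtain rfl : b = 0 := by omega
    omega
  have hob : q + 1 < 2 ^ b := by
    have := offset_mono S (show m + 1 ≤ 4 * n + 2 by omega)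
    have := hB.offset
    omega
  have hcb := hB.count m (by omega) x
  have hxq : s.mem 1 q = x := (hF.old q hq).trans haq
  have hcell : s.mem 3 (x * (4 * n + 2) + m) = cnt m x := by
    rw [hF.table x m (by omega), if_pos le_rfl]
  -- load the state and its multiplicity
  let s3 : RamState := ((s.setReg 10 x).setReg 11 (cnt m x)).setReg 12 0
  have e1 : RamProg.Reaches (.set 10 (.mem 1 (.reg 7))) s (s.setReg 10 x) (3 * (b + 1) ^ 2) := by
    refine .set_eq _ ?_ ?_ (by simp [RamExpr.nodes])
    · simp [RamExpr.eval, h7, hxq]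
    · simp only [RamExpr.Fits, RamExpr.eval, h7, hxq, Nat.size_le]; omega
  have e2 : RamProg.Reaches (.set 11 (.mem 3 (.add (.mul (.reg 10) widthExpr) (.reg 6))))
      (s.setReg 10 x) ((s.setReg 10 x).setReg 11 (cnt m x)) (11 * (b + 1) ^ 2) := by
    refine .set_eq _ ?_ ?_ (by simp [RamExpr.nodes, widthExpr])
    · simp [RamExpr.eval, widthExpr, h1, h6, hcell]
    · simp [RamExpr.Fits, RamExpr.eval, widthExpr, h1, h6, hcell, Nat.size_le]; omega
  have e3 : RamProg.Reaches (.set 12 (.const 0)) ((s.setReg 10 x).setReg 11 (cnt m x)) s3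
      (2 * (b + 1) ^ 2) :=
    .set_eq _ rfl (by simp [RamExpr.Fits]) (by simp [RamExpr.nodes])
  have hE3 : Env p A s3 := ((hE.setReg _ (by omega)).setReg _ (by omega)).setReg _ (by omega)
  obtain ⟨s4, e4, v4, r4, m4⟩ := hφ s3 hE3 (by simp [s3, Nat.size_le]; omega) (by simp [s3])
  have v4' : s4.reg 14 = φ x := by rw [v4]; simp [s3]
  have hE4 : Env p A s4 := hE3.congr (fun r hr => r4 r (by omega)) m4
  have hF4 : Front n (offset S (m + 1)) m cnt a g s4 :=
    hF.congr (by rw [r4 8 (by omega)]; simp [s3]) (by rw [m4]; simp [s3])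
  have hφ1 := hB.final x
  let s5 := s4.setReg 5 (v + φ x * cnt m x)
  have h54 : s4.reg 5 = v := by rw [r4 5 (by omega)]; simp [s3, h5]
  have h114 : s4.reg 11 = cnt m x := by rw [r4 11 (by omega)]; simp [s3]
  have e5 : RamProg.Reaches (.set 5 (.add (.reg 5) (.mul (.reg 14) (.reg 11)))) s4 s5
      (6 * (b + 1) ^ 2) := by
    refine .set_eq _ ?_ ?_ (by simp [RamExpr.nodes])
    · simp [RamExpr.eval, h54, v4', h114]
    · simp only [RamExpr.Fits, RamExpr.eval, h54, v4', h114, Nat.size_le]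
      omega
  have hE5 : Env p A s5 := hE4.setReg _ (by omega)
  let Inv : ℕ → RamState → Prop := fun c u => Env p A u ∧
    Front n (offset S (m + 1)) m cnt a
      (fun t => g t + ∑ c' ∈ Finset.range c, if δ x c' = t + 1 then cnt m x else 0) u ∧
    u.reg 12 = c ∧ ∀ r < 12, r ≠ 8 → u.reg r = s5.reg r
  have r5 : ∀ r < 14, r ≠ 5 → s5.reg r = s3.reg r := fun r h1 h2 => by
    simp only [s5, RamState.reg_setReg, if_neg h2, r4 r h1]
  obtain ⟨s6, e6, hE6, hF6, h126, r6⟩ := RamProg.Reaches.while_loop (b := b)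
    (e := .sub (.add (.mul (.const 2) (.reg 1)) (.const 1)) (.reg 12)) (P := letterProg Pδ) Inv
    (N := 2 * n + 1) (T := Tδ + 80 * (b + 1) ^ 2) (s := s5)
    (by
      rintro c hc u ⟨hEu, hFu, h12u, ru⟩
      have h1u : u.reg 1 = n := (hEu.1 1).trans hB.param
      refine ⟨?_, ?_, ?_⟩
      · simp only [RamExpr.Fits, RamExpr.eval, h1u, h12u, Nat.size_le]; omega
      · simp only [RamExpr.eval, h1u, h12u]; omega
      · have hsub : ∀ t, g t + ∑ c' ∈ Finset.range (c + 1), (if δ x c' = t + 1 then cnt m x else 0) ≤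
            cnt (m + 1) t := fun t => (Nat.add_le_add_left
          (Finset.sum_le_sum_of_subset (Finset.range_mono (by omega))) _).trans (hg t)
        obtain ⟨u', eu, hEu', hFu', h12', ru'⟩ := letterProg_reaches hB hL hδ hEu hm hFu (x := x)
          (c := c) (by rw [ru 6 (by omega) (by omega), r5 _ (by omega) (by omega)]; simp [s3, h6])
          (by rw [ru 10 (by omega) (by omega), r5 _ (by omega) (by omega)]; simp [s3])
          (by rw [ru 11 (by omega) (by omega), r5 _ (by omega) (by omega)]; simp [s3])
          h12u hx (by omega) fun t => by
            have := hsub t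
            rwa [Finset.sum_range_succ, ← add_assoc] at this
        refine ⟨u', eu, hEu', hFu'.congr_fun fun t => ?_, h12', fun r h h8 => ?_⟩
        · rw [Finset.sum_range_succ, ← add_assoc]
        · rw [ru' r h h8, ru r h h8])
    (by
      rintro u ⟨hEu, hFu, h12u, ru⟩
      have h1u : u.reg 1 = n := (hEu.1 1).trans hB.param
      refine ⟨?_, ?_⟩
      · simp only [RamExpr.Fits, RamExpr.eval, h1u, h12u, Nat.size_le]; omega
      · simp only [RamExpr.eval, h1u, h12u]; omega)
    ⟨hE5, (hF4.congr (by simp [s5]) (by simp [s5])).congr_fun (by simp),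
      by rw [r5 12 (by omega) (by omega)]; simp [s3], fun _ _ _ => rfl⟩
  have h76 : s6.reg 7 = q := by
    rw [r6 7 (by omega) (by omega), r5 7 (by omega) (by omega)]; simp [s3, h7]
  refine ⟨s6.setReg 7 (q + 1), (e1.seq (e2.seq (e3.seq (e4.seq (e5.seq (e6.seq
    (.set_eq (b := b) (c := 4) 7 ?_ ?_ ?_))))))).mono ?_, hE6.setReg _ (by omega),
    hF6.congr (by simp) (by simp), ?_, ?_, by simp, ?_⟩
  · simp [RamExpr.eval, h76]
  · simp only [RamExpr.Fits, RamExpr.eval, h76, Nat.size_le]; omega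
  · simp [RamExpr.nodes]
  · have : (2 * n + 1 + 1) * ((RamExpr.sub (.add (.mul (.const 2) (.reg 1)) (.const 1))
        (.reg 12)).nodes * (b + 1) ^ 2 + (Tδ + 80 * (b + 1) ^ 2) + 1) ≤
        (2 * n + 2) * (Tδ + 90 * (b + 1) ^ 2) := by
      refine Nat.mul_le_mul le_rfl ?_
      simp only [RamExpr.nodes]
      omega
    omega
  · rw [RamState.reg_setReg, if_neg (by omega), r6 5 (by omega) (by omega)]
    simp [s5]
  · rw [RamState.reg_setReg, if_neg (by omega), r6 6 (by omega) (by omega),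
      r5 6 (by omega) (by omega)]
    simp [s3, h6]
  · rw [RamState.reg_setReg, if_neg (by omega), r6 9 (by omega) (by omega),
      r5 9 (by omega) (by omega)]
    simp [s3]

/-- The queue and the table before the layer `m` is processed. -/
structure LayerState (p : Fin 5 → ℕ) (A : ℕ → ℕ) (n : ℕ) (φ : ℕ → ℕ) (S : ℕ → Finset ℕ)
    (cnt : ℕ → ℕ → ℕ) (m : ℕ) (s : RamState) : Prop where
  env : Env p A s
  result : s.reg 5 = ∑ i ∈ Finset.range m, layerTotal φ S cnt i
  layer : s.reg 6 = m
  head : s.reg 7 = offset S m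
  tail : s.reg 8 = offset S (m + 1)
  table : ∀ t m', m' ≤ 4 * n + 1 → s.mem 3 (t * (4 * n + 2) + m') = if m' ≤ m then cnt m' t else 0
  inj : ∀ q q', offset S m ≤ q → q < q' → q' < offset S (m + 1) → s.mem 1 q ≠ s.mem 1 q'
  mem : ∀ t, t ∈ S m ↔ ∃ q, offset S m ≤ q ∧ q < offset S (m + 1) ∧ s.mem 1 q = t

/-- Processing a layer turns the queue and the table into those for the next layer. -/
theorem layerProg_reaches (hB : Bounded b n p φ S cnt) (hL : LayeredCount n δ S cnt)
    (hδ : Computes Pδ p A b Tδ δ) (hφ : Computes Pφ p A b Tφ fun x _ => φ x)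
    (hm : m < 4 * n + 1) (hs : LayerState p A n φ S cnt m s) :
    ∃ s', (layerProg Pδ Pφ).Reaches s s' (((S m).card + 2) *
        (Tφ + 60 * (b + 1) ^ 2 + (2 * n + 2) * (Tδ + 90 * (b + 1) ^ 2))) ∧
      LayerState p A n φ S cnt (m + 1) s' := by
  have hQ : 1 ≤ (b + 1) ^ 2 := Nat.one_le_pow _ _ (by omega)
  have hoff : offset S (m + 1) = offset S m + (S m).card := Finset.sum_range_succ _ _
  have hob : offset S (m + 1) + 1 < 2 ^ b := by
    have := offset_mono S (show m + 1 ≤ 4 * n + 2 by omega)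
    have := hB.offset
    omega
  -- The queue enumerates the states of the layer.
  let e : ℕ → ℕ := fun j => s.mem 1 (offset S m + j)
  have heS : ∀ j < (S m).card, e j ∈ S m := fun j hj =>
    (hs.mem _).2 ⟨offset S m + j, by omega, by omega, rfl⟩
  have hsum : ∀ f : ℕ → ℕ, ∑ x ∈ S m, f x = ∑ j ∈ Finset.range (S m).card, f (e j) := fun f => by
    symm
    refine Finset.sum_bij (fun j _ => e j) (fun j hj => heS j (Finset.mem_range.1 hj))
      (fun i hi j hj hij => ?_) (fun x hx => ?_) fun _ _ => rfl
    · rw [Finset.mem_range] at hi hj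
      rcases Nat.lt_trichotomy i j with h | h | h
      · exact absurd hij (hs.inj _ _ (by omega) (by omega) (by omega))
      · exact h
      · exact absurd hij.symm (hs.inj _ _ (by omega) (by omega) (by omega))
    · obtain ⟨q, h1, h2, h3⟩ := (hs.mem x).1 hx
      exact ⟨q - offset S m, Finset.mem_range.2 (by omega),
        by simp only [e, Nat.add_sub_cancel' h1, h3]⟩
  have hcnt : ∀ t, cnt (m + 1) t =
      ∑ j ∈ Finset.range (S m).card, outflow n δ cnt m (e j) t := fun t => by
    rw [hL.succ, ← hsum fun x => outflow n δ cnt m x t]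
    rfl
  have htot : ∑ j ∈ Finset.range (S m).card, φ (e j) * cnt m (e j) = layerTotal φ S cnt m :=
    (hsum fun x => φ x * cnt m x).symm
  let s1 := s.setReg 9 (offset S (m + 1))
  have e1 : RamProg.Reaches (.set 9 (.reg 8)) s s1 (2 * (b + 1) ^ 2) :=
    .set_eq _ (by simp [RamExpr.eval, hs.tail])
      (by simp only [RamExpr.Fits, hs.tail, Nat.size_le]; omega) (by simp [RamExpr.nodes])
  let v : ℕ → ℕ := fun j => ∑ i ∈ Finset.range m, layerTotal φ S cnt i +
    ∑ i ∈ Finset.range j, φ (e i) * cnt m (e i)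
  have hvb : ∀ j ≤ (S m).card, v j < 2 ^ b := fun j hj => by
    refine lt_of_le_of_lt ?_ hB.total
    refine le_trans ?_ (Finset.sum_le_sum_of_subset (Finset.range_mono (Nat.succ_le_of_lt hm)))
    rw [Finset.sum_range_succ, ← htot]
    exact Nat.add_le_add_left (Finset.sum_le_sum_of_subset (Finset.range_mono hj)) _
  let Inv : ℕ → RamState → Prop := fun j u => Env p A u ∧
    Front n (offset S (m + 1)) m cnt (s.mem 1)
      (fun t => ∑ i ∈ Finset.range j, outflow n δ cnt m (e i) t) u ∧
    u.reg 5 = v j ∧ u.reg 6 = m ∧ u.reg 7 = offset S m + j ∧ u.reg 9 = offset S (m + 1)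
  obtain ⟨s2, e2, hE2, hF2, h52, h62, h72, h92⟩ := RamProg.Reaches.while_loop (b := b)
    (e := .sub (.reg 9) (.reg 7)) (P := elementProg Pδ Pφ) Inv (N := (S m).card)
    (T := Tφ + 50 * (b + 1) ^ 2 + (2 * n + 2) * (Tδ + 90 * (b + 1) ^ 2)) (s := s1)
    (by
      rintro j hj u ⟨hEu, hFu, h5, h6, h7, h9⟩
      refine ⟨?_, ?_, ?_⟩
      · simp only [RamExpr.Fits, h9, h7, Nat.size_le]; omega
      · simp only [RamExpr.eval, h9, h7]; omega
      · have hv1 : v (j + 1) = v j + φ (e j) * cnt m (e j) := by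
          simp only [v, Finset.sum_range_succ, add_assoc]
        obtain ⟨u', eu, hEu', hFu', h5', h6', h7', h9'⟩ := elementProg_reaches hB hL hδ hφ hEu hm hFu
          h5 h6 h7 (by omega) (x := e j) rfl (heS j hj) (by rw [← hv1]; exact hvb _ hj) fun t => by
            rw [hcnt, ← Finset.sum_range_succ (fun i => outflow n δ cnt m (e i) t)]
            exact Finset.sum_le_sum_of_subset (Finset.range_mono hj)
        refine ⟨u', eu, hEu', hFu'.congr_fun fun t => ?_, ?_, h6', ?_, ?_⟩
        · rw [Finset.sum_range_succ]
        · rw [h5', hv1]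
        · rw [h7', add_assoc]
        · rw [h9', h9])
    (by
      rintro u ⟨hEu, hFu, h5, h6, h7, h9⟩
      refine ⟨?_, ?_⟩
      · simp only [RamExpr.Fits, h9, h7, Nat.size_le]; omega
      · simp only [RamExpr.eval, h9, h7]; omega)
    (by
      refine ⟨hs.env.setReg _ (by omega), ⟨fun _ _ => rfl, fun t m' hm' => ?_, ?_, ?_, fun t => ?_⟩,
        ?_, ?_, ?_, ?_⟩
      · simp [s1, hs.table t m' hm']
      · simp [s1, hs.tail]
      · intro q q' h1 h2 h3
        simp [s1, hs.tail] at h3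
        omega
      · simp only [Finset.range_zero, Finset.sum_empty, ne_eq, not_true_eq_false, false_iff]
        rintro ⟨q, h1, h2, -⟩
        simp [s1, hs.tail] at h2
        omega
      · simp [s1, v, hs.result]
      · simp [s1, hs.layer]
      · simp [s1, hs.head]
      · simp [s1])
  have hF3 := hF2.congr_fun fun t => (hcnt t).symm
  have h82 := hF3.card_eq fun t => hL.mem (m + 1) t
  rw [show offset S (m + 1) + (S (m + 1)).card = offset S (m + 1 + 1) from
    (Finset.sum_range_succ _ _).symm] at h82
  refine ⟨s2.setReg 6 (m + 1), (e1.seq (e2.seq (.set_eq (b := b) (c := 4) 6 ?_ ?_ ?_))).mono ?_,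
    hE2.setReg _ (by omega), ?_, by simp, ?_, by simpa using h82, ?_, ?_, ?_⟩
  · simp [RamExpr.eval, h62]
  · have hob' : 4 * n + 10 < 2 ^ b := by
      have := hB.address 0 (by omega) 0 ((hL.mem 0 0).2 (by rw [hL.zero]; simp))
      omega
    simp only [RamExpr.Fits, RamExpr.eval, h62, Nat.size_le]; omega
  · simp [RamExpr.nodes]
  · simp only [RamExpr.nodes]
    set X := Tφ + 60 * (b + 1) ^ 2 + (2 * n + 2) * (Tδ + 90 * (b + 1) ^ 2) with hX
    have : ((S m).card + 1) * ((1 + 1 + 1) * (b + 1) ^ 2 +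
        (Tφ + 50 * (b + 1) ^ 2 + (2 * n + 2) * (Tδ + 90 * (b + 1) ^ 2)) + 1) ≤
        ((S m).card + 1) * X := Nat.mul_le_mul le_rfl (by omega)
    have h2 : ((S m).card + 2) * X = ((S m).card + 1) * X + X := by ring
    omega
  · rw [RamState.reg_setReg, if_neg (by omega), h52, Finset.sum_range_succ, ← htot]
  · rw [RamState.reg_setReg, if_neg (by omega), h72, hoff]
  · intro t m' hm'
    rw [RamState.mem_setReg, hF3.table t m' hm']
    rcases Nat.lt_trichotomy m' (m + 1) with h | h | h
    · rw [if_pos (by omega), if_pos (by omega)]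
    · subst h; simp
    · rw [if_neg (by omega), if_neg (by omega), if_neg (by omega)]
  · simpa [h82] using hF3.inj
  · intro t
    rw [hL.mem, hF3.mem, RamState.mem_setReg, h82]

/-- The dynamic program computes the sum of the multiplicities of the final states. -/
theorem layersProg_reaches {N : ℕ} (hB : Bounded b n p φ S cnt) (hL : LayeredCount n δ S cnt)
    (hδ : Computes Pδ p A b Tδ δ) (hφ : Computes Pφ p A b Tφ fun x _ => φ x)
    (hN : ∀ m, (S m).card ≤ N) (hE : Env p A s) (h5 : s.reg 5 = 0) (h6 : s.reg 6 = 0)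
    (h7 : s.reg 7 = 0) (h3 : ∀ i, s.mem 3 i = 0) (h1 : ∀ i, s.mem 1 i = 0) :
    ∃ s', (layersProg Pδ Pφ).Reaches s s' ((4 * n + 3) * ((N + 3) *
        (Tφ + 70 * (b + 1) ^ 2 + (2 * n + 2) * (Tδ + 90 * (b + 1) ^ 2)))) ∧
      s'.reg 5 = ∑ m ∈ Finset.range (4 * n + 1), layerTotal φ S cnt m := by
  have hQ : 1 ≤ (b + 1) ^ 2 := Nat.one_le_pow _ _ (by omega)
  have hS0 : S 0 = {0} := by
    ext t
    rw [hL.mem, hL.zero]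
    by_cases h : t = 0 <;> simp [h]
  have hbb : 4 * n + 10 < 2 ^ b := by
    have := hB.address 0 (by omega) 0 (by rw [hS0]; simp)
    omega
  have hb1 : 1 ≤ b := by
    by_contra hb
    obtain rfl : b = 0 := by omega
    omega
  let s2 := (s.setReg 8 1).setMem 3 0 1
  have e1 : RamProg.Reaches (.set 8 (.const 1)) s (s.setReg 8 1) (2 * (b + 1) ^ 2) :=
    .set_eq _ rfl (by simp [RamExpr.Fits, hb1]) (by simp [RamExpr.nodes])
  have e2 : RamProg.Reaches (.store 3 (.const 0) (.const 1)) (s.setReg 8 1) s2 (3 * (b + 1) ^ 2) :=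
    .store_eq _ rfl rfl (by simp [RamExpr.Fits]) (by simp [RamExpr.Fits, hb1])
      (by simp [RamExpr.nodes])
  have hs2 : LayerState p A n φ S cnt 0 s2 := by
    have ho1 : offset S 1 = 1 := by simp [offset, hS0]
    have ho0 : offset S 0 = 0 := by simp [offset]
    refine ⟨(hE.setReg _ (by omega)).setMem _ _ (by omega), by simp [s2, h5], by simp [s2, h6],
      by simp [s2, h7, ho0], by simp [s2, ho1], fun t m' hm' => ?_, fun q q' h1 h2 h3 => ?_,
      fun t => ?_⟩
    · simp only [s2, RamState.mem_setMem, RamState.mem_setReg, h3, true_and, nonpos_iff_eq_zero]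
      have h0 : t * (4 * n + 2) + m' = 0 ↔ t = 0 ∧ m' = 0 := by simp
      simp only [h0]
      by_cases hm0 : m' = 0
      · subst hm0; simp [hL.zero]
      · simp [hm0]
    · rw [ho1] at h3; omega
    · rw [hS0, ho0, ho1]
      simp only [s2, RamState.mem_setMem, RamState.mem_setReg, h1, Finset.mem_singleton]
      constructor
      · rintro rfl
        exact ⟨0, by omega, by omega, by simp⟩
      · rintro ⟨q, -, -, h⟩
        simpa using h.symm
  set X := Tφ + 60 * (b + 1) ^ 2 + (2 * n + 2) * (Tδ + 90 * (b + 1) ^ 2) with hX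
  obtain ⟨s3, e3, hs3⟩ := RamProg.Reaches.while_loop (b := b)
    (e := .sub (.add (.mul (.const 4) (.reg 1)) (.const 1)) (.reg 6)) (P := layerProg Pδ Pφ)
    (LayerState p A n φ S cnt) (N := 4 * n + 1) (T := (N + 2) * X) (s := s2)
    (by
      intro m hm u hu
      have h1u : u.reg 1 = n := (hu.env.1 1).trans hB.param
      refine ⟨?_, ?_, ?_⟩
      · simp only [RamExpr.Fits, RamExpr.eval, h1u, hu.layer, Nat.size_le]; omega
      · simp only [RamExpr.eval, h1u, hu.layer]; omega
      · obtain ⟨u', eu, hu'⟩ := layerProg_reaches hB hL hδ hφ hm hu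
        exact ⟨u', eu.mono (Nat.mul_le_mul_right _ (Nat.add_le_add_right (hN m) 2)), hu'⟩)
    (by
      intro u hu
      have h1u : u.reg 1 = n := (hu.env.1 1).trans hB.param
      refine ⟨?_, ?_⟩
      · simp only [RamExpr.Fits, RamExpr.eval, h1u, hu.layer, Nat.size_le]; omega
      · simp only [RamExpr.eval, h1u, hu.layer]; omega)
    hs2
  refine ⟨s3, (e1.seq (e2.seq e3)).mono ?_, hs3.result⟩
  simp only [RamExpr.nodes]
  set Y := Tφ + 70 * (b + 1) ^ 2 + (2 * n + 2) * (Tδ + 90 * (b + 1) ^ 2) with hY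
  have hXY : X + 10 * (b + 1) ^ 2 = Y := by rw [hX, hY]; ring
  have h4 : (1 + 1 + 1 + 1 + 1 + 1 + 1) * (b + 1) ^ 2 + (N + 2) * X + 1 ≤ (N + 3) * Y := by
    have : (N + 2) * X ≤ (N + 2) * Y := Nat.mul_le_mul le_rfl (by omega)
    rw [show (N + 3) * Y = (N + 2) * Y + Y by ring]
    omega
  have h5 : (4 * n + 1 + 1) * ((1 + 1 + 1 + 1 + 1 + 1 + 1) * (b + 1) ^ 2 + (N + 2) * X + 1) ≤
      (4 * n + 2) * ((N + 3) * Y) := Nat.mul_le_mul le_rfl h4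
  have h6 : (4 * n + 3) * ((N + 3) * Y) = (4 * n + 2) * ((N + 3) * Y) + (N + 3) * Y := by ring
  have h7 : Y ≤ (N + 3) * Y := Nat.le_mul_of_pos_left _ (by omega)
  simp only [Nat.reduceAdd] at h5 ⊢
  omega

end

end AllenDP

/-! ### The counting program -/

namespace AllenDP

/-- The parameters of a run: `|x|`, `n`, the bound on overlaps, the bit length `w`, and `3 n + 1`. -/
def params (L n k w : ℕ) : Fin 5 → ℕ := ![L, n, k, w, 3 * n + 1]

/-- The registers of the free variables of terms: the state and the letter. -/
def varReg (i : ℕ) : ℕ := if i = 0 then 10 else 12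

/-- A bound for the bit lengths of the numbers in the dynamic program on an input of length `L`. -/
def bitBound (L : ℕ) : ℕ := (2 * L + 5) * (7 * L + 8)

theorem polyBounded_bitBound : PolyBounded bitBound :=
  .mul (.add (.mul (.const 2) .id) (.const 5)) (.add (.mul (.const 7) .id) (.const 8))

/-- A compiled term computes its value as a function of the state and the letter, in polynomial time. -/
theorem exists_computes (t : ArithTerm) : ∃ f : ℕ → ℕ, PolyBounded f ∧
    ∀ (b : ℕ) (p : Fin 5 → ℕ) (A : ℕ → ℕ), (∀ i, p i ≤ b) → (∀ i, A i ≤ 1) →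
      Computes (t.compile varReg 14) p A b (f b) fun x c =>
        t.eval p A fun i => if i = 0 then x else c := by
  obtain ⟨f, hf, h⟩ := t.compile_reaches
  refine ⟨f, hf, fun b p A hp hA s hE h10 h12 => ?_⟩
  exact (h b p A (fun i => if i = 0 then s.reg 10 else s.reg 12) hp
    (fun i => by split_ifs <;> assumption) hA).2 varReg 14 s hE.1
    (fun i => by unfold varReg; split_ifs <;> rfl)
    (fun i => by unfold varReg; split_ifs <;> omega) (by omega) hE.2

theorem Computes.congr {P : RamProg} {p : Fin 5 → ℕ} {A : ℕ → ℕ} {b T : ℕ} {F G : ℕ → ℕ → ℕ}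
    (h : Computes P p A b T F) (hFG : ∀ x c, F x c = G x c) : Computes P p A b T G := by
  obtain rfl : F = G := funext fun x => funext fun c => hFG x c
  exact h

section

variable {n k : ℕ} {Al : ℕ → ℕ → ℕ → Prop}

theorem layeredCount (n k : ℕ) (Al : ℕ → ℕ → ℕ → Prop) :
    LayeredCount n (transition n k Al) (layerStates n k Al) (stateCount n k Al) :=
  ⟨stateCount_zero, fun _ => stateCount_succ, fun _ => mem_layerStates⟩

open Classical in
/-- The indicator function of the final states. -/
noncomputable def finalIndicator (n t : ℕ) : ℕ := if IsFinal n (digit n t) then 1 else 0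

theorem sum_layerTotal (n k : ℕ) (Al : ℕ → ℕ → ℕ → Prop) :
    ∑ m ∈ Finset.range (4 * n + 1),
      layerTotal (finalIndicator n) (layerStates n k Al) (stateCount n k Al) m =
      (finalSet n k Al).card := by
  rw [card_finalSet]
  refine Finset.sum_congr rfl fun m _ => Finset.sum_congr rfl fun t _ => ?_
  unfold finalIndicator
  split_ifs <;> simp

theorem card_layerStates_le_pow (n k : ℕ) (Al : ℕ → ℕ → ℕ → Prop) (m : ℕ) :
    (layerStates n k Al m).card ≤ (2 * n + 5) ^ (3 * n + 1) := by
  have : layerStates n k Al m ⊆ Finset.range (base n ^ (3 * n + 1)) := fun t ht =>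
    Finset.mem_range.2 (layerStates_lt ht)
  simpa [base] using Finset.card_le_card this

/-- Codes of states, counts and addresses are at most a power of `2 n + 5` whose exponent is linear in
`n`, so they have at most `bitBound L` bits. -/
theorem bounded {L n k w : ℕ} {Al : ℕ → ℕ → ℕ → Prop} (hn : n ≤ L) :
    Bounded (bitBound L) n (params L n k w) (finalIndicator n) (layerStates n k Al)
      (stateCount n k Al) := by
  have h1 : (2 * n + 5) ^ (7 * n + 8) < 2 ^ bitBound L := by
    calc (2 * n + 5) ^ (7 * n + 8) < (2 ^ (2 * n + 5)) ^ (7 * n + 8) :=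
          Nat.pow_lt_pow_left Nat.lt_two_pow_self (by omega)
      _ = 2 ^ ((2 * n + 5) * (7 * n + 8)) := (pow_mul _ _ _).symm
      _ ≤ 2 ^ bitBound L := Nat.pow_le_pow_right (by omega)
          (Nat.mul_le_mul (by omega) (by omega))
  have hpow : ∀ {i}, i ≤ 7 * n + 8 → (2 * n + 5) ^ i < 2 ^ bitBound L := fun hi =>
    (Nat.pow_le_pow_right (by omega) hi).trans_lt h1
  have hcnt : ∀ m ≤ 4 * n + 1, ∀ t, stateCount n k Al m t ≤ (2 * n + 5) ^ (4 * n + 1) :=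
    fun m hm t => (stateCount_le t).trans ((Nat.pow_le_pow_left (by omega) m).trans
      (Nat.pow_le_pow_right (by omega) hm))
  refine ⟨rfl, fun m _ t ht => ?_, fun m hm t => (hcnt m hm t).trans_lt (hpow (by omega)), ?_, ?_,
    fun t => by unfold finalIndicator; split_ifs <;> omega⟩
  · refine lt_of_le_of_lt ?_ (hpow (i := 3 * n + 3) (by omega))
    have ht' : t + 1 ≤ (2 * n + 5) ^ (3 * n + 1) := layerStates_lt ht
    calc t * (4 * n + 2) + (4 * n + 10) ≤ (t + 1) * (4 * n + 10) := by nlinarith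
      _ ≤ (2 * n + 5) ^ (3 * n + 1) * (2 * n + 5) ^ 2 := Nat.mul_le_mul ht' (by nlinarith)
      _ = (2 * n + 5) ^ (3 * n + 3) := by rw [← pow_add]
  · refine lt_of_le_of_lt ?_ (hpow (i := 3 * n + 3) (by omega))
    have hp : 1 ≤ (2 * n + 5) ^ (3 * n + 1) := Nat.one_le_pow _ _ (by omega)
    calc offset (layerStates n k Al) (4 * n + 2) + 1
        ≤ (4 * n + 2) * (2 * n + 5) ^ (3 * n + 1) + 1 := by
          refine Nat.add_le_add_right ?_ 1
          refine (Finset.sum_le_card_nsmul _ _ _ fun m _ => card_layerStates_le_pow n k Al m).trans ?_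
          simp
      _ ≤ (2 * n + 5) ^ (3 * n + 1) * (4 * n + 3) := by nlinarith
      _ ≤ (2 * n + 5) ^ (3 * n + 1) * (2 * n + 5) ^ 2 := Nat.mul_le_mul_left _ (by nlinarith)
      _ = (2 * n + 5) ^ (3 * n + 3) := by rw [← pow_add]
  · refine lt_of_le_of_lt ?_ (hpow (i := 7 * n + 4) (by omega))
    have hlayer : ∀ m ∈ Finset.range (4 * n + 1), layerTotal (finalIndicator n)
        (layerStates n k Al) (stateCount n k Al) m ≤ (2 * n + 5) ^ (7 * n + 2) := fun m hm => by
      have hm' := Finset.mem_range.1 hm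
      calc _ ≤ (layerStates n k Al m).card • (2 * n + 5) ^ (4 * n + 1) := by
            refine Finset.sum_le_card_nsmul _ _ _ fun t _ => ?_
            unfold finalIndicator
            have := hcnt m (by omega) t
            split_ifs <;> omega
        _ ≤ (2 * n + 5) ^ (3 * n + 1) * (2 * n + 5) ^ (4 * n + 1) :=
            Nat.mul_le_mul_right _ (card_layerStates_le_pow n k Al m)
        _ = (2 * n + 5) ^ (7 * n + 2) := by rw [← pow_add]; congr 1; omega
    calc _ ≤ (Finset.range (4 * n + 1)).card • (2 * n + 5) ^ (7 * n + 2) :=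
          Finset.sum_le_card_nsmul _ _ _ hlayer
      _ = (4 * n + 1) * (2 * n + 5) ^ (7 * n + 2) := by simp
      _ ≤ (2 * n + 5) ^ 2 * (2 * n + 5) ^ (7 * n + 2) := Nat.mul_le_mul_right _ (by nlinarith)
      _ = (2 * n + 5) ^ (7 * n + 4) := by rw [← pow_add]; congr 1; omega

end

/-- The main time bound, without the polynomial factor. -/
def mainBound (n k : ℕ) : ℕ := (2 * max n 1 * k) ^ (2 * k) * 2 ^ n

theorem two_mul_pow_le_mainBound (n k : ℕ) : (2 * k) ^ (2 * k) * 2 ^ n ≤ mainBound n k := by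
  refine Nat.mul_le_mul_right _ (Nat.pow_le_pow_left ?_ _)
  have : 1 ≤ max n 1 := le_max_right _ _
  nlinarith

theorem self_pow_pos (a : ℕ) : 1 ≤ a ^ a := by
  rcases Nat.eq_zero_or_pos a with rfl | h
  · simp
  · exact Nat.one_le_pow _ _ h

theorem two_pow_le_mainBound (n k : ℕ) : 2 ^ n ≤ mainBound n k := by
  have := two_mul_pow_le_mainBound n k
  have := Nat.mul_le_mul_right (2 ^ n) (self_pow_pos (2 * k))
  omega

theorem one_le_mainBound (n k : ℕ) : 1 ≤ mainBound n k :=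
  Nat.one_le_two_pow.trans (two_pow_le_mainBound n k)

/-- Reading the number `k` is covered by the main time bound, however large `k` is. -/
theorem sq_size_le_mainBound (n k : ℕ) : (k.size + 1) ^ 2 ≤ mainBound n k := by
  refine le_trans ?_ (two_mul_pow_le_mainBound n k)
  refine le_trans ?_ (Nat.le_mul_of_pos_right _ (by positivity))
  rcases Nat.eq_zero_or_pos k with rfl | hk
  · simp
  · have := Nat.size_le_self k
    calc (k.size + 1) ^ 2 ≤ (2 * k) ^ 2 := Nat.pow_le_pow_left (by omega) 2
      _ ≤ (2 * k) ^ (2 * k) := Nat.pow_le_pow_right (by omega) (by omega)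

/-- Reading the number `n` is covered by the main time bound, however large `n` is. -/
theorem sq_size_le_four_mul_mainBound (n k : ℕ) : (n.size + 1) ^ 2 ≤ 4 * mainBound n k := by
  refine le_trans ?_ (Nat.mul_le_mul_left 4 (two_pow_le_mainBound n k))
  refine (Nat.pow_le_pow_left (Nat.add_le_add_right (Nat.size_le_self n) 1) 2).trans ?_
  induction n with
  | zero => simp
  | succ n ih =>
    rcases Nat.lt_or_ge n 2 with hn | hn
    · interval_cases n <;> norm_num
    · rw [pow_succ 2 n]; nlinarith

theorem card_layerStates_le_mainBound (n k : ℕ) (Al : ℕ → ℕ → ℕ → Prop) (m : ℕ) :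
    (layerStates n (min k n) Al m).card ≤ (2 * n + 1) * mainBound n k := by
  refine (card_layerStates_le n (min k n) Al m).trans ?_
  rw [mul_assoc]
  refine Nat.mul_le_mul_left _ ?_
  unfold mainBound
  rw [mul_comm]
  refine Nat.mul_le_mul_right _ ?_
  rcases Nat.eq_zero_or_pos (min k n) with h0 | hpos
  · rw [h0]
    rcases Nat.eq_zero_or_pos k with rfl | hk
    · simp
    · simp only [mul_zero, pow_zero]
      exact Nat.one_le_pow _ _ (by have : 1 ≤ max n 1 := le_max_right _ _; positivity)
  · have hk : 0 < k := by omega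
    have hn : 0 < n := by omega
    calc ((n + 1) * min k n) ^ (2 * min k n) ≤ (2 * max n 1 * k) ^ (2 * min k n) :=
          Nat.pow_le_pow_left (Nat.mul_le_mul (by omega) (by omega)) _
      _ ≤ (2 * max n 1 * k) ^ (2 * k) := Nat.pow_le_pow_right
          (by have : 1 ≤ max n 1 := le_max_right _ _; positivity) (by omega)

/-- Compute the parameters, test the input for validity and run the dynamic program. -/
def instanceProg (Pw Pv Pδ Pφ : RamProg) : RamProg :=
  .seq (.set 2 (.sub (.reg 2) (.sub (.reg 2) (.reg 1)))) <|
  .seq (.set 4 (.add (.mul (.const 3) (.reg 1)) (.const 1))) <|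
  .seq Pw <| .seq (.set 3 (.reg 14)) <| .seq Pv <|
  .ite (.reg 14) (.seq (layersProg Pδ Pφ) (.set 0 (.reg 5))) (.set 0 (.const 0))

/-- The counting program: words that are too short for `n` variables are rejected first, so that
the rest runs with numbers that are small in terms of the length of the input. -/
def countProg (Pw Pv Pδ Pφ : RamProg) : RamProg :=
  .ite (.sub (.add (.reg 1) (.const 1)) (.reg 0)) (.set 0 (.const 0)) (instanceProg Pw Pv Pδ Pφ)

theorem params_le {L n k w : ℕ} (hn : n ≤ L) (hk : k ≤ L) (hw : w ≤ L) (i : Fin 5) :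
    params L n k w i ≤ bitBound L := by
  have : 4 * L + 1 ≤ bitBound L := by unfold bitBound; nlinarith
  fin_cases i <;> simp [params] <;> omega

theorem env_iff {L n k w : ℕ} {A : ℕ → ℕ} {s : RamState} : Env (params L n k w) A s ↔
    s.reg 0 = L ∧ s.reg 1 = n ∧ s.reg 2 = k ∧ s.reg 3 = w ∧ s.reg 4 = 3 * n + 1 ∧ s.mem 0 = A := by
  unfold Env
  simp only [Fin.forall_fin_succ, params]
  simp [and_assoc]

open Classical in
/-- The correctness and the running time of `instanceProg`, for words that are long enough for `n`
variables. The bound `k` is replaced by `min k n`, which does not change the solutions and makes all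
numbers small in terms of the length of the word. -/
theorem instanceProg_reaches : ∃ (Pw Pv Pδ Pφ : RamProg) (g : ℕ → ℕ), PolyBounded g ∧
    ∀ (x : List Bool) (n k : ℕ), n + 1 ≤ x.length →
      ∃ s', (instanceProg Pw Pv Pδ Pφ).Reaches (RamState.init x n k) s'
        (mainBound n k * g x.length) ∧ s'.reg 0 = kCSPAllenCount x n k ∧
        (s'.reg 0).size ≤ bitBound x.length := by
  obtain ⟨tw, htw⟩ := expressible_size
  obtain ⟨tv, htv⟩ := testable_validInput
  obtain ⟨tδ, htδ⟩ := expressible_transition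
  obtain ⟨tφ, htφ⟩ := testable_isFinal
  obtain ⟨fw, hfw, hw⟩ := exists_computes tw
  obtain ⟨fv, hfv, hv⟩ := exists_computes tv
  obtain ⟨fδ, hfδ, hδ⟩ := exists_computes tδ
  obtain ⟨fφ, hfφ, hφ⟩ := exists_computes tφ
  let B : ℕ → ℕ := bitBound
  let Q : ℕ → ℕ := fun L => (B L + 1) ^ 2
  let Y : ℕ → ℕ := fun L => fφ (B L) + 70 * Q L + (2 * L + 2) * (fδ (B L) + 90 * Q L)
  have hBp : PolyBounded B := polyBounded_bitBound
  have hQp : PolyBounded Q := (hBp.add (.const 1)).pow 2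
  have hYp : PolyBounded Y := ((hfφ.comp hBp).add (.mul (.const 70) hQp)).add
    (.mul (.add (.mul (.const 2) .id) (.const 2)) ((hfδ.comp hBp).add (.mul (.const 90) hQp)))
  refine ⟨tw.compile varReg 14, tv.compile varReg 14, tδ.compile varReg 14, tφ.compile varReg 14,
    fun L => 6 * (L + 1) ^ 2 + fw (B L) + fv (B L) + 40 * Q L +
    (4 * L + 3) * ((2 * L + 4) * Y L), ?_, fun x n k hn => ?_⟩
  · exact ((((PolyBounded.mul (.const 6) (.pow (.add .id (.const 1)) 2)).add (hfw.comp hBp)).add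
      (hfv.comp hBp)).add (.mul (.const 40) hQp)).add
      (.mul (.add (.mul (.const 4) .id) (.const 3)) (.mul (.add (.mul (.const 2) .id) (.const 4)) hYp))
  set L := x.length with hL
  have hQ1 : 1 ≤ Q L := Nat.one_le_pow _ _ (by omega)
  have hM1 := one_le_mainBound n k
  have hbL : 4 * L + 8 ≤ B L := by simp only [B, bitBound]; nlinarith
  have hnb : n.size ≤ L := (Nat.size_le_self n).trans (by omega)
  have hsz : ∀ {y}, y ≤ B L → y.size ≤ B L := fun hy => (Nat.size_le_self _).trans hy
  have hA := wordBit_le_one x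
  set k' := min k n with hk'
  -- the parameters
  let s0 := RamState.init x n k
  let s1 := s0.setReg 2 k'
  have e1 : RamProg.Reaches (.set 2 (.sub (.reg 2) (.sub (.reg 2) (.reg 1)))) s0 s1
      (6 * (k.size + L + 1) ^ 2) := by
    refine .set_eq _ ?_ ?_ (by simp [RamExpr.nodes])
    · simp only [RamExpr.eval, s0, RamState.init]; norm_num; omega
    · simp only [RamExpr.Fits, s0, RamState.init]; norm_num; omega
  let s2 := s1.setReg 4 (3 * n + 1)
  have e2 : RamProg.Reaches (.set 4 (.add (.mul (.const 3) (.reg 1)) (.const 1))) s1 s2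
      (6 * Q L) := by
    refine .set_eq _ ?_ ?_ (by simp [RamExpr.nodes])
    · simp [RamExpr.eval, s1, s0, RamState.init]
    · simp only [RamExpr.Fits, RamExpr.eval, s1, s0, RamState.init, RamState.reg_setReg]
      norm_num
      exact ⟨⟨hsz (by omega), hsz (by omega), hsz (by omega)⟩, by omega, hsz (by omega)⟩
  have hE2 : Env (params L n k' 0) (wordBit x) s2 := by
    rw [env_iff]
    simp only [s2, s1, s0, RamState.reg_setReg, RamState.mem_setReg]
    simp only [RamState.init]
    norm_num
    exact ⟨hL.symm, funext fun i => rfl⟩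
  have r2 : ∀ r, 5 ≤ r → s2.reg r = 0 := fun r hr => by
    simp only [s2, s1, s0, RamState.reg_setReg, RamState.init]
    rw [if_neg (by omega), if_neg (by omega), if_neg (by omega), if_neg (by omega),
      if_neg (by omega)]
  have hm2 : ∀ a i, a ≠ 0 → s2.mem a i = 0 := fun a i ha => by
    simp [s2, s1, s0, RamState.init, ha]
  have hk'L : k' ≤ L := by omega
  obtain ⟨s3, e3, v3, r3, m3⟩ := hw (B L) _ _ (params_le (by omega) hk'L (Nat.zero_le _)) hA s2 hE2
    (by rw [r2 _ (by omega)]; simp) (by rw [r2 _ (by omega)]; simp)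
  replace v3 : s3.reg 14 = n.size := v3.trans (htw _ _ _ rfl)
  let s4 := s3.setReg 3 n.size
  have e4 : RamProg.Reaches (.set 3 (.reg 14)) s3 s4 (2 * Q L) := by
    refine .set_eq _ ?_ ?_ (by simp [RamExpr.nodes])
    · simp [RamExpr.eval, v3]
    · simp only [RamExpr.Fits, v3]
      exact hsz (by omega)
  have hE4 : Env (params L n k' n.size) (wordBit x) s4 := by
    rw [env_iff] at hE2 ⊢
    simp only [s4, RamState.reg_setReg, RamState.mem_setReg, m3]
    norm_num
    rw [r3 0 (by omega), r3 1 (by omega), r3 2 (by omega), r3 4 (by omega)]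
    tauto
  have hp4 := params_le (L := L) (show n ≤ L by omega) hk'L hnb
  have r4 : ∀ r, 5 ≤ r → r < 14 → s4.reg r = 0 := fun r h1 h2 => by
    simp only [s4, RamState.reg_setReg]
    rw [if_neg (by omega), r3 r h2, r2 r h1]
  obtain ⟨s5, e5, v5, r5, m5⟩ := hv (B L) _ _ hp4 hA s4 hE4
    (by rw [r4 _ (by omega) (by omega)]; simp) (by rw [r4 _ (by omega) (by omega)]; simp)
  have hE5 : Env (params L n k' n.size) (wordBit x) s5 :=
    hE4.congr (fun r hr => r5 r (by omega)) m5
  have htv' := htv (params L n k' n.size) (wordBit x) (fun i => if i = 0 then s4.reg 10 else s4.reg 12)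
    rfl
  rw [show tv.eval (params L n k' n.size) (wordBit x)
    (fun i => if i = 0 then s4.reg 10 else s4.reg 12) = s5.reg 14 from v5.symm] at htv'
  have hM2 : (k.size + L + 1) ^ 2 ≤ mainBound n k * (L + 1) ^ 2 := by
    refine le_trans ?_ (Nat.mul_le_mul_right _ (sq_size_le_mainBound n k))
    rw [← mul_pow]
    exact Nat.pow_le_pow_left (by nlinarith) 2
  have hfin : ∀ (s' : RamState) (T : ℕ), (RamProg.ite (.reg 14) (.seq (layersProg
      (tδ.compile varReg 14) (tφ.compile varReg 14)) (.set 0 (.reg 5))) (.set 0 (.const 0))).Reaches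
      s5 s' T → T ≤ 20 * Q L + (4 * L + 3) * ((2 * L + 4) * mainBound n k * Y L) →
      (instanceProg (tw.compile varReg 14) (tv.compile varReg 14) (tδ.compile varReg 14)
        (tφ.compile varReg 14)).Reaches s0 s' (mainBound n k * (6 * (L + 1) ^ 2 + fw (B L) +
          fv (B L) + 40 * Q L + (4 * L + 3) * ((2 * L + 4) * Y L))) := by
    intro s' T h hT
    refine (e1.seq (e2.seq (e3.seq (e4.seq (e5.seq h))))).mono ?_
    have i1 : fw (B L) ≤ mainBound n k * fw (B L) := Nat.le_mul_of_pos_left _ hM1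
    have i2 : fv (B L) ≤ mainBound n k * fv (B L) := Nat.le_mul_of_pos_left _ hM1
    have i3 : Q L ≤ mainBound n k * Q L := Nat.le_mul_of_pos_left _ hM1
    have i4 : mainBound n k * (6 * (L + 1) ^ 2 + fw (B L) +
          fv (B L) + 40 * Q L + (4 * L + 3) * ((2 * L + 4) * Y L)) =
        6 * (mainBound n k * (L + 1) ^ 2) + mainBound n k * fw (B L) + mainBound n k * fv (B L) +
          40 * (mainBound n k * Q L) + (4 * L + 3) * ((2 * L + 4) * mainBound n k * Y L) := by ring
    rw [i4]
    generalize (4 * L + 3) * ((2 * L + 4) * mainBound n k * Y L) = Z at hT ⊢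
    omega
  by_cases hx : ValidInput L n n.size (wordBit x)
  · have v14 : s5.reg 14 = 1 := htv'.1 hx
    set Al := AtomAllowed L n n.size (wordBit x) with hAl
    have hB : Bounded (B L) n (params L n k' n.size) (finalIndicator n) (layerStates n k' Al)
      (stateCount n k' Al) := bounded (by omega)
    obtain ⟨s6, e6, v6⟩ := layersProg_reaches hB (layeredCount n k' Al)
      ((hδ (B L) _ _ hp4 hA).congr fun y c => by
        rw [htδ _ _ _ rfl]
        rfl)
      ((hφ (B L) _ _ hp4 hA).congr fun y c => by
        have := htφ (params L n k' n.size) (wordBit x) (fun i => if i = 0 then y else c) rfl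
        unfold finalIndicator
        split_ifs with h
        · exact this.1 h
        · exact this.2 h)
      (card_layerStates_le_mainBound n k Al) hE5
      (by rw [r5 _ (by omega), r4 _ (by omega) (by omega)])
      (by rw [r5 _ (by omega), r4 _ (by omega) (by omega)])
      (by rw [r5 _ (by omega), r4 _ (by omega) (by omega)])
      (fun i => by rw [m5]; simp only [s4, RamState.mem_setReg, m3]; exact hm2 _ _ (by omega))
      (fun i => by rw [m5]; simp only [s4, RamState.mem_setReg, m3]; exact hm2 _ _ (by omega))
    have hres : s6.reg 5 = kCSPAllenCount x n k := by
      rw [v6, sum_layerTotal, kCSPAllenCount_eq_finalCount hx]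
      rfl
    have htot : s6.reg 5 < 2 ^ B L := by rw [v6]; exact hB.total
    refine ⟨s6.setReg 0 (s6.reg 5), hfin _ _ (.ite_pos (b := B L) ?_ ?_ (e6.seq
      (.set_eq (b := B L) (c := 2) 0 rfl ?_ ?_))) ?_, by simp [hres], ?_⟩
    · simp only [RamExpr.Fits, v14]; exact hsz (by omega)
    · simp [RamExpr.eval, v14]
    · simpa only [RamExpr.Fits, Nat.size_le] using htot
    · simp [RamExpr.nodes]
    · have j1 : (2 * n + 1) * mainBound n k + 3 ≤ (2 * L + 4) * mainBound n k := by nlinarith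
      have j2 : fφ (B L) + 70 * (B L + 1) ^ 2 + (2 * n + 2) * (fδ (B L) + 90 * (B L + 1) ^ 2) ≤
          Y L := Nat.add_le_add_left (Nat.mul_le_mul_right _ (by omega)) _
      have j3 := Nat.mul_le_mul (show 4 * n + 3 ≤ 4 * L + 3 by omega) (Nat.mul_le_mul j1 j2)
      simp only [RamExpr.nodes]
      change 1 * Q L + (_ + 2 * Q L + 1) + 1 ≤ _
      omega
    · simpa [Nat.size_le] using htot
  · have v14 : s5.reg 14 = 0 := htv'.2 hx
    refine ⟨s5.setReg 0 0, hfin _ _ (.ite_neg (b := B L) ?_ ?_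
      (.set_eq (b := B L) (c := 2) 0 rfl ?_ ?_)) ?_, ?_, ?_⟩
    · simp [RamExpr.Fits, v14]
    · simp [RamExpr.eval, v14]
    · simp [RamExpr.Fits]
    · simp [RamExpr.nodes]
    · simp only [RamExpr.nodes]
      change 1 * Q L + 2 * Q L + 1 ≤ _
      omega
    · rw [kCSPAllenCount_eq_zero hx]; simp
    · simp

/-- One program counts the solutions within the main time bound, up to a polynomial factor. -/
theorem exists_countProg : ∃ (P : RamProg) (g : ℕ → ℕ), PolyBounded g ∧
    ∀ (x : List Bool) (n k : ℕ), ∃ s', P.Reaches (RamState.init x n k) s'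
        (mainBound n k * g x.length) ∧ s'.reg 0 = kCSPAllenCount x n k ∧
        (s'.reg 0).size ≤ bitBound x.length := by
  obtain ⟨Pw, Pv, Pδ, Pφ, g, hg, h⟩ := instanceProg_reaches
  refine ⟨countProg Pw Pv Pδ Pφ, fun L => 40 * (L + 3) ^ 2 + g L + 1,
    ((PolyBounded.mul (.const 40) ((PolyBounded.add .id (.const 3)).pow 2)).add hg).add (.const 1),
    fun x n k => ?_⟩
  set L := x.length with hL
  have hM1 := one_le_mainBound n k
  set b := n.size + L + 2 with hb
  have hfit : RamExpr.Fits b (RamState.init x n k) (.sub (.add (.reg 1) (.const 1)) (.reg 0)) := by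
    have h1 := Nat.size_add_le n 1
    have h2 := Nat.size_le_self x.length
    simp only [RamExpr.Fits, RamExpr.eval, RamState.init]
    simp only [Nat.size_one] at *
    norm_num
    omega
  have hcost : (b + 1) ^ 2 ≤ 4 * (mainBound n k * (L + 3) ^ 2) := by
    rw [← mul_assoc]
    refine le_trans ?_ (Nat.mul_le_mul_right _ (sq_size_le_four_mul_mainBound n k))
    rw [← mul_pow]
    exact Nat.pow_le_pow_left (by rw [hb]; nlinarith) 2
  have hexp : mainBound n k * (40 * (L + 3) ^ 2 + g L + 1) =
      40 * (mainBound n k * (L + 3) ^ 2) + mainBound n k * g L + mainBound n k := by ring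
  have hQ : 1 ≤ (b + 1) ^ 2 := Nat.one_le_pow _ _ (by omega)
  rw [hexp]
  rcases Nat.lt_or_ge L (n + 1) with hn | hn
  · refine ⟨(RamState.init x n k).setReg 0 0, (RamProg.Reaches.ite_pos hfit ?_
      (.set_eq (b := b) (c := 2) 0 rfl ?_ ?_)).mono ?_, ?_, ?_⟩
    · simp [RamExpr.eval, RamState.init]; omega
    · simp [RamExpr.Fits]
    · simp [RamExpr.nodes]
    · simp only [RamExpr.nodes]; omega
    · rw [kCSPAllenCount_eq_zero fun hx => by have := hx.1; omega]
      simp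
    · simp
  · obtain ⟨s', e, h1, h2⟩ := h x n k hn
    rw [← hL] at e
    refine ⟨s', (RamProg.Reaches.ite_neg hfit ?_ e).mono ?_, h1, h2⟩
    · simp [RamExpr.eval, RamState.init]; omega
    · simp only [RamExpr.nodes]; omega

/-- The decision program replaces a positive count by `1`. -/
theorem exists_decisionProg : ∃ (P : RamProg) (g : ℕ → ℕ), PolyBounded g ∧
    ∀ (x : List Bool) (n k : ℕ), ∃ s', P.Reaches (RamState.init x n k) s'
        (mainBound n k * g x.length) ∧
        s'.reg 0 = if kCSPAllenCount x n k = 0 then 0 else 1 := by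
  obtain ⟨P, g, hg, h⟩ := exists_countProg
  refine ⟨.seq P (.ite (.reg 0) (.set 0 (.const 1)) .skip),
    fun L => g L + 5 * (bitBound L + 1) ^ 2, hg.add (.mul (.const 5)
      ((polyBounded_bitBound.add (.const 1)).pow 2)), fun x n k => ?_⟩
  obtain ⟨s', e, h1, h2⟩ := h x n k
  set b := bitBound x.length with hb
  have hQ : 1 ≤ (b + 1) ^ 2 := Nat.one_le_pow _ _ (by omega)
  have hM1 : (b + 1) ^ 2 ≤ mainBound n k * (b + 1) ^ 2 :=
    Nat.le_mul_of_pos_left _ (one_le_mainBound n k)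
  rw [show mainBound n k * (g x.length + 5 * (b + 1) ^ 2) =
    mainBound n k * g x.length + 5 * (mainBound n k * (b + 1) ^ 2) by ring]
  have hb1 : 1 ≤ b := by rw [hb]; unfold bitBound; nlinarith
  by_cases h0 : kCSPAllenCount x n k = 0
  · refine ⟨s', (e.seq (.ite_neg (b := b) (show RamExpr.Fits b s' (.reg 0) from h2) ?_ (.skip _))).mono ?_, by rw [if_pos h0, h1, h0]⟩
    · simp [RamExpr.eval, h1, h0]
    · simp only [RamExpr.nodes]; omega
  · refine ⟨s'.setReg 0 1, (e.seq (.ite_pos (b := b) (show RamExpr.Fits b s' (.reg 0) from h2) ?_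
      (.set_eq (b := b) (c := 2) 0 rfl ?_ ?_))).mono ?_, by simp [h0]⟩
    · simp [RamExpr.eval, h1, h0]
    · simp [RamExpr.Fits, hb1]
    · simp [RamExpr.nodes]
    · simp only [RamExpr.nodes]; omega

end AllenDP

/-! ### The time bounds -/

namespace AllenDP

/-- A power of `n` is bounded by `2 ^ n` up to a factor that depends on the exponent only. -/
theorem pow_le_mul_two_pow (n m : ℕ) : max n 1 ^ m ≤ m ^ m * 2 ^ (n + m) := by
  calc max n 1 ^ m ≤ (n + m + 1 - m) ^ m := Nat.pow_le_pow_left (by omega) m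
    _ ≤ (n + m).descFactorial m := Nat.pow_sub_le_descFactorial _ _
    _ = m.factorial * (n + m).choose m := Nat.descFactorial_eq_factorial_mul_choose _ _
    _ ≤ m ^ m * 2 ^ (n + m) := Nat.mul_le_mul (Nat.factorial_le_pow m) (Nat.choose_le_two_pow _ _)

/-- The main time bound separates into a factor in `k` and a single exponential in `n`. -/
theorem mainBound_le (n k : ℕ) :
    mainBound n k ≤ (2 * k) ^ (2 * k) * (2 * k) ^ (2 * k) * 2 ^ (2 * k) * 2 ^ (2 * n) := by
  unfold mainBound
  rw [show 2 * max n 1 * k = 2 * k * max n 1 by ring, mul_pow]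
  calc (2 * k) ^ (2 * k) * max n 1 ^ (2 * k) * 2 ^ n
      ≤ (2 * k) ^ (2 * k) * ((2 * k) ^ (2 * k) * 2 ^ (n + 2 * k)) * 2 ^ n :=
        Nat.mul_le_mul_right _ (Nat.mul_le_mul_left _ (pow_le_mul_two_pow n (2 * k)))
    _ = _ := by rw [pow_add, two_mul n, pow_add]; ring

/-- The factor in `mainBound_le` that depends on `k` only is computable. -/
theorem computable_coarseFactor :
    Computable fun k : ℕ => (2 * k) ^ (2 * k) * (2 * k) ^ (2 * k) * 2 ^ (2 * k) := by
  have hpow : Primrec₂ ((· ^ ·) : ℕ → ℕ → ℕ) := Primrec₂.unpaired'.1 Nat.Primrec.pow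
  have h2k : Primrec fun k : ℕ => 2 * k := Primrec.nat_mul.comp (Primrec.const 2) Primrec.id
  have h1 := hpow.comp h2k h2k
  exact (Primrec.nat_mul.comp (Primrec.nat_mul.comp h1 h1)
    (hpow.comp (Primrec.const 2) h2k)).to_comp

end AllenDP

open AllenDP in
theorem mainTheorem1 :
    (∃ p : Polynomial ℕ, SolvableInTime kCSPAllen fun x n k =>
      (2 * max n 1 * k) ^ (2 * k) * 2 ^ n * p.eval x.length) ∧
    (∃ p : Polynomial ℕ, ComputableInTime kCSPAllenCount fun x n k =>
      (2 * max n 1 * k) ^ (2 * k) * 2 ^ n * p.eval x.length) ∧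
    kCSPAllen ∈ FPE := by
  classical
  obtain ⟨P, g, hg, hP⟩ := exists_countProg
  obtain ⟨P', g', hg', hP'⟩ := exists_decisionProg
  obtain ⟨p, hp⟩ := hg.exists_polynomial
  obtain ⟨p', hp'⟩ := hg'.exists_polynomial
  have hdec : SolvableInTime kCSPAllen fun x n k => mainBound n k * p'.eval x.length := by
    refine ⟨P', fun x n k => ?_⟩
    obtain ⟨s, ⟨t, ht, hr⟩, hs⟩ := hP' x n k
    refine ⟨s, t, hr, ?_, ht.trans (Nat.mul_le_mul_left _ (hp' _))⟩
    rw [hs]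
    have := mem_kCSPAllen_iff x n k
    beta_reduce
    by_cases h : kCSPAllenCount x n k = 0
    · rw [if_pos h, if_neg (by rw [this]; exact fun h' => h' h)]
    · rw [if_neg h, if_pos (this.2 h)]
  refine ⟨⟨p', hdec⟩, ⟨p, P, fun x n k => ?_⟩, _, computable_coarseFactor, 2, p', ?_⟩
  · obtain ⟨s, ⟨t, ht, hr⟩, hs, -⟩ := hP x n k
    exact ⟨s, t, hr, hs, ht.trans (Nat.mul_le_mul_left _ (hp _))⟩
  · obtain ⟨Q, hQ⟩ := hdec
    refine ⟨Q, fun x n k => ?_⟩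
    obtain ⟨s, t, hr, hs, ht⟩ := hQ x n k
    exact ⟨s, t, hr, hs, ht.trans (Nat.mul_le_mul_right _ (mainBound_le n k))⟩
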